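/- Let $n\ge 2$ and let $f\in\mathbb{R}[x_1,\dots,x_n]$ be a polynomial of total degree four that is invariant under the hyperoctahedral group $CB_n$ of all signed permutation matrices (equivalently, a polynomial of degree four of the form $f=A\sum_{i<j}x_i^2x_j^2+B\big(\sum_i x_i^2\big)^2+C\sum_i x_i^2+D$ with $A,B,C,D\in\mathbb{R}$). Let $X=\{x\in\mathbb{R}^n : f(x)=0\}$ be its real zero locus with the topology induced from $\mathbb{R}^n$, and assume that $X$ has no isolated points (as is the case when $X$ is an $(n-1)$-dimensional manifold). Let $\mathbb{A}$ be a nonzero unital commutative ring, and let $b_i=\dim H_i(X,\mathbb{A})$ be the $i$-th Betti number, that is, the rank of the $i$-th singular homology module $H_i(X,\mathbb{A})$ over $\mathbb{A}$. In each of the following three cases all the modules $H_i(X,\mathbb{A})$, $i\ge 0$, are free, and the following holds. 1. If $X$ has exactly $2^n+1$ connected components, then $b_0=2^n+1$, $b_{n-1}=1$, and $b_i=0$ for all $i\notin\{0,n-1\}$. 2. If exactly $2^n$ of the connected components of $X$ are compact, then $b_0=b_{n-1}=2^n$, and $b_i=0$ for all $i\notin\{0,n-1\}$. 3. If exactly $2$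 of the connected components of $X$ are compact, then $b_0=b_{n-1}=2$, and $b_i=0$ for all $i\notin\{0,n-1\}$. -/

import Mathlib

universe u

namespace CBQuartic

/-- A signed permutation matrix: a real monomial matrix (exactly one nonzero entry in every row
and in every column) whose nonzero entries are `1` or `-1`. These matrices form the
hyperoctahedral group `CB_n`. -/
def IsSignedPermutation {n : ℕ} (g : Matrix (Fin n) (Fin n) ℝ) : Prop :=
  (∀ i, ∃! j, g i j ≠ 0) ∧ (∀ j, ∃! i, g i j ≠ 0) ∧ ∀ i j, g i j ≠ 0 → g i j = 1 ∨ g i j = -1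

/-- `f` belongs to the ring of invariants `ℝ[V]^{CB_n}`, `V = ℝⁿ`: `f (g v) = f v` for every `g` in
`CB_n` and every `v`. (Polynomials over `ℝ` are determined by their values, and the set of signed
permutation matrices is closed under inverses.) -/
def IsCBInvariant {n : ℕ} (f : MvPolynomial (Fin n) ℝ) : Prop :=
  ∀ g : Matrix (Fin n) (Fin n) ℝ, IsSignedPermutation g →
    ∀ v : Fin n → ℝ, MvPolynomial.eval (g.mulVec v) f = MvPolynomial.eval v f

/-- The real zero locus `Z(f) ⊆ ℝⁿ`. As a type, it carries the topology induced from `ℝⁿ`. -/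
def zeroLocus {n : ℕ} (f : MvPolynomial (Fin n) ℝ) : Set (Fin n → ℝ) :=
  {x | MvPolynomial.eval x f = 0}

/-- The number of connected components of `X`, a cardinal. -/
noncomputable def numComponents (X : Type) [TopologicalSpace X] : Cardinal :=
  Cardinal.mk (ConnectedComponents X)

/-- The number of compact connected components of `X`, a cardinal; the connected component
named `c` is the fibre over `c` of the quotient map `X → ConnectedComponents X`. -/
noncomputable def numCompactComponents (X : Type) [TopologicalSpace X] : Cardinal :=
  Cardinal.mk {c : ConnectedComponents X //
    IsCompact ((ConnectedComponents.mk : X → ConnectedComponents X) ⁻¹' {c})}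

/-- Singular homology `H_i(X, A)` with coefficients in the commutative ring `A`, as an
`A`-module. -/
noncomputable def singularHomology (A : Type u) [CommRing A] (X : Type) [TopologicalSpace X]
    (i : ℕ) : ModuleCat.{u} A :=
  ((AlgebraicTopology.singularHomologyFunctor (ModuleCat.{u} A) i).obj (ModuleCat.of A A)).obj
    (TopCat.of X)

/-- The `i`-th Betti number `b_i = dim H_i(X, A)`: the rank of the `A`-module `H_i(X, A)`,
a cardinal. -/
noncomputable def bettiNumber (A : Type u) [CommRing A] (X : Type) [TopologicalSpace X]
    (i : ℕ) : Cardinal.{u} :=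
  Module.rank A (singularHomology A X i)

end CBQuartic

/-!
# Betti numbers of zero loci of invariant quartics

Averaging over signs and permutations shows that an invariant polynomial of degree four is
`α ∑ x_k⁴ + β (∑ x_k²)² + γ ∑ x_k² + δ` (`isInvariantQuartic_eval`). If `δ = 0`, its zero locus is a
cone or has the origin as an isolated point. If `δ ≠ 0`, the direction `u = x / |x|` and
`w = 1 / |x|²` identify it with the set `{(u, w) : w > 0, (w - w₀)² = h u}`, where `u` runs through
the unit sphere and `h = a - b ∑ u_k⁴` (`quarticLocusHomeomorph`): two sheets `w = w₀ ± √(h u)` over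
`{h ≥ 0}`, glued along `{h = 0}` and cut off at height zero (`Sheets`).

The function `h` has its extrema at the centres of the `2^n` orthants and at the `2n` unit vectors
`± e_j`. From every point of an orthant, and from every point of the cone of points closest to some
`± e_j`, straight segments in the coordinates `u_k²` lead to extrema of both kinds, monotonically in
`h` and inside the same piece (`peakCover_orthant`, `peakCover_cone`). Lifting these paths to the
sheets bounds the number of components, and shows that components that reach down to height zero
are not compact. Comparing the extrema `m ≤ M` of `h` with `0` and `w₀²`, only three
configurations are left (`Sheets.bettiDetermined`):

* `0 < m ≤ M < w₀²`: two disjoint copies of the sphere;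
* `m ≤ 0 < M < w₀²`: either there is one component, or the parts over the orthants or cones are
  pairwise disjoint. Over the orthants, each part is an ellipsoid in the coordinates `u_k² / w`
  (`Sheets.isConnectedSphere_piece`); the cones matter only when `n = 2`, and are then exchanged with
  the orthants by a reflection;
* `0 < m < w₀² ≤ M`: the upper sheet is a sphere, no component of the lower sheet is compact, and
  if the number of components is `2^n + 1`, then the lower sheet consists of one part over each
  orthant, convex in the coordinates `u_k²`.

In each of them the components are, up to homotopy, spheres or points. To compute their homology,
augmented singular chains are set up by hand (`Chain`, with `Chain.RedHomology`) and compared with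
Mathlib's singular homology (`Chain.nonempty_singularHomology_equiv`). Barycentric subdivision
proves that a cover by two acyclic open sets shifts the degree
(`Chain.nonempty_equiv_of_acyclic_cover`); homotopy invariance is taken from Mathlib. Covering
`ℝ^(m+1)` without the origin by two slit spaces then gives the homology of spheres by induction
(`Chain.isHomologySphere_punctured`). The homology of a finite disjoint union is assembled from that
of its parts in `Chain.hasBetti_of_isLocallyConstant`.
-/

noncomputable section

/-! ### Chains on ordered lists of points -/

namespace ListChain

variable (A : Type u) [CommRing A] {Y Y' : Type}

/-- Formal `A`-linear combinations of lists of `n` points of `Y`. -/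
abbrev Lists (Y : Type) (n : ℕ) : Type u := (Fin n → Y) →₀ A

/-- The alternating sum of the lists obtained by omitting one entry. -/
def bd (n : ℕ) : Lists A Y (n + 1) →ₗ[A] Lists A Y n :=
  Finsupp.linearCombination A fun v =>
    ∑ i : Fin (n + 1), (-1 : A) ^ (i : ℕ) • Finsupp.single (fun j => v (i.succAbove j)) 1

/-- The cone with apex `p`: prepend `p` to every list. -/
def cone (p : Y) (n : ℕ) : Lists A Y n →ₗ[A] Lists A Y (n + 1) :=
  Finsupp.lmapDomain A A fun v => (Fin.cons p v : Fin (n + 1) → Y)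

/-- The map induced on lists by a map of points. -/
def push (φ : Y → Y') (n : ℕ) : Lists A Y n →ₗ[A] Lists A Y' n :=
  Finsupp.lmapDomain A A fun v => φ ∘ v

variable {A}

lemma bd_single (n : ℕ) (v : Fin (n + 1) → Y) (a : A) :
    bd A n (Finsupp.single v a) =
      ∑ i : Fin (n + 1), (-1 : A) ^ (i : ℕ) • Finsupp.single (fun j => v (i.succAbove j)) a := by
  simp only [bd, Finsupp.linearCombination_single, Finset.smul_sum, Finsupp.smul_single,
    smul_eq_mul, mul_one]
  exact Finset.sum_congr rfl fun i _ => by rw [mul_comm]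

@[simp] lemma cone_single (p : Y) (n : ℕ) (v : Fin n → Y) (a : A) :
    cone A p n (Finsupp.single v a) = Finsupp.single (Fin.cons p v : Fin (n + 1) → Y) a := by
  simp [cone]

@[simp] lemma push_single (φ : Y → Y') (n : ℕ) (v : Fin n → Y) (a : A) :
    push A φ n (Finsupp.single v a) = Finsupp.single (φ ∘ v) a := by
  simp [push]

lemma bd_cone_zero (p : Y) (c : Lists A Y 0) : bd A 0 (cone A p 0 c) = c := by
  induction c using Finsupp.induction_linear with
  | zero => simp
  | add f g hf hg => simp [hf, hg]
  | single v a =>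
    rw [cone_single, bd_single]
    rw [Fin.sum_univ_one, Fin.val_zero, pow_zero, one_smul]
    congr 1

lemma bd_cone_succ (p : Y) (n : ℕ) (c : Lists A Y (n + 1)) :
    bd A (n + 1) (cone A p (n + 1) c) = c - cone A p n (bd A n c) := by
  induction c using Finsupp.induction_linear with
  | zero => simp
  | add f g hf hg => simp only [map_add, hf, hg]; abel
  | single v a =>
    rw [cone_single, bd_single, Fin.sum_univ_succ, bd_single, map_sum, sub_eq_add_neg,
      ← Finset.sum_neg_distrib]
    congr 1
    · simp
    · refine Finset.sum_congr rfl fun i _ => ?_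
      rw [map_smul, cone_single, Fin.val_succ, pow_succ, mul_neg_one, neg_smul]
      congr 3
      funext j
      refine Fin.cases ?_ (fun j => ?_) j <;> simp

lemma bd_bd (n : ℕ) (c : Lists A Y (n + 2)) : bd A n (bd A (n + 1) c) = 0 := by
  induction n with
  | zero =>
    induction c using Finsupp.induction_linear with
    | zero => simp
    | add f g hf hg => simp only [map_add, hf, hg, add_zero]
    | single v a =>
      have : Finsupp.single v a =
          cone A (v 0) 1 (Finsupp.single (fun i => v i.succ) a) := by
        rw [cone_single]; congr 1; exact (Fin.cons_self_tail v).symm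
      rw [this, bd_cone_succ, map_sub, bd_cone_zero, sub_self]
  | succ n ih =>
    induction c using Finsupp.induction_linear with
    | zero => simp
    | add f g hf hg => simp only [map_add, hf, hg, add_zero]
    | single v a =>
      have : Finsupp.single v a =
          cone A (v 0) (n + 2) (Finsupp.single (fun i => v i.succ) a) := by
        rw [cone_single]; congr 1; exact (Fin.cons_self_tail v).symm
      rw [this, bd_cone_succ, map_sub, bd_cone_succ, ih, map_zero, sub_zero, sub_self]

lemma bd_push (φ : Y → Y') (n : ℕ) (c : Lists A Y (n + 1)) :
    bd A n (push A φ (n + 1) c) = push A φ n (bd A n c) := by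
  induction c using Finsupp.induction_linear with
  | zero => simp
  | add f g hf hg => simp only [map_add, hf, hg]
  | single v a =>
    simp only [push_single, bd_single, map_sum, map_smul]
    rfl

lemma push_cone (φ : Y → Y') (p : Y) (n : ℕ) (c : Lists A Y n) :
    push A φ (n + 1) (cone A p n c) = cone A (φ p) n (push A φ n c) := by
  induction c using Finsupp.induction_linear with
  | zero => simp
  | add f g hf hg => simp only [map_add, hf, hg]
  | single v a =>
    simp only [push_single, cone_single]
    congr 1
    funext j
    refine Fin.cases ?_ (fun j => ?_) j <;> simp

variable (A)

/-- Barycentric subdivision of lists, relative to a choice `b` of a "centre" for each nonempty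
list: the cone from the centre over the subdivided boundary. -/
def sd (b : ∀ n, (Fin (n + 1) → Y) → Y) : ∀ n, Lists A Y n →ₗ[A] Lists A Y n
  | 0 => LinearMap.id
  | n + 1 => Finsupp.linearCombination A fun v =>
      cone A (b n v) n (sd b n (bd A n (Finsupp.single v 1)))

/-- The chain homotopy between the identity and the subdivision `sd`. -/
def homot (b : ∀ n, (Fin (n + 1) → Y) → Y) : ∀ n, Lists A Y n →ₗ[A] Lists A Y (n + 1)
  | 0 => 0
  | n + 1 => Finsupp.linearCombination A fun v =>
      cone A (b n v) (n + 1) (Finsupp.single v 1 - homot b n (bd A n (Finsupp.single v 1)))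

variable {A} (b : ∀ n, (Fin (n + 1) → Y) → Y) (b' : ∀ n, (Fin (n + 1) → Y') → Y')

lemma sd_single_succ (n : ℕ) (v : Fin (n + 1) → Y) :
    sd A b (n + 1) (Finsupp.single v 1) =
      cone A (b n v) n (sd A b n (bd A n (Finsupp.single v 1))) := by
  simp [sd]

lemma homot_single_succ (n : ℕ) (v : Fin (n + 1) → Y) :
    homot A b (n + 1) (Finsupp.single v 1) =
      cone A (b n v) (n + 1) (Finsupp.single v 1 - homot A b n (bd A n (Finsupp.single v 1))) := by
  simp [homot]

/-- Two linear maps on lists agree if they agree on every single list. -/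
lemma Lists.hom_ext {n : ℕ} {M : Type*} [AddCommGroup M] [Module A M] {f g : Lists A Y n →ₗ[A] M}
    (h : ∀ v, f (Finsupp.single v 1) = g (Finsupp.single v 1)) : f = g :=
  Finsupp.lhom_ext' fun v => LinearMap.ext_ring (h v)

lemma bd_sd (n : ℕ) (c : Lists A Y (n + 1)) :
    bd A n (sd A b (n + 1) c) = sd A b n (bd A n c) := by
  induction n with
  | zero =>
    refine LinearMap.congr_fun (f := bd A 0 ∘ₗ sd A b 1) (g := sd A b 0 ∘ₗ bd A 0)
      (Lists.hom_ext fun v => ?_) c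
    simp only [LinearMap.comp_apply, sd_single_succ, bd_cone_zero]
  | succ n ih =>
    refine LinearMap.congr_fun (f := bd A (n + 1) ∘ₗ sd A b (n + 2))
      (g := sd A b (n + 1) ∘ₗ bd A (n + 1)) (Lists.hom_ext fun v => ?_) c
    simp only [LinearMap.comp_apply]
    rw [sd_single_succ, bd_cone_succ, ih, bd_bd, map_zero, map_zero, sub_zero]

lemma bd_homot_zero (c : Lists A Y 0) : bd A 0 (homot A b 0 c) = c - sd A b 0 c := by
  simp [homot, sd]

lemma bd_homot_succ (n : ℕ) (c : Lists A Y (n + 1)) :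
    bd A (n + 1) (homot A b (n + 1) c) = c - sd A b (n + 1) c - homot A b n (bd A n c) := by
  induction n with
  | zero =>
    refine LinearMap.congr_fun (f := bd A 1 ∘ₗ homot A b 1)
      (g := LinearMap.id - sd A b 1 - homot A b 0 ∘ₗ bd A 0) (Lists.hom_ext fun v => ?_) c
    simp only [LinearMap.comp_apply, LinearMap.sub_apply, LinearMap.id_apply]
    rw [homot_single_succ, bd_cone_succ, sd_single_succ]
    simp [homot, sd]
  | succ n ih =>
    refine LinearMap.congr_fun (f := bd A (n + 2) ∘ₗ homot A b (n + 2))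
      (g := LinearMap.id - sd A b (n + 2) - homot A b (n + 1) ∘ₗ bd A (n + 1))
      (Lists.hom_ext fun v => ?_) c
    simp only [LinearMap.comp_apply, LinearMap.sub_apply, LinearMap.id_apply]
    rw [homot_single_succ, bd_cone_succ, sd_single_succ, map_sub (bd A (n + 1)), ih, bd_bd]
    simp only [map_zero, sub_zero, sub_sub_cancel]
    abel

variable {b b'}

lemma push_sd (φ : Y → Y') (hφ : ∀ n v, φ (b n v) = b' n (φ ∘ v)) (n : ℕ) (c : Lists A Y n) :
    push A φ n (sd A b n c) = sd A b' n (push A φ n c) := by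
  induction n with
  | zero => rfl
  | succ n ih =>
    refine LinearMap.congr_fun (f := push A φ (n + 1) ∘ₗ sd A b (n + 1))
      (g := sd A b' (n + 1) ∘ₗ push A φ (n + 1)) (Lists.hom_ext fun v => ?_) c
    simp only [LinearMap.comp_apply]
    rw [sd_single_succ, push_cone, ih, ← bd_push, push_single, sd_single_succ, hφ]

lemma push_homot (φ : Y → Y') (hφ : ∀ n v, φ (b n v) = b' n (φ ∘ v)) (n : ℕ) (c : Lists A Y n) :
    push A φ (n + 1) (homot A b n c) = homot A b' n (push A φ n c) := by
  induction n with
  | zero => simp [homot]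
  | succ n ih =>
    refine LinearMap.congr_fun (f := push A φ (n + 2) ∘ₗ homot A b (n + 1))
      (g := homot A b' (n + 1) ∘ₗ push A φ (n + 1)) (Lists.hom_ext fun v => ?_) c
    simp only [LinearMap.comp_apply]
    rw [homot_single_succ, push_cone, map_sub, ih, ← bd_push, push_single, homot_single_succ, hφ]

end ListChain

end

noncomputable section

/-! ### Affine maps of standard simplices -/

/-- The standard simplex with `n` vertices (empty for `n = 0`). -/
abbrev Simplex (n : ℕ) : Type := stdSimplex ℝ (Fin n)

namespace Simplex

variable {k m n : ℕ}

/-- The affine map of simplices that sends the `i`-th vertex to `v i`. -/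
def aff (v : Fin m → Simplex n) : C(Simplex m, Simplex n) where
  toFun t := ⟨fun k => ∑ i, t i * v i k,
    fun k => Finset.sum_nonneg fun i _ => mul_nonneg (t.2.1 i) ((v i).2.1 k), by
      rw [Finset.sum_comm]
      simp only [← Finset.mul_sum, stdSimplex.sum_eq_one, mul_one]⟩
  continuous_toFun := by
    refine Continuous.subtype_mk (continuous_pi fun k => ?_) _
    refine continuous_finsetSum _ fun i _ => Continuous.mul ?_ continuous_const
    exact (continuous_apply i).comp continuous_subtype_val

lemma aff_apply (v : Fin m → Simplex n) (t : Simplex m) (k : Fin n) :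
    aff v t k = ∑ i, t i * v i k := rfl

/-- The list of vertices of the standard simplex. -/
def vert (n : ℕ) (i : Fin n) : Simplex n := stdSimplex.vertex i

lemma vert_apply (i k : Fin n) : vert n i k = if k = i then 1 else 0 := by
  simp [vert, Pi.single_apply]

@[simp] lemma aff_vert (v : Fin m → Simplex n) (i : Fin m) : aff v (vert m i) = v i := by
  ext k
  simp [aff_apply, vert_apply]

lemma aff_vert_id : aff (vert n) = ContinuousMap.id _ := by
  ext t k
  simp [aff_apply, vert_apply]

lemma aff_aff (v : Fin m → Simplex n) (w : Fin k → Simplex m) (t : Simplex k) :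
    aff v (aff w t) = aff (fun i => aff v (w i)) t := by
  ext j
  simp only [aff_apply, Finset.sum_mul, Finset.mul_sum]
  rw [Finset.sum_comm]
  simp only [mul_assoc]

lemma aff_comp_aff (v : Fin m → Simplex n) (w : Fin k → Simplex m) :
    (aff v).comp (aff w) = aff (fun i => aff v (w i)) :=
  ContinuousMap.ext fun t => aff_aff v w t

/-- The inclusion of the `i`-th face. -/
def face (n : ℕ) (i : Fin (n + 1)) : C(Simplex n, Simplex (n + 1)) :=
  aff fun j => vert (n + 1) (i.succAbove j)

/-- The barycentre of a list of points in a simplex. -/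
def bary (m n : ℕ) (v : Fin (n + 1) → Simplex m) : Simplex m := aff v stdSimplex.barycenter

lemma aff_bary (v : Fin m → Simplex k) (n : ℕ) (w : Fin (n + 1) → Simplex m) :
    aff v (bary m n w) = bary k n (aff v ∘ w) := aff_aff _ _ _

/-- A point of an affine simplex is no further from `q` than the average, with the barycentric
coordinates as weights, of the distances of the vertices. -/
lemma dist_aff_le (v : Fin m → Simplex n) (t : Simplex m) (q : Simplex n) :
    dist (aff v t) q ≤ ∑ i, t i * dist (v i) q := by
  have h0 : 0 ≤ ∑ i, t i * dist (v i) q :=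
    Finset.sum_nonneg fun i _ => mul_nonneg (t.2.1 i) dist_nonneg
  rw [Subtype.dist_eq, dist_pi_le_iff h0]
  intro k
  have hq : q k = ∑ i, t i * q k := by
    rw [← Finset.sum_mul, stdSimplex.sum_eq_one, one_mul]
  change |(∑ i, t i * v i k) - q k| ≤ _
  rw [hq, ← Finset.sum_sub_distrib]
  refine (Finset.abs_sum_le_sum_abs _ _).trans (Finset.sum_le_sum fun i _ => ?_)
  rw [← mul_sub, abs_mul, abs_of_nonneg (stdSimplex.zero_le t i)]
  refine mul_le_mul_of_nonneg_left ?_ (t.2.1 i)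
  exact dist_le_pi_dist (v i : Fin n → ℝ) q k

lemma dist_aff_le_of_forall (v : Fin m → Simplex n) (t : Simplex m) (q : Simplex n) {d : ℝ}
    (h : ∀ i, dist (v i) q ≤ d) : dist (aff v t) q ≤ d := by
  refine (dist_aff_le v t q).trans ?_
  calc ∑ i, t i * dist (v i) q ≤ ∑ i, t i * d :=
        Finset.sum_le_sum fun i _ => mul_le_mul_of_nonneg_left (h i) (t.2.1 i)
    _ = d := by rw [← Finset.sum_mul, stdSimplex.sum_eq_one, one_mul]

/-- The barycentre is closer to every point of the simplex than the diameter, by a fixed factor. -/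
lemma dist_bary_le (v : Fin (n + 1) → Simplex m) (t : Simplex (n + 1)) {d : ℝ}
    (h : ∀ i j, dist (v i) (v j) ≤ d) : dist (aff v t) (bary m n v) ≤ n / (n + 1) * d := by
  refine dist_aff_le_of_forall v t _ fun j => ?_
  rw [dist_comm]
  refine (dist_aff_le v _ _).trans ?_
  have hb : ∀ i, (stdSimplex.barycenter : Simplex (n + 1)) i = ((n : ℝ) + 1)⁻¹ := by
    intro i
    show ((Fintype.card (Fin (n + 1)) : ℝ))⁻¹ = _
    simp
  simp only [hb, ← Finset.mul_sum]
  rw [div_eq_inv_mul, mul_assoc]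
  refine mul_le_mul_of_nonneg_left ?_ (by positivity)
  rw [← Finset.add_sum_erase _ _ (Finset.mem_univ j), dist_self, zero_add]
  refine (Finset.sum_le_card_nsmul _ _ d fun i _ => h i j).trans_eq ?_
  simp

end Simplex

/-! ### Barycentric subdivision shrinks simplices -/

namespace ListChain

variable (A : Type u) [CommRing A] {m : ℕ}

open Simplex

/-- Combinations of lists whose entries lie in `S` and have mutual distances at most `d`. -/
def fine (m : ℕ) (S : Set (Simplex m)) (d : ℝ) (n : ℕ) : Submodule A (Lists A (Simplex m) n) :=
  Finsupp.supported A A {w | (∀ i, w i ∈ S) ∧ ∀ i j, dist (w i) (w j) ≤ d}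

variable {A}

lemma single_mem_fine {S : Set (Simplex m)} {d : ℝ} {n : ℕ} {w : Fin n → Simplex m}
    (h : ∀ i, w i ∈ S) (h' : ∀ i j, dist (w i) (w j) ≤ d) (a : A) :
    Finsupp.single w a ∈ fine A m S d n :=
  Finsupp.single_mem_supported A a ⟨h, h'⟩

lemma fine_mono {S S' : Set (Simplex m)} {d d' : ℝ} (hS : S ⊆ S') (hd : d ≤ d') (n : ℕ) :
    fine A m S d n ≤ fine A m S' d' n :=
  Finsupp.supported_mono fun _ hw => ⟨fun i => hS (hw.1 i), fun i j => (hw.2 i j).trans hd⟩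

/-- To map one span of lists into a submodule it suffices to check the lists. -/
lemma map_mem_of_supported {Y : Type} {n : ℕ} {P : Set (Fin n → Y)} {M : Type*} [AddCommGroup M]
    [Module A M] (f : Lists A Y n →ₗ[A] M) (N : Submodule A M)
    (h : ∀ v ∈ P, f (Finsupp.single v 1) ∈ N) {c : Lists A Y n} (hc : c ∈ Finsupp.supported A A P) :
    f c ∈ N := by
  have : Finsupp.supported A A P ≤ N.comap f := by
    rw [Finsupp.supported_eq_span_single, Submodule.span_le]
    rintro _ ⟨v, hv, rfl⟩
    exact h v hv
  exact this hc

lemma cone_mem_fine {S : Set (Simplex m)} {d : ℝ} {n : ℕ} {p : Simplex m} (hp : p ∈ S)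
    (hd : 0 ≤ d) (h : ∀ q ∈ S, dist q p ≤ d) {S' : Set (Simplex m)} (hS : S' ⊆ S)
    {c : Lists A (Simplex m) n} (hc : c ∈ fine A m S' d n) :
    cone A p n c ∈ fine A m S d (n + 1) := by
  refine map_mem_of_supported _ _ (fun v hv => ?_) hc
  rw [cone_single]
  refine single_mem_fine (fun i => ?_) (fun i j => ?_) _
  · refine Fin.cases (by simpa using hp) (fun i => ?_) i
    simpa using hS (hv.1 i)
  · refine Fin.cases ?_ (fun i => ?_) i <;> refine Fin.cases ?_ (fun j => ?_) j
    · simpa using hd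
    · simpa [dist_comm p] using h _ (hS (hv.1 j))
    · simpa using h _ (hS (hv.1 i))
    · simpa using hv.2 i j

/-- Subdividing a list of at most `M + 1` points divides the mesh by `(M + 1) / M`. -/
lemma sd_single_mem_fine (M : ℕ) {d : ℝ} (hd : 0 ≤ d) (n : ℕ) (hn : n ≤ M + 1)
    (v : Fin n → Simplex m) (h : ∀ i j, dist (v i) (v j) ≤ d) :
    sd A (bary m) n (Finsupp.single v 1) ∈
      fine A m (Set.range (aff v)) (M / (M + 1) * d) n := by
  induction n with
  | zero => exact single_mem_fine (fun i => i.elim0) (fun i => i.elim0) _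
  | succ n ih =>
    rw [sd_single_succ]
    have hr : (n : ℝ) / (n + 1) ≤ M / (M + 1) := by
      have : (n : ℝ) ≤ M := by exact_mod_cast Nat.le_of_succ_le_succ hn
      rw [div_le_div_iff₀ (by positivity) (by positivity)]
      linarith
    have key : ∀ q ∈ Set.range (aff v), dist q (bary m n v) ≤ M / (M + 1) * d := by
      rintro _ ⟨t, rfl⟩
      exact (dist_bary_le v t h).trans (mul_le_mul_of_nonneg_right hr hd)
    have hb : bary m n v ∈ Set.range (aff v) := ⟨_, rfl⟩
    refine cone_mem_fine hb (by positivity) key subset_rfl ?_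
    rw [bd_single, map_sum]
    refine Submodule.sum_mem _ fun i _ => ?_
    rw [map_smul]
    refine Submodule.smul_mem _ _ ?_
    refine fine_mono ?_ le_rfl n
      (ih (Nat.le_of_succ_le hn) (fun j => v (i.succAbove j)) fun _ _ => h _ _)
    rintro _ ⟨t, ht⟩
    refine ⟨face n i t, ?_⟩
    rw [face, aff_aff, ← ht]
    simp

lemma sd_mem_fine (M : ℕ) {d : ℝ} (hd : 0 ≤ d) (n : ℕ) (hn : n ≤ M + 1)
    {c : Lists A (Simplex m) n} (hc : c ∈ fine A m Set.univ d n) :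
    sd A (bary m) n c ∈ fine A m Set.univ (M / (M + 1) * d) n :=
  map_mem_of_supported _ _ (fun v hv => fine_mono (Set.subset_univ _) le_rfl n
    (sd_single_mem_fine M hd n hn v hv.2)) hc

/-- Iterated subdivision makes all lists arbitrarily fine. -/
lemma exists_sd_iterate_mem_fine (n : ℕ) (v : Fin n → Simplex m) {ε : ℝ} (hε : 0 < ε) :
    ∃ N : ℕ, (sd A (bary m) n)^[N] (Finsupp.single v 1) ∈ fine A m Set.univ ε n := by
  have h1 : ∀ i j, dist (v i) (v j) ≤ 1 := fun i j =>
    (Metric.dist_le_diam_of_mem (bounded_stdSimplex _) (v i).2 (v j).2).trans diam_stdSimplex_le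
  have h2 : ∀ N : ℕ, (sd A (bary m) n)^[N] (Finsupp.single v 1) ∈
      fine A m Set.univ ((n / (n + 1) : ℝ) ^ N) n := by
    intro N
    induction N with
    | zero => exact single_mem_fine (fun _ => Set.mem_univ _) (by simpa using h1) _
    | succ N ih =>
      rw [Function.iterate_succ_apply', pow_succ']
      exact sd_mem_fine n (by positivity) n n.le_succ ih
  obtain ⟨N, hN⟩ := exists_pow_lt_of_lt_one hε
    (show (n / (n + 1) : ℝ) < 1 by rw [div_lt_one (by positivity)]; linarith)
  refine ⟨N, fine_mono subset_rfl hN.le n (h2 N)⟩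

end ListChain

end

noncomputable section

/-! ### Augmented singular chains -/

open Simplex

/-- Singular chains on simplices with `n` vertices. The degree is shifted by one, so that `n = 0`
gives the augmentation: there is exactly one map from the empty simplex. -/
abbrev Chain (A : Type u) [CommRing A] (X : Type) [TopologicalSpace X] (n : ℕ) : Type u :=
  C(Simplex n, X) →₀ A

namespace Chain

variable (A : Type u) [CommRing A] {X Y Z : Type} [TopologicalSpace X] [TopologicalSpace Y]
  [TopologicalSpace Z]

/-- The singular boundary operator. -/
def bd (n : ℕ) : Chain A X (n + 1) →ₗ[A] Chain A X n :=
  Finsupp.linearCombination A fun σ =>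
    ∑ i : Fin (n + 1), (-1 : A) ^ (i : ℕ) • Finsupp.single (σ.comp (face n i)) 1

/-- The map on chains induced by a continuous map. -/
def push (f : C(X, Y)) (n : ℕ) : Chain A X n →ₗ[A] Chain A Y n :=
  Finsupp.lmapDomain A A fun σ => f.comp σ

/-- The singular chain that a combination of lists of points of the simplex `Simplex m` defines
through a singular simplex `σ`: lists are realized as affine simplices. -/
def real {m : ℕ} (σ : C(Simplex m, X)) (n : ℕ) : ListChain.Lists A (Simplex m) n →ₗ[A] Chain A X n :=
  Finsupp.lmapDomain A A fun v => σ.comp (aff v)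

/-- Barycentric subdivision of singular chains. -/
def sd (n : ℕ) : Chain A X n →ₗ[A] Chain A X n :=
  Finsupp.linearCombination A fun σ =>
    real A σ n (ListChain.sd A (bary n) n (Finsupp.single (vert n) 1))

/-- The chain homotopy between the identity and the subdivision. -/
def homot (n : ℕ) : Chain A X n →ₗ[A] Chain A X (n + 1) :=
  Finsupp.linearCombination A fun σ =>
    real A σ (n + 1) (ListChain.homot A (bary n) n (Finsupp.single (vert n) 1))

variable {A}

/-- Two linear maps on chains agree if they agree on every singular simplex. -/
lemma hom_ext {n : ℕ} {M : Type*} [AddCommGroup M] [Module A M] {f g : Chain A X n →ₗ[A] M}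
    (h : ∀ σ, f (Finsupp.single σ 1) = g (Finsupp.single σ 1)) : f = g :=
  Finsupp.lhom_ext' fun v => LinearMap.ext_ring (h v)

lemma bd_single (n : ℕ) (σ : C(Simplex (n + 1), X)) :
    bd A n (Finsupp.single σ 1) =
      ∑ i : Fin (n + 1), (-1 : A) ^ (i : ℕ) • Finsupp.single (σ.comp (face n i)) 1 := by
  simp [bd]

lemma push_single (f : C(X, Y)) (n : ℕ) (σ : C(Simplex n, X)) (a : A) :
    push A f n (Finsupp.single σ a) = Finsupp.single (f.comp σ) a := by
  simp [push]

lemma real_single {m n : ℕ} (σ : C(Simplex m, X)) (v : Fin n → Simplex m) (a : A) :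
    real A σ n (Finsupp.single v a) = Finsupp.single (σ.comp (aff v)) a := by
  simp [real]

lemma real_vert {n : ℕ} (σ : C(Simplex n, X)) (a : A) :
    real A σ n (Finsupp.single (vert n) a) = Finsupp.single σ a := by
  rw [real_single, aff_vert_id, ContinuousMap.comp_id]

lemma sd_single {n : ℕ} (σ : C(Simplex n, X)) :
    sd A n (Finsupp.single σ 1) =
      real A σ n (ListChain.sd A (bary n) n (Finsupp.single (vert n) 1)) := by
  simp [sd]

lemma homot_single {n : ℕ} (σ : C(Simplex n, X)) :
    homot A n (Finsupp.single σ 1) =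
      real A σ (n + 1) (ListChain.homot A (bary n) n (Finsupp.single (vert n) 1)) := by
  simp [homot]

lemma bd_real {m n : ℕ} (σ : C(Simplex m, X)) (c : ListChain.Lists A (Simplex m) (n + 1)) :
    bd A n (real A σ (n + 1) c) = real A σ n (ListChain.bd A n c) := by
  refine LinearMap.congr_fun (f := bd A n ∘ₗ real A σ (n + 1))
    (g := real A σ n ∘ₗ ListChain.bd A n) (ListChain.Lists.hom_ext fun v => ?_) c
  simp only [LinearMap.comp_apply, real_single, bd_single, ListChain.bd_single, map_sum, map_smul]
  refine Finset.sum_congr rfl fun i _ => ?_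
  rw [ContinuousMap.comp_assoc, face, aff_comp_aff]
  simp

lemma push_real {m n : ℕ} (f : C(X, Y)) (σ : C(Simplex m, X))
    (c : ListChain.Lists A (Simplex m) n) :
    push A f n (real A σ n c) = real A (f.comp σ) n c := by
  refine LinearMap.congr_fun (f := push A f n ∘ₗ real A σ n)
    (g := real A (f.comp σ) n) (ListChain.Lists.hom_ext fun v => ?_) c
  simp only [LinearMap.comp_apply, real_single, push_single, ContinuousMap.comp_assoc]

/-- Realization through an affine simplex. -/
lemma real_comp_aff {k m n : ℕ} (σ : C(Simplex m, X)) (v : Fin k → Simplex m)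
    (c : ListChain.Lists A (Simplex k) n) :
    real A (σ.comp (aff v)) n c = real A σ n (ListChain.push A (aff v) n c) := by
  refine LinearMap.congr_fun (f := real A (σ.comp (aff v)) n)
    (g := real A σ n ∘ₗ ListChain.push A (aff v) n) (ListChain.Lists.hom_ext fun w => ?_) c
  simp only [LinearMap.comp_apply, real_single, ListChain.push_single, ContinuousMap.comp_assoc,
    aff_comp_aff]
  rfl

lemma sd_real {m n : ℕ} (σ : C(Simplex m, X)) (c : ListChain.Lists A (Simplex m) n) :
    sd A n (real A σ n c) = real A σ n (ListChain.sd A (bary m) n c) := by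
  refine LinearMap.congr_fun (f := sd A n ∘ₗ real A σ n)
    (g := real A σ n ∘ₗ ListChain.sd A (bary m) n) (ListChain.Lists.hom_ext fun v => ?_) c
  simp only [LinearMap.comp_apply, real_single, sd_single, real_comp_aff]
  rw [ListChain.push_sd (b' := bary m) (aff v) (aff_bary v), ListChain.push_single,
    show aff v ∘ vert n = v from funext (aff_vert v)]

lemma homot_real {m n : ℕ} (σ : C(Simplex m, X)) (c : ListChain.Lists A (Simplex m) n) :
    homot A n (real A σ n c) = real A σ (n + 1) (ListChain.homot A (bary m) n c) := by
  refine LinearMap.congr_fun (f := homot A n ∘ₗ real A σ n)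
    (g := real A σ (n + 1) ∘ₗ ListChain.homot A (bary m) n)
    (ListChain.Lists.hom_ext fun v => ?_) c
  simp only [LinearMap.comp_apply, real_single, homot_single, real_comp_aff]
  rw [ListChain.push_homot (b' := bary m) (aff v) (aff_bary v), ListChain.push_single,
    show aff v ∘ vert n = v from funext (aff_vert v)]

lemma bd_bd (n : ℕ) (c : Chain A X (n + 2)) : bd A n (bd A (n + 1) c) = 0 := by
  refine LinearMap.congr_fun (f := bd A n ∘ₗ bd A (n + 1)) (g := 0) (hom_ext fun σ => ?_) c
  rw [LinearMap.comp_apply, ← real_vert, bd_real, bd_real, ListChain.bd_bd, map_zero,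
    LinearMap.zero_apply]

lemma bd_push (f : C(X, Y)) (n : ℕ) (c : Chain A X (n + 1)) :
    bd A n (push A f (n + 1) c) = push A f n (bd A n c) := by
  refine LinearMap.congr_fun (f := bd A n ∘ₗ push A f (n + 1)) (g := push A f n ∘ₗ bd A n)
    (hom_ext fun σ => ?_) c
  simp only [LinearMap.comp_apply]
  rw [← real_vert, push_real, bd_real, bd_real, push_real]

lemma push_id (n : ℕ) (c : Chain A X n) : push A (ContinuousMap.id X) n c = c := by
  refine LinearMap.congr_fun (f := push A (ContinuousMap.id X) n) (g := LinearMap.id)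
    (hom_ext fun σ => ?_) c
  rw [push_single, ContinuousMap.id_comp, LinearMap.id_apply]

lemma push_push (f : C(X, Y)) (g : C(Y, Z)) (n : ℕ) (c : Chain A X n) :
    push A g n (push A f n c) = push A (g.comp f) n c := by
  refine LinearMap.congr_fun (f := push A g n ∘ₗ push A f n) (g := push A (g.comp f) n)
    (hom_ext fun σ => ?_) c
  simp only [LinearMap.comp_apply, push_single, ContinuousMap.comp_assoc]

lemma bd_sd (n : ℕ) (c : Chain A X (n + 1)) : bd A n (sd A (n + 1) c) = sd A n (bd A n c) := by
  refine LinearMap.congr_fun (f := bd A n ∘ₗ sd A (n + 1)) (g := sd A n ∘ₗ bd A n)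
    (hom_ext fun σ => ?_) c
  simp only [LinearMap.comp_apply]
  rw [← real_vert, sd_real, bd_real, bd_real, sd_real, ListChain.bd_sd]

lemma bd_homot_zero (c : Chain A X 0) : bd A 0 (homot A 0 c) = c - sd A 0 c := by
  refine LinearMap.congr_fun (f := bd A 0 ∘ₗ homot A 0) (g := LinearMap.id - sd A 0)
    (hom_ext fun σ => ?_) c
  simp only [LinearMap.comp_apply, LinearMap.sub_apply, LinearMap.id_apply]
  rw [← real_vert, sd_real, homot_real, bd_real, ListChain.bd_homot_zero, map_sub]

lemma bd_homot_succ (n : ℕ) (c : Chain A X (n + 1)) :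
    bd A (n + 1) (homot A (n + 1) c) = c - sd A (n + 1) c - homot A n (bd A n c) := by
  refine LinearMap.congr_fun (f := bd A (n + 1) ∘ₗ homot A (n + 1))
    (g := LinearMap.id - sd A (n + 1) - homot A n ∘ₗ bd A n) (hom_ext fun σ => ?_) c
  simp only [LinearMap.comp_apply, LinearMap.sub_apply, LinearMap.id_apply]
  rw [← real_vert, sd_real, homot_real, bd_real, bd_real, homot_real, ListChain.bd_homot_succ,
    map_sub, map_sub]

/-! ### Chains supported in a subset, and small simplices -/

variable (A)

/-- The chains whose simplices have image in `U`. -/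
def within (U : Set X) (n : ℕ) : Submodule A (Chain A X n) :=
  Finsupp.supported A A {σ | ∀ t, σ t ∈ U}

/-- Cycles; in degree `0` every chain is a cycle. -/
def cycles (X : Type) [TopologicalSpace X] : ∀ n, Submodule A (Chain A X n)
  | 0 => ⊤
  | n + 1 => LinearMap.ker (bd A n)

variable {A}

lemma single_mem_within {U : Set X} {n : ℕ} {σ : C(Simplex n, X)} (h : ∀ t, σ t ∈ U) (a : A) :
    Finsupp.single σ a ∈ within A U n :=
  Finsupp.single_mem_supported A a h

lemma map_mem_of_within {U : Set X} {n : ℕ} {M : Type*} [AddCommGroup M] [Module A M]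
    (f : Chain A X n →ₗ[A] M) (N : Submodule A M)
    (h : ∀ σ : C(Simplex n, X), (∀ t, σ t ∈ U) → f (Finsupp.single σ 1) ∈ N) {c : Chain A X n}
    (hc : c ∈ within A U n) : f c ∈ N := by
  have : within A U n ≤ N.comap f := by
    rw [within, Finsupp.supported_eq_span_single, Submodule.span_le]
    rintro _ ⟨v, hv, rfl⟩
    exact h v hv
  exact this hc

lemma real_mem_within {U : Set X} {m n : ℕ} {σ : C(Simplex m, X)} (h : ∀ t, σ t ∈ U)
    (c : ListChain.Lists A (Simplex m) n) : real A σ n c ∈ within A U n := by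
  induction c using Finsupp.induction_linear with
  | zero => simp
  | add f g hf hg => rw [map_add]; exact add_mem hf hg
  | single v a => rw [real_single]; exact single_mem_within (fun t => h (aff v t)) a

lemma bd_mem_within {U : Set X} {n : ℕ} {c : Chain A X (n + 1)} (hc : c ∈ within A U (n + 1)) :
    bd A n c ∈ within A U n :=
  map_mem_of_within _ _ (fun σ h => by rw [← real_vert, bd_real]; exact real_mem_within h _) hc

lemma sd_mem_within {U : Set X} {n : ℕ} {c : Chain A X n} (hc : c ∈ within A U n) :
    sd A n c ∈ within A U n :=
  map_mem_of_within _ _ (fun σ h => by rw [← real_vert, sd_real]; exact real_mem_within h _) hc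

lemma homot_mem_within {U : Set X} {n : ℕ} {c : Chain A X n} (hc : c ∈ within A U n) :
    homot A n c ∈ within A U (n + 1) :=
  map_mem_of_within _ _ (fun σ h => by rw [← real_vert, homot_real]; exact real_mem_within h _) hc

lemma within_inter (U V : Set X) (n : ℕ) :
    within A (U ∩ V) n = within A U n ⊓ within A V n := by
  rw [within, within, within, ← Finsupp.supported_inter]
  congr 1
  ext σ
  exact forall_and

variable (A) in
/-- Sums of chains in `U` and chains in `V`. -/
def small (U V : Set X) (n : ℕ) : Submodule A (Chain A X n) := within A U n ⊔ within A V n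

lemma sup_induction {U V : Set X} {n k : ℕ} (f : Chain A X n →ₗ[A] Chain A X k)
    (h : ∀ (W : Set X) c, c ∈ within A W n → f c ∈ within A W k) {c : Chain A X n}
    (hc : c ∈ small A U V n) : f c ∈ small A U V k := by
  obtain ⟨u, hu, v, hv, rfl⟩ := Submodule.mem_sup.1 hc
  rw [map_add]
  exact Submodule.add_mem_sup (h U u hu) (h V v hv)

lemma sd_iterate_small {U V : Set X} {n : ℕ} {c : Chain A X n} (hc : c ∈ small A U V n) (N : ℕ) :
    (sd A n)^[N] c ∈ small A U V n := by
  induction N with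
  | zero => exact hc
  | succ N ih =>
    rw [Function.iterate_succ_apply']
    exact sup_induction _ (fun _ _ => sd_mem_within) ih

/-- Every singular simplex becomes small after finitely many subdivisions. -/
lemma exists_sd_iterate_single_small {U V : Set X} (hU : IsOpen U) (hV : IsOpen V)
    (hUV : U ∪ V = Set.univ) {n : ℕ} (σ : C(Simplex n, X)) :
    ∃ N : ℕ, (sd A n)^[N] (Finsupp.single σ 1) ∈ small A U V n := by
  obtain ⟨δ, hδ, hL⟩ := lebesgue_number_lemma_of_metric (s := (Set.univ : Set (Simplex n)))
    (c := fun b : Bool => cond b (σ ⁻¹' U) (σ ⁻¹' V)) isCompact_univ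
    (fun b => by cases b <;> exact IsOpen.preimage σ.continuous ‹_›)
    (fun t _ => by
      have : σ t ∈ U ∪ V := hUV ▸ trivial
      rcases this with h | h
      · exact Set.mem_iUnion.2 ⟨true, h⟩
      · exact Set.mem_iUnion.2 ⟨false, h⟩)
  obtain ⟨N, hN⟩ := ListChain.exists_sd_iterate_mem_fine (A := A) n (vert n) (half_pos hδ)
  refine ⟨N, ?_⟩
  have e : ∀ c : ListChain.Lists A (Simplex n) n,
      (sd A n)^[N] (real A σ n c) = real A σ n ((ListChain.sd A (bary n) n)^[N] c) :=
    fun c => ((Function.Semiconj.iterate_right (f := real A σ n)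
      (fun c => (sd_real σ c).symm) N) c).symm
  rw [← real_vert, e]
  refine ListChain.map_mem_of_supported _ _ (fun v hv => ?_) hN
  rw [real_single]
  rcases n with _ | n
  · exact Submodule.mem_sup_left
      (single_mem_within (fun t => absurd t.2.2 (by simp)) 1)
  · obtain ⟨b, hb⟩ := hL (v 0) trivial
    have : ∀ t, aff v t ∈ cond b (σ ⁻¹' U) (σ ⁻¹' V) := fun t => hb <| by
      refine lt_of_le_of_lt (dist_aff_le_of_forall v t (v 0) fun i => hv.2 i 0) (half_lt_self hδ)
    cases b
    · exact Submodule.mem_sup_right (single_mem_within (σ := σ.comp (aff v)) (fun t => this t) (1 : A))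
    · exact Submodule.mem_sup_left (single_mem_within (σ := σ.comp (aff v)) (fun t => this t) (1 : A))

lemma exists_sd_iterate_small {U V : Set X} (hU : IsOpen U) (hV : IsOpen V)
    (hUV : U ∪ V = Set.univ) {n : ℕ} (c : Chain A X n) :
    ∃ N : ℕ, (sd A n)^[N] c ∈ small A U V n := by
  have lin : ∀ N, (sd A (X := X) n)^[N] = ((sd A n ^ N : Module.End A (Chain A X n)) : _ → _) :=
    fun N => (Module.End.coe_pow _ N).symm
  induction c using Finsupp.induction_linear with
  | zero => exact ⟨0, by simp⟩
  | add f g hf hg =>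
    obtain ⟨N, hN⟩ := hf
    obtain ⟨M, hM⟩ := hg
    refine ⟨N + M, ?_⟩
    rw [lin, map_add, ← lin]
    refine add_mem ?_ ?_
    · rw [add_comm, Function.iterate_add_apply]; exact sd_iterate_small hN M
    · rw [Function.iterate_add_apply]; exact sd_iterate_small hM N
  | single σ a =>
    obtain ⟨N, hN⟩ := exists_sd_iterate_single_small (A := A) hU hV hUV σ
    refine ⟨N, ?_⟩
    rw [← mul_one a, ← smul_eq_mul, ← Finsupp.smul_single, lin, map_smul, ← lin]
    exact Submodule.smul_mem _ _ hN

/-- Subdivision does not change the class of a cycle. -/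
lemma bd_homot_of_mem_cycles {n : ℕ} {z : Chain A X n} (hz : z ∈ cycles A X n) :
    bd A n (homot A n z) = z - sd A n z := by
  cases n with
  | zero => exact bd_homot_zero z
  | succ n => rw [bd_homot_succ, LinearMap.mem_ker.1 hz, map_zero, sub_zero]

lemma sd_mem_cycles {n : ℕ} {z : Chain A X n} (hz : z ∈ cycles A X n) :
    sd A n z ∈ cycles A X n := by
  cases n with
  | zero => trivial
  | succ n =>
    refine LinearMap.mem_ker.2 ?_
    rw [bd_sd, LinearMap.mem_ker.1 hz, map_zero]

/-- Every cycle is homologous to a small one. -/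
lemma exists_small_homologous {U V : Set X} (hU : IsOpen U) (hV : IsOpen V)
    (hUV : U ∪ V = Set.univ) {n : ℕ} {z : Chain A X n} (hz : z ∈ cycles A X n) :
    ∃ x, z - bd A n x ∈ small A U V n := by
  obtain ⟨N, hN⟩ := exists_sd_iterate_small hU hV hUV z
  induction N generalizing z with
  | zero => exact ⟨0, by simpa using hN⟩
  | succ N ih =>
    obtain ⟨x, hx⟩ := ih (sd_mem_cycles hz) (by rwa [Function.iterate_succ_apply] at hN)
    refine ⟨homot A n z + x, ?_⟩
    rw [map_add, bd_homot_of_mem_cycles hz]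
    convert hx using 1
    abel

/-- A small cycle that bounds is the boundary of a small chain. -/
lemma exists_small_bounding {U V : Set X} (hU : IsOpen U) (hV : IsOpen V)
    (hUV : U ∪ V = Set.univ) {n : ℕ} {x : Chain A X (n + 1)} (hx : bd A n x ∈ small A U V n) :
    ∃ y ∈ small A U V (n + 1), bd A n y = bd A n x := by
  obtain ⟨N, hN⟩ := exists_sd_iterate_small hU hV hUV x
  induction N generalizing x with
  | zero => exact ⟨x, hN, rfl⟩
  | succ N ih =>
    obtain ⟨y, hy, hyx⟩ := ih (x := sd A (n + 1) x)
      (by rw [bd_sd]; exact sup_induction _ (fun _ _ => sd_mem_within) hx)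
      (by rwa [Function.iterate_succ_apply] at hN)
    refine ⟨homot A n (bd A n x) + y,
      add_mem (sup_induction _ (fun _ _ => homot_mem_within) hx) hy, ?_⟩
    have hc : bd A n x ∈ cycles A X n := by
      cases n with
      | zero => trivial
      | succ n => exact LinearMap.mem_ker.2 (bd_bd _ _)
    rw [map_add, bd_homot_of_mem_cycles hc, hyx, bd_sd]
    abel

end Chain

end

noncomputable section

universe v w

open Simplex

namespace Chain

variable {A : Type u} [CommRing A] {X Y Z : Type} [TopologicalSpace X] [TopologicalSpace Y]
  [TopologicalSpace Z]

/-! ### Augmented homology -/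

lemma bd_mem_cycles {n : ℕ} (c : Chain A X (n + 1)) : bd A n c ∈ cycles A X n := by
  cases n with
  | zero => trivial
  | succ n => exact LinearMap.mem_ker.2 (bd_bd _ _)

lemma push_mem_cycles (f : C(X, Y)) {n : ℕ} {z : Chain A X n} (hz : z ∈ cycles A X n) :
    push A f n z ∈ cycles A Y n := by
  cases n with
  | zero => trivial
  | succ n => exact LinearMap.mem_ker.2 (by rw [bd_push, LinearMap.mem_ker.1 hz, map_zero])

/-- The quotient of a submodule `Z` by its intersection with a submodule `B`. -/
def Subquotient {M : Type*} [AddCommGroup M] [Module A M] (Z B : Submodule A M) : Type _ :=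
  Z ⧸ B.submoduleOf Z

namespace Subquotient

variable {M : Type*} [AddCommGroup M] [Module A M] (Z B : Submodule A M)

instance : AddCommGroup (Subquotient Z B) := inferInstanceAs (AddCommGroup (Z ⧸ B.submoduleOf Z))

instance : Module A (Subquotient Z B) := inferInstanceAs (Module A (Z ⧸ B.submoduleOf Z))

/-- The class of an element of the numerator. -/
def mk : Z →ₗ[A] Subquotient Z B := (B.submoduleOf Z).mkQ

lemma mk_surjective : Function.Surjective (mk Z B) := (B.submoduleOf Z).mkQ_surjective

lemma mk_eq_zero (z : Z) : mk Z B z = 0 ↔ z.1 ∈ B := by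
  change (B.submoduleOf Z).mkQ z = 0 ↔ _
  rw [Submodule.mkQ_apply, Submodule.Quotient.mk_eq_zero]
  rfl

end Subquotient

variable (A X) in
/-- The homology of the augmented singular chain complex, in the shifted degree `n`: this is the
reduced singular homology of `X` in degree `n - 1`. -/
abbrev RedHomology (n : ℕ) : Type u :=
  Subquotient (cycles A X n) (LinearMap.range (bd A (X := X) n))

variable (A X) in
/-- All cycles are boundaries. -/
def Acyclic : Prop := ∀ n, ∀ z ∈ cycles A X n, ∃ y, bd A n y = z

/-- Two surjective images of a module are isomorphic if the kernels agree. -/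
lemma nonempty_equiv_of_ker_eq {M : Type v} {N P : Type w} [AddCommMonoid M] [Module A M] [AddCommMonoid N]
    [Module A N] [AddCommMonoid P] [Module A P] (f : M →ₗ[A] N) (g : M →ₗ[A] P)
    (hf : Function.Surjective f) (hg : Function.Surjective g) (h : ∀ x, f x = 0 ↔ g x = 0) :
    Nonempty (N ≃ₗ[A] P) := by
  have neg : ∀ {Q : Type w} [AddCommMonoid Q] [Module A Q] (k : M →ₗ[A] Q) (x y : M),
      k (x + (-1 : A) • y) = 0 ↔ k x = k y := by
    intro Q _ _ k x y
    have hy : (-1 : A) • k y + k y = 0 := by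
      rw [← one_smul A (k y), smul_smul, ← add_smul]; simp
    rw [map_add, map_smul]
    constructor
    · intro e
      rw [← add_zero (k x), ← hy, ← add_assoc, e, zero_add]
    · intro e
      rw [e, add_comm, hy]
  have key : ∀ x y, f x = f y ↔ g x = g y := fun x y => by rw [← neg f, ← neg g, h]
  have hs := Function.surjInv_eq hf
  refine ⟨LinearEquiv.ofBijective
    { toFun := fun n => g (Function.surjInv hf n)
      map_add' := fun a b => by rw [← map_add, ← key, map_add, hs, hs, hs]
      map_smul' := fun r a => by rw [← map_smul, ← key, map_smul, hs, hs]; rfl } ⟨?_, ?_⟩⟩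
  · intro a b hab
    rw [← hs a, ← hs b]
    exact (key _ _).2 hab
  · intro p
    obtain ⟨x, rfl⟩ := hg p
    exact ⟨f x, (key _ _).1 (hs _)⟩

variable (A) in
/-- The class of a cycle. -/
def toHomology (X : Type) [TopologicalSpace X] (n : ℕ) : cycles A X n →ₗ[A] RedHomology A X n :=
  Subquotient.mk _ _

lemma toHomology_surjective (n : ℕ) : Function.Surjective (toHomology A X n) :=
  Subquotient.mk_surjective _ _

lemma toHomology_eq_zero {n : ℕ} (z : cycles A X n) :
    toHomology A X n z = 0 ↔ ∃ y, bd A n y = (z : Chain A X n) :=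
  Subquotient.mk_eq_zero _ _ z

lemma Acyclic.subsingleton (h : Acyclic A X) (n : ℕ) : Subsingleton (RedHomology A X n) := by
  refine subsingleton_of_forall_eq 0 fun x => ?_
  obtain ⟨z, rfl⟩ := toHomology_surjective n x
  exact (toHomology_eq_zero z).2 (h n z z.2)

/-- If the two compositions of `f` and `g` act on cycles as the identity up to boundaries, then
`X` and `Y` have isomorphic homology. -/
lemma nonempty_equiv_of_homotopy_inverse (f : C(X, Y)) (g : C(Y, X)) (n : ℕ)
    (h1 : ∀ z ∈ cycles A X n, ∃ y, bd A n y = push A g n (push A f n z) - z)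
    (h2 : ∀ z ∈ cycles A Y n, ∃ y, bd A n y = push A f n (push A g n z) - z) :
    Nonempty (RedHomology A X n ≃ₗ[A] RedHomology A Y n) := by
  let F : cycles A X n →ₗ[A] RedHomology A Y n := toHomology A Y n ∘ₗ
    ((push A f n).restrict fun _ => push_mem_cycles f)
  refine nonempty_equiv_of_ker_eq (toHomology A X n) F (toHomology_surjective n) ?_ ?_
  · intro y
    obtain ⟨z, rfl⟩ := toHomology_surjective n y
    refine ⟨⟨push A g n z, push_mem_cycles g z.2⟩, ?_⟩
    rw [← sub_eq_zero]
    simp only [F, LinearMap.comp_apply, ← map_sub]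
    exact (toHomology_eq_zero _).2 (h2 z z.2)
  · intro z
    simp only [F, LinearMap.comp_apply, toHomology_eq_zero]
    constructor
    · rintro ⟨y, hy⟩
      exact ⟨push A f (n + 1) y, by rw [bd_push, hy]; rfl⟩
    · rintro ⟨y, hy⟩
      obtain ⟨x, hx⟩ := h1 z z.2
      refine ⟨push A g (n + 1) y - x, ?_⟩
      rw [map_sub, bd_push, hy, hx]
      simp

/-! ### The Mayer-Vietoris argument -/

lemma push_subtype_injective (U : Set X) (n : ℕ) :
    Function.Injective (push A (⟨Subtype.val, continuous_subtype_val⟩ : C(U, X)) n) := by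
  refine Finsupp.mapDomain_injective fun σ τ h => ?_
  ext t
  exact DFunLike.congr_fun h t

lemma range_push_subtype (U : Set X) (n : ℕ) :
    LinearMap.range (push A (⟨Subtype.val, continuous_subtype_val⟩ : C(U, X)) n) =
      within A U n := by
  apply le_antisymm
  · rintro _ ⟨c, rfl⟩
    induction c using Finsupp.induction_linear with
    | zero => simp
    | add f g hf hg => rw [map_add]; exact add_mem hf hg
    | single σ a => rw [push_single]; exact single_mem_within (fun t => (σ t).2) a
  · rw [within, Finsupp.supported_eq_span_single, Submodule.span_le]
    rintro _ ⟨σ, hσ, rfl⟩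
    refine ⟨Finsupp.single ⟨fun t => ⟨σ t, hσ t⟩, by fun_prop⟩ 1, ?_⟩
    rw [push_single]
    rfl

lemma push_subtype_mem_cycles {U : Set X} {n : ℕ} {c : Chain A U n}
    (h : push A (⟨Subtype.val, continuous_subtype_val⟩ : C(U, X)) n c ∈ cycles A X n) :
    c ∈ cycles A U n := by
  cases n with
  | zero => trivial
  | succ n =>
    refine LinearMap.mem_ker.2 (push_subtype_injective U n ?_)
    rw [← bd_push, LinearMap.mem_ker.1 h, map_zero]

/-- A cycle in an acyclic subspace bounds inside the subspace. -/
lemma Acyclic.exists_within {U : Set X} (hU : Acyclic A U) {n : ℕ} {z : Chain A X n}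
    (hz : z ∈ cycles A X n) (hzU : z ∈ within A U n) :
    ∃ y ∈ within A U (n + 1), bd A n y = z := by
  rw [← range_push_subtype] at hzU
  obtain ⟨c, rfl⟩ := hzU
  obtain ⟨y, rfl⟩ := hU n c (push_subtype_mem_cycles hz)
  refine ⟨push A _ (n + 1) y, ?_, bd_push _ _ _⟩
  rw [← range_push_subtype]
  exact ⟨y, rfl⟩

/-- If `X` is the union of two open acyclic subspaces, its homology is that of the intersection,
shifted by one degree. -/
theorem nonempty_equiv_of_acyclic_cover {U V : Set X} (hU : IsOpen U) (hV : IsOpen V)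
    (hUV : U ∪ V = Set.univ) (aU : Acyclic A U) (aV : Acyclic A V) (n : ℕ) :
    Nonempty (RedHomology A X (n + 1) ≃ₗ[A] RedHomology A ↥(U ∩ V) n) := by
  -- pairs of a chain in `U` and a chain in `V` with the same boundary
  let P : Submodule A (Chain A X (n + 1) × Chain A X (n + 1)) :=
    ((within A U (n + 1)).prod (within A V (n + 1))) ⊓
      LinearMap.ker ((bd A n).comp (LinearMap.fst A _ _) - (bd A n).comp (LinearMap.snd A _ _))
  have hP : ∀ p : P, bd A n p.1.1 = bd A n p.1.2 := fun p => sub_eq_zero.1 p.2.2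
  let ι : C(↥(U ∩ V), X) := ⟨Subtype.val, continuous_subtype_val⟩
  let E : Chain A ↥(U ∩ V) n ≃ₗ[A] within A (U ∩ V) n :=
    (LinearEquiv.ofInjective _ (push_subtype_injective (U ∩ V) n)).trans
      (LinearEquiv.ofEq _ _ (range_push_subtype (U ∩ V) n))
  have hE : ∀ c, push A ι n (E.symm c) = c := by
    intro c
    obtain ⟨d, rfl⟩ := E.surjective c
    rw [LinearEquiv.symm_apply_apply]
    rfl
  let bdP : P →ₗ[A] within A (U ∩ V) n :=
    ((bd A n).comp ((LinearMap.fst A _ _).comp P.subtype)).codRestrict _ fun p => by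
      rw [within_inter]
      refine ⟨bd_mem_within p.2.1.1, ?_⟩
      change bd A n p.1.1 ∈ _
      rw [hP]
      exact bd_mem_within p.2.1.2
  let f : P →ₗ[A] RedHomology A X (n + 1) := toHomology A X (n + 1) ∘ₗ
    (((LinearMap.fst A (Chain A X (n + 1)) (Chain A X (n + 1)) -
      LinearMap.snd A _ _).comp P.subtype).codRestrict _ fun p =>
      LinearMap.mem_ker.2 (by
        change bd A n (p.1.1 - p.1.2) = 0
        rw [map_sub, hP, sub_self]))
  let g : P →ₗ[A] RedHomology A ↥(U ∩ V) n := toHomology A _ n ∘ₗ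
    ((E.symm.toLinearMap.comp bdP).codRestrict _ fun p => push_subtype_mem_cycles (by
      change push A ι n (E.symm (bdP p)) ∈ _
      rw [hE]
      exact bd_mem_cycles _))
  have hf : ∀ p : P, f p = 0 ↔ ∃ y, bd A (n + 1) y = p.1.1 - p.1.2 :=
    fun p => toHomology_eq_zero _
  have hg : ∀ p : P, g p = 0 ↔ ∃ y ∈ within A (U ∩ V) (n + 1), bd A n y = bd A n p.1.1 := by
    intro p
    rw [show g p = toHomology A _ n ⟨E.symm (bdP p), _⟩ from rfl, toHomology_eq_zero]
    constructor
    · rintro ⟨y, hy⟩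
      refine ⟨push A ι (n + 1) y, ?_, ?_⟩
      · rw [← range_push_subtype]; exact ⟨y, rfl⟩
      · rw [bd_push, hy]
        exact hE _
    · rintro ⟨y, hy, hyp⟩
      rw [← range_push_subtype] at hy
      obtain ⟨y, rfl⟩ := hy
      refine ⟨y, push_subtype_injective _ n ?_⟩
      rw [← bd_push, hyp]
      exact (hE (bdP p)).symm
  refine nonempty_equiv_of_ker_eq f g ?_ ?_ fun p => ?_
  · intro x
    obtain ⟨z, rfl⟩ := toHomology_surjective _ x
    obtain ⟨y, hy⟩ := exists_small_homologous hU hV hUV z.2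
    obtain ⟨u, hu, v, hv, huv⟩ := Submodule.mem_sup.1 hy
    have hb : bd A n u + bd A n v = 0 := by
      rw [← map_add, huv, map_sub, bd_bd, sub_zero]
      exact z.2
    refine ⟨⟨(u, -v), ⟨hu, neg_mem hv⟩, LinearMap.mem_ker.2 ?_⟩, ?_⟩
    · change bd A n u - bd A n (-v) = 0
      rw [map_neg, sub_neg_eq_add, hb]
    · rw [← sub_eq_zero, ← neg_eq_zero, neg_sub]
      simp only [f, LinearMap.comp_apply, ← map_sub]
      refine (toHomology_eq_zero _).2 ⟨y, ?_⟩
      change bd A (n + 1) y = z - (u - (-v))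
      rw [sub_neg_eq_add, huv]
      abel
  · intro x
    obtain ⟨z, rfl⟩ := toHomology_surjective _ x
    have hz : push A ι n z ∈ within A (U ∩ V) n := by
      rw [← range_push_subtype]; exact ⟨_, rfl⟩
    have hz' := hz
    rw [within_inter] at hz'
    obtain ⟨u, hu, huz⟩ := aU.exists_within (push_mem_cycles ι z.2) hz'.1
    obtain ⟨v, hv, hvz⟩ := aV.exists_within (push_mem_cycles ι z.2) hz'.2
    refine ⟨⟨(u, v), ⟨hu, hv⟩, LinearMap.mem_ker.2 ?_⟩, ?_⟩
    · change bd A n u - bd A n v = 0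
      rw [huz, hvz, sub_self]
    · simp only [g, LinearMap.comp_apply]
      congr 1
      refine Subtype.ext (push_subtype_injective _ n ?_)
      exact (hE _).trans huz
  · rw [hf, hg]
    constructor
    · rintro ⟨x, hx⟩
      obtain ⟨y, hy, hyx⟩ := exists_small_bounding hU hV hUV (x := x) (by
        rw [hx, sub_eq_add_neg]
        exact Submodule.add_mem_sup p.2.1.1 (neg_mem p.2.1.2))
      obtain ⟨a, ha, b, hb, rfl⟩ := Submodule.mem_sup.1 hy
      have e : p.1.1 - bd A (n + 1) a = p.1.2 + bd A (n + 1) b := by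
        rw [map_add, hx] at hyx
        rw [sub_eq_iff_eq_add, add_assoc, add_comm (bd A (n + 1) b), hyx]
        abel
      refine ⟨p.1.1 - bd A (n + 1) a, ?_, by rw [map_sub, bd_bd, sub_zero]⟩
      rw [within_inter]
      refine ⟨sub_mem p.2.1.1 (bd_mem_within ha), ?_⟩
      rw [e]
      exact add_mem p.2.1.2 (bd_mem_within hb)
    · rintro ⟨w, hw, hwp⟩
      rw [within_inter] at hw
      obtain ⟨a, -, ha⟩ := aU.exists_within (n := n + 1) (z := p.1.1 - w)
        (LinearMap.mem_ker.2 (by rw [map_sub, hwp, sub_self])) (sub_mem p.2.1.1 hw.1)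
      obtain ⟨b, -, hb⟩ := aV.exists_within (n := n + 1) (z := p.1.2 - w)
        (LinearMap.mem_ker.2 (by rw [map_sub, hwp, hP, sub_self])) (sub_mem p.2.1.2 hw.2)
      exact ⟨a - b, by rw [map_sub, ha, hb]; abel⟩

/-! ### Finite disjoint unions -/

section Fiber

variable {κ : Type} [Fintype κ] (π : X → κ)

/-- The inclusion of a fibre. -/
def fiberIncl (c : κ) : C(π ⁻¹' {c}, X) := ⟨Subtype.val, continuous_subtype_val⟩

variable (A) in
/-- The sum of chains in the fibres of `π`. -/
def fiberSum (n : ℕ) : ((c : κ) → Chain A (π ⁻¹' {c}) n) →ₗ[A] Chain A X n :=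
  ∑ c, (push A (fiberIncl π c) n).comp (LinearMap.proj c)

lemma fiberSum_apply (n : ℕ) (z : (c : κ) → Chain A (π ⁻¹' {c}) n) :
    fiberSum A π n z = ∑ c, push A (fiberIncl π c) n (z c) := by
  simp [fiberSum]

lemma bd_fiberSum (n : ℕ) (z : (c : κ) → Chain A (π ⁻¹' {c}) (n + 1)) :
    bd A n (fiberSum A π (n + 1) z) = fiberSum A π n (fun c => bd A n (z c)) := by
  simp only [fiberSum_apply, map_sum, bd_push]

lemma fiberSum_injective (n : ℕ) : Function.Injective (fiberSum A π (n + 1)) := by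
  classical
  rw [injective_iff_map_eq_zero]
  intro z hz
  funext c
  refine push_subtype_injective _ (n + 1) ?_
  rw [Pi.zero_apply, map_zero]
  have hmem : ∀ d, push A (fiberIncl π d) (n + 1) (z d) ∈ within A (π ⁻¹' {d}) (n + 1) :=
    fun d => by rw [← range_push_subtype]; exact ⟨z d, rfl⟩
  -- discard all simplices outside of the fibre over `c`
  let F : Chain A X (n + 1) →+ Chain A X (n + 1) :=
    Finsupp.filterAddHom fun σ => ∀ t, σ t ∈ π ⁻¹' {c}
  have h0 := congrArg F hz
  rw [fiberSum_apply, map_sum, map_zero, Finset.sum_eq_single c] at h0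
  · refine Eq.trans ?_ h0
    exact (Finsupp.filter_eq_self_iff _ _ |>.2 fun σ hσ => hmem c (Finsupp.mem_support_iff.2 hσ)).symm
  · intro d _ hd
    refine Finsupp.filter_eq_zero_iff _ _ |>.2 fun σ hσ => ?_
    by_contra h
    have h1 := hmem d (Finsupp.mem_support_iff.2 h) (vert (n + 1) 0)
    have h2 := hσ (vert (n + 1) 0)
    exact hd (h1.symm.trans h2)
  · exact fun h => absurd (Finset.mem_univ c) h

variable {π}

lemma fiberSum_surjective (hπ : IsLocallyConstant π) (n : ℕ) :
    Function.Surjective (fiberSum A π (n + 1)) := by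
  classical
  rw [← LinearMap.range_eq_top, eq_top_iff]
  rintro c -
  induction c using Finsupp.induction_linear with
  | zero => exact zero_mem _
  | add f g hf hg => exact add_mem hf hg
  | single σ a =>
    have h : ∀ t, π (σ t) = π (σ (vert (n + 1) 0)) := fun t =>
      (hπ.comp_continuous σ.continuous).apply_eq_of_preconnectedSpace t _
    refine ⟨Pi.single (π (σ (vert (n + 1) 0)))
      (Finsupp.single ⟨fun t => ⟨σ t, h t⟩, by fun_prop⟩ a), ?_⟩
    rw [fiberSum_apply, Finset.sum_eq_single (π (σ (vert (n + 1) 0)))]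
    · rw [Pi.single_eq_same, push_single]
      rfl
    · intro d _ hd
      rw [Pi.single_eq_of_ne hd, map_zero]
    · exact fun h => absurd (Finset.mem_univ _) h

/-- In positive degrees, the homology of a space that is decomposed by a locally constant map is
the product of the homologies of the fibres. -/
theorem nonempty_equiv_pi_fiber (hπ : IsLocallyConstant π) (n : ℕ) :
    Nonempty (RedHomology A X (n + 2) ≃ₗ[A] ((c : κ) → RedHomology A (π ⁻¹' {c}) (n + 2))) := by
  let J : ((c : κ) → cycles A (π ⁻¹' {c}) (n + 2)) →ₗ[A]
      ((c : κ) → Chain A (π ⁻¹' {c}) (n + 2)) :=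
    LinearMap.pi fun c => (Submodule.subtype _).comp (LinearMap.proj c)
  have hJ : ∀ z c, J z c = z c := fun _ _ => rfl
  have hc : ∀ z c, bd A (n + 1) (J z c) = 0 := fun z c => LinearMap.mem_ker.1 (z c).2
  let f : ((c : κ) → cycles A (π ⁻¹' {c}) (n + 2)) →ₗ[A] RedHomology A X (n + 2) :=
    toHomology A X (n + 2) ∘ₗ ((fiberSum A π (n + 2)).comp J).codRestrict _ fun z =>
      LinearMap.mem_ker.2 (by
        rw [LinearMap.comp_apply, bd_fiberSum]
        simp only [hc]
        exact map_zero (fiberSum A π (n + 1)))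
  let g : ((c : κ) → cycles A (π ⁻¹' {c}) (n + 2)) →ₗ[A]
      ((c : κ) → RedHomology A (π ⁻¹' {c}) (n + 2)) :=
    LinearMap.pi fun c => (toHomology A _ (n + 2)).comp (LinearMap.proj c)
  refine nonempty_equiv_of_ker_eq f g ?_ ?_ fun z => ?_
  · intro x
    obtain ⟨z, rfl⟩ := toHomology_surjective _ x
    obtain ⟨y, hy⟩ := fiberSum_surjective hπ (n + 1) (z : Chain A X (n + 2))
    have hy0 : (fun c => bd A (n + 1) (y c)) = 0 := by
      refine fiberSum_injective π n ?_
      rw [← bd_fiberSum, hy, map_zero]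
      exact z.2
    refine ⟨fun c => ⟨y c, LinearMap.mem_ker.2 (congrFun hy0 c)⟩, ?_⟩
    simp only [f, LinearMap.comp_apply]
    congr 1
    exact Subtype.ext hy
  · intro x
    choose z hz using fun c => toHomology_surjective (n + 2) (x c)
    exact ⟨z, funext hz⟩
  · rw [funext_iff]
    simp only [g, LinearMap.pi_apply, LinearMap.comp_apply, LinearMap.proj_apply, Pi.zero_apply,
      f, toHomology_eq_zero]
    constructor
    · rintro ⟨y, hy⟩ c
      obtain ⟨x, rfl⟩ := fiberSum_surjective hπ (n + 2) y
      rw [bd_fiberSum] at hy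
      exact ⟨x c, congrFun (fiberSum_injective π (n + 1) hy) c⟩
    · intro h
      choose y hy using h
      refine ⟨fiberSum A π (n + 3) y, ?_⟩
      rw [bd_fiberSum]
      simp only [hy]
      rfl

end Fiber

end Chain

end

noncomputable section

open Simplex CategoryTheory Limits AlgebraicTopology Simplicial

namespace Chain

variable (A : Type u) [CommRing A] (X : Type) [TopologicalSpace X] {Y : Type} [TopologicalSpace Y]

/-! ### Comparison with Mathlib's singular chain complex -/

/-- The singular chain complex with coefficients in `A`. -/
abbrev singComplex : ChainComplex (ModuleCat.{u} A) ℕ :=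
  (TopCat.toSSet.obj (TopCat.of X)).chainComplex (ModuleCat.of A A)

variable {X}

/-- Singular simplices are continuous maps. -/
def simplexEquiv (n : ℕ) : TopCat.toSSet.obj (TopCat.of X) _⦋n⦌ ≃ C(Simplex (n + 1), X) :=
  TopCat.toSSetObjEquiv _ _

lemma face_eq_map (n : ℕ) (i : Fin (n + 1)) (t : Simplex n) :
    face n i t = stdSimplex.map i.succAbove t := by
  ext k
  rw [stdSimplex.map_coe, FunOnFinite.linearMap_apply_apply, face, aff_apply, Finset.sum_filter]
  refine Finset.sum_congr rfl fun j _ => ?_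
  rw [vert_apply, mul_ite, mul_one, mul_zero]
  exact if_congr eq_comm rfl rfl

lemma simplexEquiv_δ {n : ℕ} (x : TopCat.toSSet.obj (TopCat.of X) _⦋n + 1⦌) (i : Fin (n + 2)) :
    simplexEquiv n ((TopCat.toSSet.obj (TopCat.of X)).δ i x) =
      (simplexEquiv (n + 1) x).comp (face (n + 1) i) := by
  ext t
  rw [ContinuousMap.comp_apply, face_eq_map]
  rfl

variable {A}

/-- The generator of the singular chains given by a simplex. -/
def gen {n : ℕ} (x : TopCat.toSSet.obj (TopCat.of X) _⦋n⦌) : (singComplex A X).X n :=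
  (SSet.ιChainComplex (R := ModuleCat.of A A) _ x).hom (1 : A)

lemma singComplex_hom_ext {n : ℕ} {M : ModuleCat.{u} A}
    {f g : (singComplex A X).X n →ₗ[A] M} (h : ∀ x, f (gen x) = g (gen x)) : f = g := by
  have : ModuleCat.ofHom f = ModuleCat.ofHom g := by
    refine SSet.chainComplex_hom_ext fun x => ModuleCat.hom_ext (LinearMap.ext_ring ?_)
    exact h x
  exact congrArg ModuleCat.Hom.hom this

lemma d_gen {n : ℕ} (x : TopCat.toSSet.obj (TopCat.of X) _⦋n + 1⦌) :
    ((singComplex A X).d (n + 1) n).hom (gen x) =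
      ∑ i : Fin (n + 2), (-1 : A) ^ (i : ℕ) •
        gen (A := A) ((TopCat.toSSet.obj (TopCat.of X)).δ i x) := by
  have h := congrArg (fun f : ModuleCat.of A A ⟶ _ => f.hom (1 : A))
    (SSet.ιChainComplex_d (R := ModuleCat.of A A) _ x)
  refine Eq.trans h ?_
  dsimp only
  rw [ModuleCat.hom_sum, LinearMap.sum_apply]
  refine Finset.sum_congr rfl fun i _ => ?_
  rcases Nat.even_or_odd (i : ℕ) with hi | hi
  · rw [hi.neg_one_pow, hi.neg_one_pow, one_smul, one_smul]
    rfl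
  · rw [hi.neg_one_pow, hi.neg_one_pow, neg_one_smul, neg_one_smul]
    rfl

lemma map_gen (f : C(X, Y)) {n : ℕ} (x : TopCat.toSSet.obj (TopCat.of X) _⦋n⦌) :
    ((SSet.chainComplexMap (TopCat.toSSet.map (TopCat.ofHom f)) (ModuleCat.of A A)).f n).hom
      (gen x) = gen (A := A) ((TopCat.toSSet.map (TopCat.ofHom f)).app _ x) :=
  congrArg (fun f : ModuleCat.of A A ⟶ _ => f.hom (1 : A))
    (SSet.ι_chainComplexMap_f _ _ (TopCat.toSSet.map (TopCat.ofHom f)) (ModuleCat.of A A) x)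

variable (A X) in
/-- The map from explicit chains to Mathlib's singular chains. -/
def toSing (n : ℕ) : Chain A X (n + 1) →ₗ[A] (singComplex A X).X n :=
  Finsupp.linearCombination A fun σ => gen ((simplexEquiv n).symm σ)

variable (A X) in
/-- The map from Mathlib's singular chains to explicit chains. -/
def ofSing (n : ℕ) : (singComplex A X).X n →ₗ[A] Chain A X (n + 1) :=
  ((SSet.isColimitChainComplexXCofan (TopCat.toSSet.obj (TopCat.of X)) (ModuleCat.of A A) n).desc
    (Cofan.mk (ModuleCat.of A (Chain A X (n + 1)))
      fun x => ModuleCat.ofHom (Finsupp.lsingle (simplexEquiv n x)))).hom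

lemma toSing_single (n : ℕ) (σ : C(Simplex (n + 1), X)) :
    toSing A X n (Finsupp.single σ 1) = gen ((simplexEquiv n).symm σ) := by
  simp [toSing]

lemma ofSing_gen (n : ℕ) (x : TopCat.toSSet.obj (TopCat.of X) _⦋n⦌) :
    ofSing A X n (gen x) = Finsupp.single (simplexEquiv n x) 1 :=
  congrArg (fun f : ModuleCat.of A A ⟶ _ => f.hom (1 : A))
    ((SSet.isColimitChainComplexXCofan (TopCat.toSSet.obj (TopCat.of X)) (ModuleCat.of A A) n).fac
      (Cofan.mk (ModuleCat.of A (Chain A X (n + 1)))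
        fun x => ModuleCat.ofHom (Finsupp.lsingle (simplexEquiv n x))) ⟨x⟩)

variable (A X) in
/-- Explicit chains and Mathlib's singular chains agree. -/
def singEquiv (n : ℕ) : Chain A X (n + 1) ≃ₗ[A] (singComplex A X).X n :=
  LinearEquiv.ofLinearMap (toSing A X n) (ofSing A X n)
    (singComplex_hom_ext (M := (singComplex A X).X n) fun x => by
      rw [LinearMap.comp_apply, ofSing_gen, toSing_single, Equiv.symm_apply_apply]; rfl)
    (hom_ext fun σ => by
      rw [LinearMap.comp_apply, toSing_single, ofSing_gen, Equiv.apply_symm_apply]; rfl)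

lemma d_singEquiv (n : ℕ) (c : Chain A X (n + 2)) :
    ((singComplex A X).d (n + 1) n).hom (singEquiv A X (n + 1) c) =
      singEquiv A X n (bd A (n + 1) c) := by
  refine LinearMap.congr_fun
    (f := ((singComplex A X).d (n + 1) n).hom ∘ₗ (singEquiv A X (n + 1)).toLinearMap)
    (g := (singEquiv A X n).toLinearMap ∘ₗ bd A (n + 1)) (hom_ext fun σ => ?_) c
  simp only [LinearMap.comp_apply]
  change ((singComplex A X).d (n + 1) n).hom (toSing A X (n + 1) _) = toSing A X n _
  rw [toSing_single, d_gen, bd_single, map_sum]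
  refine Finset.sum_congr rfl fun i _ => ?_
  rw [map_smul, toSing_single]
  congr 2
  apply (simplexEquiv n).injective
  rw [simplexEquiv_δ, Equiv.apply_symm_apply, Equiv.apply_symm_apply]

lemma singEquiv_bd_symm (n : ℕ) (w : (singComplex A X).X (n + 1)) :
    singEquiv A X n (bd A (n + 1) ((singEquiv A X (n + 1)).symm w)) =
      ((singComplex A X).d (n + 1) n).hom w := by
  rw [← d_singEquiv, LinearEquiv.apply_symm_apply]

lemma d_singEquiv_of_mem_cycles (n : ℕ) {z : Chain A X (n + 2)} (hz : z ∈ cycles A X (n + 2)) :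
    ((singComplex A X).d (n + 1) n).hom (singEquiv A X (n + 1) z) = 0 := by
  rw [d_singEquiv, LinearMap.mem_ker.1 hz, map_zero]

lemma map_singEquiv (f : C(X, Y)) (n : ℕ) (c : Chain A X (n + 1)) :
    ((SSet.chainComplexMap (TopCat.toSSet.map (TopCat.ofHom f)) (ModuleCat.of A A)).f n).hom
      (singEquiv A X n c) = singEquiv A Y n (push A f (n + 1) c) := by
  refine LinearMap.congr_fun
    (f := ((SSet.chainComplexMap (TopCat.toSSet.map (TopCat.ofHom f)) (ModuleCat.of A A)).f n).hom
      ∘ₗ (singEquiv A X n).toLinearMap)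
    (g := (singEquiv A Y n).toLinearMap ∘ₗ push A f (n + 1)) (hom_ext fun σ => ?_) c
  simp only [LinearMap.comp_apply]
  change LinearMap.comp _ (toSing A X n) _ = toSing A Y n _
  rw [LinearMap.comp_apply, toSing_single, map_gen, push_single, toSing_single]
  congr 1

/-- Chain homotopic maps send a cycle to homologous cycles. -/
lemma exists_d_eq_of_homotopy {P Q : ChainComplex (ModuleCat.{u} A) ℕ} {F G : P ⟶ Q}
    (h : _root_.Homotopy F G) (n : ℕ) (x : P.X n)
    (hx : ∀ k, n = k + 1 → (P.d n k).hom x = 0) :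
    ∃ w : Q.X (n + 1), (Q.d (n + 1) n).hom w = (F.f n).hom x - (G.f n).hom x := by
  refine ⟨(h.hom n (n + 1)).hom x, ?_⟩
  rw [h.comm n, Homotopy.prevD_chainComplex]
  rcases n with _ | n
  · rw [Homotopy.dNext_zero_chainComplex]
    simp
  · rw [Homotopy.dNext_succ_chainComplex]
    simp [hx n rfl]

/-- Homotopic maps send a cycle to homologous cycles. -/
theorem exists_bd_eq_of_homotopic {f g : C(X, Y)} (H : f.Homotopic g) {n : ℕ} {z : Chain A X n}
    (hz : z ∈ cycles A X n) : ∃ y, bd A n y = push A f n z - push A g n z := by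
  obtain ⟨H⟩ := H
  rcases n with _ | n
  · refine ⟨0, ?_⟩
    have : push A f 0 = push A g 0 := hom_ext fun σ => by
      rw [push_single, push_single]
      congr 1
      ext t
      exact absurd t.2.2 (by simp)
    rw [this, sub_self, map_zero]
  · have h : _root_.Homotopy
        (SSet.chainComplexMap (TopCat.toSSet.map (TopCat.ofHom f)) (ModuleCat.of A A))
        (SSet.chainComplexMap (TopCat.toSSet.map (TopCat.ofHom g)) (ModuleCat.of A A)) :=
      TopCat.Homotopy.singularChainComplexFunctorObjMap
        (f := TopCat.ofHom f) (g := TopCat.ofHom g) H (ModuleCat.of A A)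
    obtain ⟨w, hw⟩ := exists_d_eq_of_homotopy h n (singEquiv A X n z) (by
      rintro k rfl
      exact d_singEquiv_of_mem_cycles k hz)
    refine ⟨(singEquiv A Y (n + 1)).symm w, (singEquiv A Y n).injective ?_⟩
    rw [singEquiv_bd_symm, map_sub, ← map_singEquiv, ← map_singEquiv]
    exact hw

/-- The higher singular homology modules are the reduced ones. -/
theorem nonempty_singularHomology_equiv (n : ℕ) :
    Nonempty (CBQuartic.singularHomology A X (n + 1) ≃ₗ[A] RedHomology A X (n + 2)) := by
  let S := (singComplex A X).sc' (n + 2) (n + 1) n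
  let E : S.moduleCatLeftHomologyData.H ≅ CBQuartic.singularHomology A X (n + 1) :=
    S.moduleCatHomologyIso.symm ≪≫
      ((singComplex A X).homologyIsoSc' (n + 2) (n + 1) n (by simp) (by simp)).symm
  let π : LinearMap.ker S.g.hom →ₗ[A] (S.moduleCatLeftHomologyData.H) :=
    (LinearMap.range S.moduleCatToCycles).mkQ
  let J₀ : cycles A X (n + 2) →ₗ[A] S.X₂ :=
    (singEquiv A X (n + 1)).toLinearMap.comp (Submodule.subtype _)
  let J : cycles A X (n + 2) →ₗ[A] LinearMap.ker S.g.hom :=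
    J₀.codRestrict _ fun z => LinearMap.mem_ker.2 (d_singEquiv_of_mem_cycles n z.2)
  refine nonempty_equiv_of_ker_eq (E.toLinearEquiv.toLinearMap ∘ₗ π ∘ₗ J) (toHomology A X (n + 2))
    ?_ (toHomology_surjective _) fun z => ?_
  · refine E.toLinearEquiv.surjective.comp ((Submodule.mkQ_surjective _).comp ?_)
    rintro ⟨w, hw⟩
    refine ⟨⟨(singEquiv A X (n + 1)).symm w, LinearMap.mem_ker.2 ?_⟩, ?_⟩
    · refine (singEquiv A X n).injective ?_
      exact (singEquiv_bd_symm n w).trans (hw.trans (map_zero (singEquiv A X n)).symm)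
    · exact Subtype.ext (LinearEquiv.apply_symm_apply (singEquiv A X (n + 1)) w)
  · rw [toHomology_eq_zero, LinearMap.comp_apply]
    refine (LinearEquiv.map_eq_zero_iff E.toLinearEquiv).trans ?_
    change (LinearMap.range S.moduleCatToCycles).mkQ (J z) = 0 ↔ _
    rw [Submodule.mkQ_apply, Submodule.Quotient.mk_eq_zero]
    constructor
    · rintro ⟨y, hy⟩
      refine ⟨(singEquiv A X (n + 2)).symm y, (singEquiv A X (n + 1)).injective ?_⟩
      exact (singEquiv_bd_symm (n + 1) y).trans (congrArg Subtype.val hy)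
    · rintro ⟨y, hy⟩
      refine ⟨singEquiv A X (n + 2) y, Subtype.ext ((d_singEquiv (n + 1) y).trans ?_)⟩
      rw [hy]
      rfl

end Chain

end

noncomputable section

open Simplex

namespace Chain

variable (A : Type u) [CommRing A] (X : Type) [TopologicalSpace X] {Y : Type} [TopologicalSpace Y]

/-! ### Homology of contractible spaces and of punctured vector spaces -/

variable {X} in
lemma nonempty_equiv_of_homotopyEquiv (e : ContinuousMap.HomotopyEquiv X Y) (n : ℕ) :
    Nonempty (RedHomology A X n ≃ₗ[A] RedHomology A Y n) :=
  nonempty_equiv_of_homotopy_inverse e.toFun e.invFun n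
    (fun z hz => by
      obtain ⟨y, hy⟩ := exists_bd_eq_of_homotopic e.left_inv hz
      exact ⟨y, by rw [hy, push_push, push_id]⟩)
    (fun z hz => by
      obtain ⟨y, hy⟩ := exists_bd_eq_of_homotopic e.right_inv hz
      exact ⟨y, by rw [hy, push_push, push_id]⟩)

variable {X A} in
/-- A constant map sends every chain to a multiple of the constant simplex. -/
lemma push_const (x : X) (n : ℕ) (c : Chain A X n) :
    ∃ a : A, push A (ContinuousMap.const X x) n c = Finsupp.single (ContinuousMap.const _ x) a := by
  induction c using Finsupp.induction_linear with
  | zero => exact ⟨0, by simp⟩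
  | add f g hf hg =>
    obtain ⟨a, ha⟩ := hf
    obtain ⟨b, hb⟩ := hg
    exact ⟨a + b, by rw [map_add, ha, hb, Finsupp.single_add]⟩
  | single σ a => exact ⟨a, push_single _ _ _ _⟩

variable {X A} in
lemma bd_const (x : X) (n : ℕ) (a : A) :
    bd A n (Finsupp.single (ContinuousMap.const (Simplex (n + 1)) x) a) =
      if Even n then Finsupp.single (ContinuousMap.const (Simplex n) x) a else 0 := by
  rw [← mul_one a, ← smul_eq_mul, ← Finsupp.smul_single, map_smul, bd_single]
  have h : ∀ i, (ContinuousMap.const (Simplex (n + 1)) x).comp (face n i) =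
    ContinuousMap.const (Simplex n) x := fun i => rfl
  simp only [h, ← Finset.sum_smul, Fin.sum_neg_one_pow, Nat.even_add_one, ite_not]
  split_ifs <;> simp

/-- Contractible spaces are acyclic. -/
theorem acyclic_of_contractible [ContractibleSpace X] : Acyclic A X := by
  intro n z hz
  obtain ⟨x, hx⟩ := id_nullhomotopic X
  obtain ⟨y, hy⟩ := exists_bd_eq_of_homotopic hx hz
  rw [push_id] at hy
  obtain ⟨a, ha⟩ := push_const x n z
  rw [ha] at hy
  by_cases hn : Even n
  · refine ⟨y + Finsupp.single (ContinuousMap.const _ x) a, ?_⟩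
    rw [map_add, hy, bd_const, if_pos hn, sub_add_cancel]
  · obtain ⟨k, rfl⟩ : ∃ k, n = k + 1 :=
      Nat.exists_eq_succ_of_ne_zero fun h => hn (h ▸ Even.zero)
    have h0 : bd A k (push A (ContinuousMap.const X x) (k + 1) z) = 0 := by
      rw [bd_push, LinearMap.mem_ker.1 hz, map_zero]
    rw [ha, bd_const, if_pos (by simpa [Nat.even_add_one] using hn)] at h0
    refine ⟨y, ?_⟩
    rw [hy, Finsupp.single_eq_zero.1 h0, Finsupp.single_zero, sub_zero]

variable {X} in
lemma acyclic_of_homeomorph {X' : Type} [TopologicalSpace X'] (e : X ≃ₜ X')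
    [ContractibleSpace X'] : Acyclic A X :=
  have := e.contractibleSpace
  acyclic_of_contractible A X

/-- The homology of `X` is that of a sphere of dimension `m - 1`; the degrees of `RedHomology` are
shifted by one. -/
def IsHomologySphere (m : ℕ) : Prop :=
  Nonempty (RedHomology A X m ≃ₗ[A] A) ∧ ∀ n, n ≠ m → Subsingleton (RedHomology A X n)

variable {A X} in
lemma IsHomologySphere.of_homotopyEquiv {m : ℕ} (h : IsHomologySphere A Y m)
    (e : ContinuousMap.HomotopyEquiv X Y) : IsHomologySphere A X m := by
  refine ⟨?_, fun n hn => ?_⟩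
  · obtain ⟨f⟩ := nonempty_equiv_of_homotopyEquiv A e m
    obtain ⟨g⟩ := h.1
    exact ⟨f.trans g⟩
  · obtain ⟨f⟩ := nonempty_equiv_of_homotopyEquiv A e n
    have := h.2 n hn
    exact f.toEquiv.subsingleton

lemma subsingleton_redHomology_zero [Nonempty X] : Subsingleton (RedHomology A X 0) := by
  refine subsingleton_of_forall_eq 0 fun z => ?_
  obtain ⟨z, rfl⟩ := toHomology_surjective 0 z
  rw [toHomology_eq_zero]
  obtain ⟨c, hc⟩ := z
  change ∃ y, bd A 0 y = c
  clear hc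
  obtain ⟨x⟩ := ‹Nonempty X›
  induction c using Finsupp.induction_linear with
  | zero => exact ⟨0, map_zero _⟩
  | add f g hf hg =>
    obtain ⟨a, ha⟩ := hf
    obtain ⟨b, hb⟩ := hg
    exact ⟨a + b, by rw [map_add, ha, hb]⟩
  | single σ a =>
    refine ⟨Finsupp.single (ContinuousMap.const _ x) a, ?_⟩
    rw [bd_const, if_pos Even.zero]
    congr 1
    ext t
    exact absurd t.2.2 (by simp)

/-- The empty space is the sphere of dimension `-1`. -/
lemma isHomologySphere_of_isEmpty [IsEmpty X] : IsHomologySphere A X 0 := by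
  have : IsEmpty (Simplex 0) := ⟨fun t => absurd t.2.2 (by simp)⟩
  have he : ∀ n, IsEmpty C(Simplex (n + 1), X) :=
    fun n => ⟨fun σ => isEmptyElim (σ (vert (n + 1) 0))⟩
  have hs : ∀ n, Subsingleton (Chain A X (n + 1)) := fun n => inferInstance
  constructor
  · let σ : C(Simplex 0, X) := ⟨isEmptyElim, continuous_of_const fun t => isEmptyElim t⟩
    have hσ : ∀ τ : C(Simplex 0, X), τ = σ := fun τ => ContinuousMap.ext fun t => isEmptyElim t
    let g : cycles A X 0 →ₗ[A] A := (Finsupp.lapply σ).comp (Submodule.subtype _)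
    refine nonempty_equiv_of_ker_eq (toHomology A X 0) g (toHomology_surjective 0)
      (fun a => ⟨⟨Finsupp.single σ a, trivial⟩, Finsupp.single_eq_same⟩) fun z => ?_
    rw [toHomology_eq_zero]
    constructor
    · rintro ⟨y, hy⟩
      rw [Subsingleton.elim y 0, map_zero] at hy
      change (z : Chain A X 0) σ = 0
      rw [← hy]; rfl
    · intro h
      refine ⟨0, ?_⟩
      rw [map_zero]
      ext τ
      rw [hσ τ]
      exact h.symm
  · intro n hn
    obtain ⟨k, rfl⟩ := Nat.exists_eq_succ_of_ne_zero hn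
    exact (toHomology_surjective (A := A) (X := X) (k + 1)).subsingleton

/-- The space `ℝ^m` without the origin. -/
abbrev Punctured (m : ℕ) : Type := {x : Fin m → ℝ // x ≠ 0}

/-- The complement of the closed half-line of points `(x₀, 0, …, 0)` with `s * x₀ ≤ 0`. -/
def slit (m : ℕ) (s : ℝ) : Set (Fin (m + 1) → ℝ) := {x | Fin.tail x ≠ 0 ∨ 0 < s * x 0}

lemma continuous_tail (m : ℕ) : Continuous (Fin.tail : (Fin (m + 1) → ℝ) → Fin m → ℝ) :=
  continuous_pi fun i => continuous_apply i.succ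

lemma isOpen_slit (m : ℕ) (s : ℝ) : IsOpen (slit m s) :=
  (isOpen_compl_singleton.preimage (continuous_tail m)).union
    (isOpen_lt continuous_const (continuous_const.mul (continuous_apply 0)))

lemma contractibleSpace_slit (m : ℕ) {s : ℝ} (hs : s ≠ 0) : ContractibleSpace (slit m s) := by
  have hs2 : 0 < s * s := mul_self_pos.2 hs
  refine StarConvex.contractibleSpace (x := Fin.cons s 0) (fun y hy a b ha hb hab => ?_)
    ⟨Fin.cons s 0, Or.inr (by simpa using hs2)⟩
  have h0 : s * (a • (Fin.cons s 0 : Fin (m + 1) → ℝ) + b • y) 0 = a * (s * s) + b * (s * y 0) := by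
    simp; ring
  have ht : Fin.tail (a • (Fin.cons s 0 : Fin (m + 1) → ℝ) + b • y) = b • Fin.tail y := by
    ext i; simp [Fin.tail]
  rcases hb.eq_or_lt with rfl | hb
  · right
    rw [h0]
    have : a = 1 := by linarith
    simp [this, hs2]
  · rcases hy with hy | hy
    · left
      rw [ht]
      exact smul_ne_zero hb.ne' hy
    · right
      rw [h0]
      have := mul_pos hb hy
      positivity

/-- The complement of a line in `ℝ^(m+1)` is homotopy equivalent to `ℝ^m` without the origin. -/
def slitInterEquiv (m : ℕ) (W : Set (Punctured (m + 1))) (hW : ∀ x, x ∈ W ↔ Fin.tail x.1 ≠ 0) :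
    ContinuousMap.HomotopyEquiv W (Punctured m) where
  toFun := ⟨fun x => ⟨Fin.tail x.1.1, (hW _).1 x.2⟩,
    ((continuous_tail m).comp (continuous_subtype_val.comp continuous_subtype_val)).subtype_mk _⟩
  invFun := ⟨fun y => ⟨⟨Fin.cons 0 y.1, fun h => y.2 (by
      ext i; simpa using congrFun h i.succ)⟩, (hW _).2 (by simpa using y.2)⟩, by
    refine Continuous.subtype_mk (Continuous.subtype_mk (continuous_pi fun i => ?_) _) _
    refine Fin.cases ?_ (fun i => ?_) i
    · simpa using continuous_const
    · simp only [Fin.cons_succ]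
      exact (continuous_apply i).comp (continuous_subtype_val (p := fun x : Fin m → ℝ => x ≠ 0))⟩
  left_inv := ⟨{
    toFun := fun p => ⟨⟨Fin.cons (p.1.1 * p.2.1.1 0) (Fin.tail p.2.1.1), fun h => (hW _).1 p.2.2 (by
      ext i; simpa using congrFun h i.succ)⟩, (hW _).2 (by simpa using (hW _).1 p.2.2)⟩
    continuous_toFun := by
      refine Continuous.subtype_mk (Continuous.subtype_mk (continuous_pi fun i => ?_) _) _
      refine Fin.cases ?_ (fun i => ?_) i
      · simp only [Fin.cons_zero]
        exact (continuous_subtype_val.comp continuous_fst).mul ((continuous_apply 0).comp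
          (continuous_subtype_val.comp (continuous_subtype_val.comp continuous_snd)))
      · simp only [Fin.cons_succ, Fin.tail]
        exact (continuous_apply i.succ).comp
          (continuous_subtype_val.comp (continuous_subtype_val.comp continuous_snd))
    map_zero_left := fun x => by
      apply Subtype.ext; apply Subtype.ext
      simp
    map_one_left := fun x => by
      apply Subtype.ext; apply Subtype.ext
      simp }⟩
  right_inv := by
    rw [show ContinuousMap.comp _ _ = ContinuousMap.id (Punctured m) from ?_]
    ext y
    simp

/-- Removing one or the other closed half of the first coordinate axis from `ℝ^(m+1)` leaves two
contractible open sets. They cover the complement of the origin, and their intersection is homotopy equivalent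
to the complement of the origin in `ℝ^m`. -/
theorem isHomologySphere_punctured (m : ℕ) : IsHomologySphere A (Punctured m) m := by
  induction m with
  | zero =>
    have : IsEmpty (Punctured 0) := ⟨fun x => x.2 (Subsingleton.elim _ _)⟩
    exact isHomologySphere_of_isEmpty A _
  | succ m ih =>
    let U : ℝ → Set (Punctured (m + 1)) := fun s => Subtype.val ⁻¹' slit m s
    have hac : ∀ s : ℝ, s ≠ 0 → Acyclic A (U s) := fun s hs => by
      have := contractibleSpace_slit m hs
      have hne : ∀ x : slit m s, x.1 ≠ 0 := by
        rintro ⟨x, hx⟩ rfl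
        rcases hx with hx | hx
        · exact hx rfl
        · simp at hx
      exact acyclic_of_homeomorph A (X' := slit m s)
        { toFun := fun x => ⟨x.1.1, x.2⟩
          invFun := fun x => ⟨⟨x.1, hne x⟩, x.2⟩
          left_inv := fun x => rfl
          right_inv := fun x => rfl
          continuous_toFun := by fun_prop
          continuous_invFun := (continuous_subtype_val.subtype_mk hne).subtype_mk _ }
    have hU : ∀ s, IsOpen (U s) := fun s => (isOpen_slit m s).preimage continuous_subtype_val
    have hcov : U 1 ∪ U (-1) = Set.univ := by
      refine Set.eq_univ_of_forall fun x => ?_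
      by_cases ht : Fin.tail x.1 = 0
      · have h0 : x.1 0 ≠ 0 := fun h0 => x.2 (by
          ext i
          refine Fin.cases h0 (fun i => ?_) i
          exact congrFun ht i)
        rcases h0.lt_or_gt with h | h
        · exact Or.inr (Or.inr (by linarith))
        · exact Or.inl (Or.inr (by linarith))
      · exact Or.inl (Or.inl ht)
    have hsusp : ∀ n, Nonempty (RedHomology A (Punctured (m + 1)) (n + 1) ≃ₗ[A]
        RedHomology A (Punctured m) n) := fun n => by
      obtain ⟨e⟩ := nonempty_equiv_of_acyclic_cover (hU 1) (hU (-1)) hcov (hac 1 one_ne_zero)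
        (hac (-1) (by norm_num)) n
      obtain ⟨f⟩ := nonempty_equiv_of_homotopyEquiv A (slitInterEquiv m (U 1 ∩ U (-1)) fun x => by
        constructor
        · rintro ⟨h | h, h' | h'⟩ <;> try assumption
          exact absurd h (by linarith)
        · exact fun h => ⟨Or.inl h, Or.inl h⟩) n
      exact ⟨e.trans f⟩
    refine ⟨?_, fun n hn => ?_⟩
    · obtain ⟨e⟩ := hsusp m
      obtain ⟨f⟩ := ih.1
      exact ⟨e.trans f⟩
    · rcases n with _ | n
      · have : Nonempty (Punctured (m + 1)) := ⟨⟨fun _ => 1, fun h => one_ne_zero (congrFun h 0)⟩⟩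
        exact subsingleton_redHomology_zero A _
      · obtain ⟨e⟩ := hsusp n
        have := ih.2 n (by omega)
        exact e.toEquiv.subsingleton

end Chain

end

noncomputable section

open CategoryTheory Limits AlgebraicTopology

namespace Chain

variable (A : Type u) [CommRing A] (X : Type) [TopologicalSpace X] {Y : Type} [TopologicalSpace Y]

/-! ### Betti numbers of disjoint unions of spheres and acyclic spaces -/

/-- A coproduct of copies of `A` is free on its index set. -/
lemma nonempty_sigma_equiv_finsupp (J : Type) :
    Nonempty ((∐ fun _ : J => ModuleCat.of A A : ModuleCat.{u} A) ≃ₗ[A] (J →₀ A)) := by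
  let g : J → (∐ fun _ : J => ModuleCat.of A A : ModuleCat.{u} A) := fun j =>
    (Sigma.ι (fun _ : J => ModuleCat.of A A) j).hom (1 : A)
  let F : (J →₀ A) →ₗ[A] (∐ fun _ : J => ModuleCat.of A A : ModuleCat.{u} A) :=
    Finsupp.linearCombination A g
  let G' : (∐ fun _ : J => ModuleCat.of A A : ModuleCat.{u} A) ⟶ ModuleCat.of A (J →₀ A) :=
    Sigma.desc fun j => ModuleCat.ofHom (Finsupp.lsingle j)
  let G : (∐ fun _ : J => ModuleCat.of A A : ModuleCat.{u} A) →ₗ[A] (J →₀ A) := G'.hom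
  have hG : ∀ j, G (g j) = Finsupp.single j 1 := fun j =>
    congrArg (fun f : ModuleCat.of A A ⟶ _ => f.hom (1 : A))
      (Sigma.ι_desc (f := fun _ : J => ModuleCat.of A A)
        (fun j => ModuleCat.ofHom (Finsupp.lsingle (R := A) (M := A) j)) j)
  have hF : ∀ j, F (Finsupp.single j 1) = g j := fun j => by
    simp [F]
  refine ⟨LinearEquiv.ofLinearMap G F ?_ ?_⟩
  · refine Finsupp.lhom_ext' fun j => LinearMap.ext_ring ?_
    exact (congrArg G (hF j)).trans (hG j)
  · have : ModuleCat.ofHom (F ∘ₗ G) = 𝟙 (∐ fun _ : J => ModuleCat.of A A : ModuleCat.{u} A) := by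
      refine Sigma.hom_ext _ _ fun j => ModuleCat.hom_ext (LinearMap.ext_ring ?_)
      exact (congrArg F (hG j)).trans (hF j)
    exact congrArg ModuleCat.Hom.hom this

variable {X} in
/-- A locally constant map with path connected fibres enumerates the path components. -/
lemma nonempty_zerothHomotopy_equiv {κ : Type} {π : X → κ} (hπ : IsLocallyConstant π)
    (hc : ∀ c, IsPathConnected (π ⁻¹' {c})) : Nonempty (ZerothHomotopy X ≃ κ) := by
  let F : ZerothHomotopy X → κ := Quotient.lift π fun x y (h : Joined x y) => by
    obtain ⟨p⟩ := h
    have := (hπ.comp_continuous p.continuous).apply_eq_of_preconnectedSpace 0 1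
    simpa using this
  refine ⟨Equiv.ofBijective F ⟨?_, fun c => ?_⟩⟩
  · rintro ⟨x⟩ ⟨y⟩ h
    have h : π x = π y := h
    exact Quotient.sound ((hc (π y)).joinedIn x h y rfl).joined
  · obtain ⟨x, hx, -⟩ := hc c
    exact ⟨Quotient.mk _ x, hx⟩

variable {X} in
lemma nonempty_singularHomology_zero_equiv {κ : Type} {π : X → κ} (hπ : IsLocallyConstant π)
    (hc : ∀ c, IsPathConnected (π ⁻¹' {c})) :
    Nonempty (CBQuartic.singularHomology A X 0 ≃ₗ[A] (κ →₀ A)) := by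
  obtain ⟨e⟩ := nonempty_zerothHomotopy_equiv hπ hc
  obtain ⟨f⟩ := nonempty_sigma_equiv_finsupp A (ZerothHomotopy X)
  let i : CBQuartic.singularHomology A X 0 ≃ₗ[A]
      (∐ fun _ : ZerothHomotopy X => ModuleCat.of A A : ModuleCat.{u} A) :=
    (TopCat.singularHomology₀Iso (TopCat.of X) (ModuleCat.of A A)).toLinearEquiv
  exact ⟨(i.trans f).trans (Finsupp.domLCongr e)⟩

/-- The homology modules of `X` are free, of rank `N` in degree `0`, of rank `k` in degree `d`, and
zero in all other degrees. -/
def HasBetti (N d k : ℕ) : Prop :=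
  (∀ i, Module.Free A (CBQuartic.singularHomology A X i)) ∧ CBQuartic.bettiNumber A X 0 = N ∧
    CBQuartic.bettiNumber A X d = k ∧ ∀ i, i ≠ 0 → i ≠ d → CBQuartic.bettiNumber A X i = 0

variable {A} in
lemma free_rank_of_equiv_fun [Nontrivial A] {M : Type u} [AddCommGroup M] [Module A M] {κ : Type}
    [Fintype κ] (e : Nonempty (M ≃ₗ[A] (κ → A))) :
    Module.Free A M ∧ Module.rank A M = Fintype.card κ := by
  obtain ⟨e⟩ := e
  refine ⟨Module.Free.of_equiv e.symm, ?_⟩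
  rw [e.rank_eq, rank_fun']

variable {A} in
lemma nonempty_pi_equiv_fun {κ : Type} (M : κ → Type u) [∀ c, AddCommGroup (M c)]
    [∀ c, Module A (M c)] (s : Finset κ) (hs : ∀ c ∈ s, Nonempty (M c ≃ₗ[A] A))
    (hs' : ∀ c ∉ s, Subsingleton (M c)) : Nonempty ((∀ c, M c) ≃ₗ[A] (s → A)) := by
  classical
  let g : ∀ c : s, M c ≃ₗ[A] A := fun c => (hs c.1 c.2).some
  let F : (∀ c, M c) →ₗ[A] (s → A) := LinearMap.pi fun c => (g c).toLinearMap ∘ₗ LinearMap.proj c.1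
  have hF : ∀ z c, F z c = g c (z c) := fun _ _ => rfl
  refine ⟨LinearEquiv.ofBijective F ⟨fun z w h => funext fun c => ?_, fun z => ?_⟩⟩
  · by_cases hc : c ∈ s
    · have := congrFun h ⟨c, hc⟩
      rw [hF, hF] at this
      exact (g ⟨c, hc⟩).injective this
    · have := hs' c hc
      exact Subsingleton.elim _ _
  · refine ⟨fun c => if hc : c ∈ s then (g ⟨c, hc⟩).symm (z ⟨c, hc⟩) else 0, funext fun c => ?_⟩
    rw [hF, dif_pos c.2]
    exact (g c).apply_symm_apply _

variable {X} in
/-- The Betti numbers of a finite disjoint union of path connected spaces, those with index in `s`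
being homology spheres of dimension `d + 1` and the others acyclic. -/
theorem hasBetti_of_isLocallyConstant [Nontrivial A] {κ : Type} [Fintype κ] {π : X → κ}
    (hπ : IsLocallyConstant π) (hc : ∀ c, IsPathConnected (π ⁻¹' {c})) {d : ℕ} (s : Finset κ)
    (hs : ∀ c ∈ s, IsHomologySphere A (π ⁻¹' {c}) (d + 2))
    (hs' : ∀ c ∉ s, Acyclic A (π ⁻¹' {c})) : HasBetti A X (Fintype.card κ) (d + 1) s.card := by
  classical
  have h0 : Nonempty (CBQuartic.singularHomology A X 0 ≃ₗ[A] (κ → A)) := by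
    obtain ⟨e⟩ := nonempty_singularHomology_zero_equiv A hπ hc
    exact ⟨e.trans (Finsupp.linearEquivFunOnFinite A A κ)⟩
  have hd : Nonempty (CBQuartic.singularHomology A X (d + 1) ≃ₗ[A] (s → A)) := by
    obtain ⟨e⟩ := nonempty_singularHomology_equiv (A := A) (X := X) d
    obtain ⟨f⟩ := nonempty_equiv_pi_fiber (A := A) hπ d
    obtain ⟨g⟩ := nonempty_pi_equiv_fun (fun c => RedHomology A (π ⁻¹' {c}) (d + 2)) s
      (fun c h => (hs c h).1) fun c h => (hs' c h).subsingleton _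
    exact ⟨(e.trans f).trans g⟩
  have hi : ∀ i, i ≠ 0 → i ≠ d + 1 → Subsingleton (CBQuartic.singularHomology A X i) := by
    intro i hi hid
    obtain ⟨i, rfl⟩ := Nat.exists_eq_succ_of_ne_zero hi
    obtain ⟨e⟩ := nonempty_singularHomology_equiv (A := A) (X := X) i
    obtain ⟨f⟩ := nonempty_equiv_pi_fiber (A := A) hπ i
    have : ∀ c, Subsingleton (RedHomology A (π ⁻¹' {c}) (i + 2)) := fun c => by
      by_cases h : c ∈ s
      · exact (hs c h).2 _ (by omega)
      · exact (hs' c h).subsingleton _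
    exact (e.trans f).toEquiv.subsingleton
  have hi' : ∀ i, i ≠ 0 → i ≠ d + 1 →
      Nonempty (CBQuartic.singularHomology A X i ≃ₗ[A] (Empty → A)) := fun i h h' =>
    have := hi i h h'
    ⟨LinearEquiv.ofSubsingleton _ _⟩
  refine ⟨fun i => ?_, (free_rank_of_equiv_fun h0).2, ?_, fun i h h' => ?_⟩
  · by_cases h : i = 0
    · subst h; exact (free_rank_of_equiv_fun h0).1
    · by_cases h' : i = d + 1
      · subst h'; exact (free_rank_of_equiv_fun hd).1
      · exact (free_rank_of_equiv_fun (hi' i h h')).1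
  · exact (free_rank_of_equiv_fun hd).2.trans (by simp)
  · exact (free_rank_of_equiv_fun (hi' i h h')).2.trans (by simp)

variable {A X} in
lemma HasBetti.of_homeomorph {N d k : ℕ} (h : HasBetti A Y N d k) (e : X ≃ₜ Y) :
    HasBetti A X N d k := by
  have E : ∀ i, CBQuartic.singularHomology A X i ≃ₗ[A] CBQuartic.singularHomology A Y i := fun i =>
    ((((singularHomologyFunctor (ModuleCat.{u} A) i).obj (ModuleCat.of A A)).mapIso
      (TopCat.isoOfHomeo (X := TopCat.of X) (Y := TopCat.of Y) e)).toLinearEquiv :)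
  have hb : ∀ i, CBQuartic.bettiNumber A X i = CBQuartic.bettiNumber A Y i :=
    fun i => (E i).rank_eq
  obtain ⟨h1, h2, h3, h4⟩ := h
  refine ⟨fun i => have := h1 i; Module.Free.of_equiv (E i).symm, ?_, ?_, ?_⟩
  · rw [hb, h2]
  · rw [hb, h3]
  · intro i hi hi'
    rw [hb, h4 i hi hi']

variable {X} in
lemma pathConnectedSpace_of_homotopyEquiv [PathConnectedSpace Y]
    (e : ContinuousMap.HomotopyEquiv X Y) : PathConnectedSpace X := by
  obtain ⟨H⟩ := e.left_inv
  have hx : ∀ x, Joined (e.invFun (e.toFun x)) x := fun x =>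
    ⟨{ toFun := fun t => H (t, x)
       source' := H.apply_zero x
       target' := H.apply_one x }⟩
  obtain ⟨y⟩ := (inferInstance : Nonempty Y)
  refine ⟨⟨e.invFun y⟩, fun x x' => (hx x).symm.trans (Joined.trans ?_ (hx x'))⟩
  exact ⟨(PathConnectedSpace.somePath (e.toFun x) (e.toFun x')).map e.invFun.continuous⟩

lemma pathConnectedSpace_punctured {m : ℕ} (hm : 2 ≤ m) : PathConnectedSpace (Punctured m) := by
  refine isPathConnected_iff_pathConnectedSpace.1
    (isPathConnected_compl_singleton_of_one_lt_rank (E := Fin m → ℝ) ?_ 0)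
  rw [rank_fin_fun]
  exact_mod_cast hm

end Chain

end

noncomputable section

open CBQuartic

namespace Components

variable {X Y : Type} [TopologicalSpace X] [TopologicalSpace Y]

/-! ### Counting connected components -/

lemma numCompactComponents_le : numCompactComponents X ≤ numComponents X :=
  Cardinal.mk_subtype_le _

/-- Homeomorphic spaces have the same connected components. -/
def componentsEquiv (e : X ≃ₜ Y) : ConnectedComponents X ≃ ConnectedComponents Y where
  toFun := e.continuous.connectedComponentsMap
  invFun := e.symm.continuous.connectedComponentsMap
  left_inv := by
    intro c
    obtain ⟨x, rfl⟩ := ConnectedComponents.surjective_coe c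
    simp
  right_inv := by
    intro c
    obtain ⟨x, rfl⟩ := ConnectedComponents.surjective_coe c
    simp

lemma componentsEquiv_mk (e : X ≃ₜ Y) (x : X) :
    componentsEquiv e (ConnectedComponents.mk x) = ConnectedComponents.mk (e x) := rfl

lemma numComponents_eq_of_homeomorph (e : X ≃ₜ Y) : numComponents X = numComponents Y :=
  Cardinal.mk_congr (componentsEquiv e)

lemma numCompactComponents_eq_of_homeomorph (e : X ≃ₜ Y) :
    numCompactComponents X = numCompactComponents Y := by
  refine Cardinal.mk_congr ((componentsEquiv e).subtypeEquiv fun c => ?_)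
  have : ConnectedComponents.mk ⁻¹' {c} =
      e ⁻¹' (ConnectedComponents.mk ⁻¹' {componentsEquiv e c}) := by
    ext x
    simp only [Set.mem_preimage, Set.mem_singleton_iff, ← componentsEquiv_mk,
      (componentsEquiv e).injective.eq_iff]
  rw [this, e.isCompact_preimage]

lemma mk_eq_mk {P : Set X} (hP : IsPreconnected P) {x y : X} (hx : x ∈ P) (hy : y ∈ P) :
    ConnectedComponents.mk x = ConnectedComponents.mk y :=
  ConnectedComponents.coe_eq_coe'.2 (hP.subset_connectedComponent hy hx)

lemma numComponents_le {κ : Type} [Fintype κ] (P : κ → Set X) (hP : ∀ k, IsPreconnected (P k))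
    (hcov : ∀ x, ∃ k, x ∈ P k) : numComponents X ≤ Fintype.card κ := by
  have h : ∀ c : ConnectedComponents X, ∃ k, ∃ x ∈ P k, ConnectedComponents.mk x = c := fun c => by
    obtain ⟨x, rfl⟩ := ConnectedComponents.surjective_coe c
    obtain ⟨k, hk⟩ := hcov x
    exact ⟨k, x, hk, rfl⟩
  choose g x hx hg using h
  rw [← Cardinal.mk_fintype]
  refine Cardinal.mk_le_of_injective (f := g) fun c d hcd => ?_
  rw [← hg c, ← hg d]
  exact mk_eq_mk (hP _) (hx c) (hcd ▸ hx d)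

lemma numComponents_le_one [PreconnectedSpace X] : numComponents X ≤ 1 :=
  Cardinal.le_one_iff_subsingleton.2 inferInstance

/-- If a cover by connected sets has as many members as there are components, then its members are
the components. -/
lemma exists_isLocallyConstant {κ : Type} [Fintype κ] (P : κ → Set X)
    (hP : ∀ k, IsPreconnected (P k)) (hcov : ∀ x, ∃ k, x ∈ P k)
    (hn : numComponents X = Fintype.card κ) :
    ∃ π : X → κ, IsLocallyConstant π ∧ ∀ k, (P k).Nonempty ∧ π ⁻¹' {k} = P k := by
  have h : ∀ c : ConnectedComponents X, ∃ k, ∃ x ∈ P k, ConnectedComponents.mk x = c := fun c => by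
    obtain ⟨x, rfl⟩ := ConnectedComponents.surjective_coe c
    obtain ⟨k, hk⟩ := hcov x
    exact ⟨k, x, hk, rfl⟩
  choose g x hx hg using h
  have hinj : Function.Injective g := fun c d hcd => by
    rw [← hg c, ← hg d]
    exact mk_eq_mk (hP _) (hx c) (hcd ▸ hx d)
  have : Finite (ConnectedComponents X) := Finite.of_injective g hinj
  have := Fintype.ofFinite (ConnectedComponents X)
  have hbij : Function.Bijective g := by
    refine (Fintype.bijective_iff_injective_and_card g).2 ⟨hinj, ?_⟩
    rw [numComponents, Cardinal.mk_fintype] at hn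
    exact_mod_cast hn
  have hd : DiscreteTopology (ConnectedComponents X) := inferInstance
  refine ⟨fun y => g (ConnectedComponents.mk y), ?_, fun k => ?_⟩
  · exact (IsLocallyConstant.of_discrete g).comp_continuous ConnectedComponents.continuous_coe
  · obtain ⟨c, rfl⟩ := hbij.2 k
    refine ⟨⟨x c, hx c⟩, Set.ext fun y => ⟨fun hy => ?_, fun hy => ?_⟩⟩
    · obtain ⟨k, hk⟩ := hcov y
      obtain ⟨d, rfl⟩ := hbij.2 k
      have hy : g (ConnectedComponents.mk y) = g c := hy
      rw [← hinj hy, mk_eq_mk (hP _) hk (hx d), hg]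
      exact hk
    · change g (ConnectedComponents.mk y) = g c
      rw [mk_eq_mk (hP _) hy (hx c), hg]

/-- A finite cover by disjoint closed sets is the family of fibres of a locally constant map. -/
lemma exists_isLocallyConstant_of_disjoint {κ : Type} [Fintype κ] (P : κ → Set X)
    (hP : ∀ k, IsClosed (P k)) (hcov : ∀ x, ∃ k, x ∈ P k)
    (hdisj : ∀ k l x, x ∈ P k → x ∈ P l → k = l) :
    ∃ π : X → κ, IsLocallyConstant π ∧ ∀ k, π ⁻¹' {k} = P k := by
  choose π hπ using hcov
  have hfib : ∀ k, π ⁻¹' {k} = P k := fun k =>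
    Set.ext fun x => ⟨fun h => h ▸ hπ x, fun h => hdisj _ _ x (hπ x) h⟩
  refine ⟨π, ?_, hfib⟩
  let _ : TopologicalSpace κ := ⊥
  have : DiscreteTopology κ := ⟨rfl⟩
  refine (IsLocallyConstant.iff_continuous π).2 (continuous_iff_isClosed.2 fun s _ => ?_)
  rw [← Set.biUnion_preimage_singleton]
  exact s.toFinite.isClosed_biUnion fun k _ => hfib k ▸ hP k

lemma le_numComponents {κ : Type} [Fintype κ] {π : X → κ} (hπ : IsLocallyConstant π)
    (hs : Function.Surjective π) : (Fintype.card κ : Cardinal) ≤ numComponents X := by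
  let _ : TopologicalSpace κ := ⊥
  have : DiscreteTopology κ := ⟨rfl⟩
  rw [← Cardinal.mk_fintype]
  refine Cardinal.mk_le_of_surjective (f := hπ.continuous.connectedComponentsLift) fun k => ?_
  obtain ⟨x, rfl⟩ := hs k
  exact ⟨ConnectedComponents.mk x, rfl⟩

lemma numCompactComponents_eq [CompactSpace X] : numCompactComponents X = numComponents X := by
  refine Cardinal.mk_congr (Equiv.subtypeUnivEquiv fun c => ?_)
  exact (isClosed_singleton.preimage ConnectedComponents.continuous_coe).isCompact

/-- If a positive function comes arbitrarily close to zero on every component that avoids a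
connected set, then at most one component is compact. -/
lemma numCompactComponents_le_one {P : Set X} (hP : IsPreconnected P) {w : X → ℝ}
    (hw : Continuous w) (hpos : ∀ x, 0 < w x)
    (h : ∀ x ∉ P, ∀ δ > 0, ∃ y, ConnectedComponents.mk y = ConnectedComponents.mk x ∧ w y < δ) :
    numCompactComponents X ≤ 1 := by
  rw [numCompactComponents, Cardinal.le_one_iff_subsingleton]
  have key : ∀ c : ConnectedComponents X, IsCompact (ConnectedComponents.mk ⁻¹' {c}) →
      ∃ x ∈ P, ConnectedComponents.mk x = c := by
    intro c hc
    obtain ⟨x, rfl⟩ := ConnectedComponents.surjective_coe c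
    by_contra hx
    have hxP : x ∉ P := fun h => hx ⟨x, h, rfl⟩
    obtain ⟨y, -, hy⟩ := hc.exists_isMinOn ⟨x, rfl⟩ hw.continuousOn
    obtain ⟨z, hz, hzy⟩ := h x hxP (w y) (hpos y)
    exact absurd (hy (show z ∈ _ from hz)) (not_le.2 hzy)
  refine ⟨fun c d => Subtype.ext ?_⟩
  obtain ⟨x, hx, hc⟩ := key c.1 c.2
  obtain ⟨y, hy, hd⟩ := key d.1 d.2
  rw [← hc, ← hd, mk_eq_mk hP hx hy]

/-- A finite preperfect set is empty. -/
lemma eq_empty_of_preperfect_of_finite {s : Set X} [T1Space X] (hs : Preperfect s)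
    (hf : s.Finite) : s = ∅ := by
  refine Set.eq_empty_of_forall_notMem fun x hx => ?_
  have hU : (s \ {x})ᶜ ∈ nhds x :=
    (hf.subset Set.sdiff_subset).isClosed.isOpen_compl.mem_nhds (by simp)
  obtain ⟨y, ⟨hy, hys⟩, hyx⟩ := accPt_iff_nhds.1 (hs x hx) _ hU
  exact hy ⟨hys, hyx⟩

end Components

end

noncomputable section

open CBQuartic Components unitInterval

/-! ### Graphs of two-valued square roots -/

/-- The set of points `(u, w)` with `w > 0` and `w = w₀ ± √(h u)`: two sheets over `{h ≥ 0}`, glued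
along `{h = 0}` and cut off at height zero. -/
abbrev Sheets {S : Type} (h : S → ℝ) (w₀ : ℝ) : Type :=
  {x : S × ℝ // 0 < x.2 ∧ (x.2 - w₀) ^ 2 = h x.1}

/-- The sets `T i` cover the space, each of them contains a highest point to which all its points
can climb inside `T i`, and from all its points one can descend inside `T i` to the level `m`. -/
structure PeakCover {S ι : Type} [TopologicalSpace S] (h : S → ℝ) (m M : ℝ) (T : ι → Set S) :
    Prop where
  cover : ∀ u, ∃ i, u ∈ T i
  up : ∀ i, ∃ p ∈ T i, h p = M ∧ ∀ u ∈ T i, ∃ γ : Path u p, (∀ t, γ t ∈ T i) ∧ Monotone (h ∘ γ)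
  down : ∀ i, ∀ u ∈ T i, ∃ v, h v = m ∧ ∃ γ : Path u v, (∀ t, γ t ∈ T i) ∧ Antitone (h ∘ γ)

namespace PeakCover

variable {S ι : Type} [TopologicalSpace S] {h : S → ℝ} {m M : ℝ} {T : ι → Set S}

lemma le (H : PeakCover h m M T) (u : S) : h u ≤ M := by
  obtain ⟨i, hi⟩ := H.cover u
  obtain ⟨p, -, hp, hup⟩ := H.up i
  obtain ⟨γ, -, hγ⟩ := hup u hi
  simpa [hp] using hγ (zero_le_one (α := I))

lemma ge (H : PeakCover h m M T) (u : S) : m ≤ h u := by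
  obtain ⟨i, hi⟩ := H.cover u
  obtain ⟨v, hv, γ, -, hγ⟩ := H.down i u hi
  simpa [hv] using hγ (zero_le_one (α := I))

lemma exists_eq (H : PeakCover h m M T) (hc : Continuous h) (i : ι) {c : ℝ} (hm : m ≤ c)
    (hM : c ≤ M) : ∃ u ∈ T i, h u = c := by
  obtain ⟨p, hp, hpM, -⟩ := H.up i
  obtain ⟨v, hv, γ, hγ, -⟩ := H.down i p hp
  have := mem_range_of_exists_le_of_exists_ge (c := c) (hc.comp γ.continuous)
    ⟨1, by simpa [hv]⟩ ⟨0, by simpa [hpM]⟩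
  obtain ⟨t, ht⟩ := this
  exact ⟨γ t, hγ t, ht⟩

end PeakCover

namespace Sheets

variable {S ι : Type} {h : S → ℝ} {w₀ m M : ℝ} {T : ι → Set S}

/-- The part of the sheets over a subset of the base. -/
def piece (h : S → ℝ) (w₀ : ℝ) (T : Set S) : Set (Sheets h w₀) := {x | x.1.1 ∈ T}

/-- The part of the lower sheet over a subset of the base. -/
def lowerPiece (h : S → ℝ) (w₀ : ℝ) (T : Set S) : Set (Sheets h w₀) := {x | x.1.1 ∈ T ∧ x.1.2 < w₀}

lemma nonneg (x : Sheets h w₀) : 0 ≤ h x.1.1 := x.2.2 ▸ sq_nonneg _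

lemma eq_upper {x : Sheets h w₀} (hx : w₀ ≤ x.1.2) : x.1.2 = w₀ + √(h x.1.1) := by
  rw [← x.2.2, Real.sqrt_sq (by linarith)]; ring

lemma eq_lower {x : Sheets h w₀} (hx : x.1.2 ≤ w₀) : x.1.2 = w₀ - √(h x.1.1) := by
  rw [← x.2.2, ← neg_sq, Real.sqrt_sq (by linarith)]; ring

variable [TopologicalSpace S]

/-- A path in the base lifts to the sheet with sign `s`. -/
lemma joinedIn_of_path {P : Set (Sheets h w₀)} (hc : Continuous h) {u v : S} (γ : Path u v) (s : ℝ)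
    (hs : s ^ 2 = 1) (h0 : ∀ t, 0 ≤ h (γ t)) (hw : ∀ t, 0 < w₀ + s * √(h (γ t)))
    (hP : ∀ x : Sheets h w₀, ∀ t, x.1 = (γ t, w₀ + s * √(h (γ t))) → x ∈ P)
    {x y : Sheets h w₀} (hx : x.1 = (u, w₀ + s * √(h u))) (hy : y.1 = (v, w₀ + s * √(h v))) :
    JoinedIn P x y := by
  have hmem : ∀ t, 0 < w₀ + s * √(h (γ t)) ∧ (w₀ + s * √(h (γ t)) - w₀) ^ 2 = h (γ t) := fun t =>
    ⟨hw t, by rw [add_sub_cancel_left, mul_pow, hs, one_mul, Real.sq_sqrt (h0 t)]⟩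
  refine ⟨{ toFun := fun t => ⟨(γ t, w₀ + s * √(h (γ t))), hmem t⟩
            continuous_toFun := ?_
            source' := Subtype.ext ?_
            target' := Subtype.ext ?_ }, fun t => hP _ t rfl⟩
  · refine Continuous.subtype_mk ?_ _
    have := γ.continuous
    fun_prop
  · simp [hx]
  · simp [hy]

/-- If the sheets meet over every set of the cover, or if there is only the upper sheet, the part over
each set is connected: all its points can be joined to the highest point. -/
lemma isPreconnected_piece (H : PeakCover h m M T) (hc : Continuous h) (hw : m ≤ 0 ∨ w₀ ≤ 0) (i : ι) :
    IsPreconnected (piece h w₀ (T i)) := by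
  obtain ⟨p, hp, hpM, hup⟩ := H.up i
  have hplus : ∀ x ∈ piece h w₀ (T i), w₀ ≤ x.1.2 → ∀ y : Sheets h w₀, y.1 = (p, w₀ + √M) →
      JoinedIn (piece h w₀ (T i)) x y := by
    intro x hx hxw y hy
    obtain ⟨γ, hγ, hmono⟩ := hup x.1.1 hx
    have hge : ∀ t, h x.1.1 ≤ h (γ t) := fun t => by
      simpa using hmono (show (0 : I) ≤ t from t.2.1)
    refine joinedIn_of_path hc γ 1 (by norm_num) (fun t => x.nonneg.trans (hge t)) (fun t => ?_)
      (fun z t hz => ?_) ?_ ?_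
    · rw [one_mul]
      have := Real.sqrt_le_sqrt (hge t)
      have h1 := eq_upper hxw
      have h2 := x.2.1
      linarith
    · change z.1.1 ∈ T i
      rw [hz]
      exact hγ t
    · rw [one_mul, ← eq_upper hxw]
    · rw [one_mul, hpM, hy]
  rcases Set.eq_empty_or_nonempty (piece h w₀ (T i)) with he | ⟨x₀, hx₀⟩
  · rw [he]; exact isPreconnected_empty
  have hM : 0 ≤ M := x₀.nonneg.trans (H.le _)
  have htop : 0 < w₀ + √M := by
    have h1 := Real.sqrt_le_sqrt (H.le x₀.1.1)
    have h2 := x₀.2.1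
    have h3 := Real.sqrt_nonneg (h x₀.1.1)
    rcases le_total w₀ x₀.1.2 with h4 | h4
    · have := eq_upper h4
      linarith
    · have := eq_lower h4
      linarith
  let y : Sheets h w₀ := ⟨(p, w₀ + √M), htop, by
    rw [add_sub_cancel_left, Real.sq_sqrt hM, hpM]⟩
  refine IsPathConnected.isConnected (show IsPathConnected _ from ⟨y, hp, fun {x} hx => JoinedIn.symm ?_⟩) |>.isPreconnected
  rcases le_or_gt w₀ x.1.2 with hxw | hxw
  · exact hplus x hx hxw y rfl
  · have hw₀ : 0 < w₀ := x.2.1.trans hxw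
    have hm : m ≤ 0 := hw.resolve_right (not_le.2 hw₀)
    obtain ⟨v, hv, δ, hδ, hanti⟩ := H.down i x.1.1 hx
    have hivt := mem_range_of_exists_le_of_exists_ge (c := (0 : ℝ)) (hc.comp δ.continuous)
      ⟨1, by simpa [hv]⟩ ⟨0, by simpa using x.nonneg⟩
    obtain ⟨s, hs⟩ := hivt
    have hs : h (δ s) = 0 := hs
    -- descend to the level zero, where the two sheets meet
    let δ' : Path x.1.1 (δ s) :=
      { toFun := fun t => δ (t * s)
        continuous_toFun := by fun_prop
        source' := by simp
        target' := by simp }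
    have h0 : ∀ t, 0 ≤ h (δ' t) := fun t => by
      refine hs.symm.trans_le ?_
      exact hanti (mul_le_of_le_one_left s.2.1 t.2.2 : t * s ≤ s)
    have hle : ∀ t, h (δ' t) ≤ h x.1.1 := fun t => by
      have := hanti (show (0 : I) ≤ t * s from (t * s).2.1)
      simp only [Function.comp_apply, Path.source] at this
      exact this
    let z : Sheets h w₀ := ⟨(δ s, w₀), hw₀, by simp [hs]⟩
    refine JoinedIn.trans (y := z) ?_ (hplus z (hδ s) le_rfl y rfl)
    refine joinedIn_of_path hc δ' (-1) (by norm_num) h0 (fun t => ?_) (fun z t hz => ?_) ?_ ?_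
    · have h1 := Real.sqrt_le_sqrt (hle t)
      have h2 := eq_lower hxw.le
      have h3 := x.2.1
      linarith
    · change z.1.1 ∈ T i
      rw [hz]
      exact hδ _
    · rw [neg_one_mul, ← sub_eq_add_neg, ← eq_lower hxw.le]
    · rw [hs, Real.sqrt_zero, mul_zero, add_zero]

/-- Climbing on the lower sheet means descending in the base. -/
lemma isPreconnected_lowerPiece (H : PeakCover (fun u => -h u) (-M) (-m) T) (hc : Continuous h)
    (hm : 0 < m) (i : ι) : IsPreconnected (lowerPiece h w₀ (T i)) := by
  obtain ⟨p, hp, hpm, hup⟩ := H.up i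
  have hpm : h p = m := neg_injective hpm
  rcases Set.eq_empty_or_nonempty (lowerPiece h w₀ (T i)) with he | ⟨x₀, hx₀, hxw₀⟩
  · rw [he]; exact isPreconnected_empty
  have hge : ∀ u, m ≤ h u := fun u => neg_le_neg_iff.1 (H.le u)
  have htop : 0 < w₀ - √m := by
    have h1 := Real.sqrt_le_sqrt (hge x₀.1.1)
    have h2 := x₀.2.1
    have := eq_lower hxw₀.le
    linarith
  let y : Sheets h w₀ := ⟨(p, w₀ - √m), htop, by
    rw [sub_sub_cancel_left, neg_sq, Real.sq_sqrt hm.le, hpm]⟩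
  have hy : y ∈ lowerPiece h w₀ (T i) := ⟨hp, sub_lt_self _ (Real.sqrt_pos.2 hm)⟩
  refine IsPathConnected.isConnected (show IsPathConnected _ from ⟨y, hy, fun {x} hx => JoinedIn.symm ?_⟩) |>.isPreconnected
  obtain ⟨hxT, hxw⟩ := hx
  obtain ⟨γ, hγ, hmono⟩ := hup x.1.1 hxT
  have hle : ∀ t, h (γ t) ≤ h x.1.1 := fun t => by
    simpa using hmono (show (0 : I) ≤ t from t.2.1)
  refine joinedIn_of_path hc γ (-1) (by norm_num) (fun t => hm.le.trans (hge _)) (fun t => ?_)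
    (fun z t hz => And.intro (a := z.1.1 ∈ T i) (b := z.1.2 < w₀) ?_ ?_) ?_ ?_
  · have h1 := Real.sqrt_le_sqrt (hle t)
    have h2 := eq_lower hxw.le
    have h3 := x.2.1
    linarith
  · rw [hz]; exact hγ t
  · rw [hz]
    have := Real.sqrt_pos.2 (hm.trans_le (hge (γ t)))
    simpa using this
  · rw [neg_one_mul, ← sub_eq_add_neg, ← eq_lower hxw.le]
  · rw [neg_one_mul, ← sub_eq_add_neg, hpm]

lemma isClosed_piece {T : Set S} (hT : IsClosed T) : IsClosed (piece h w₀ T) :=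
  hT.preimage (continuous_fst.comp continuous_subtype_val)

lemma continuous_height : Continuous fun x : Sheets h w₀ => x.1.2 :=
  continuous_snd.comp continuous_subtype_val

lemma numComponents_le_card [Fintype ι] (H : PeakCover h m M T) (hc : Continuous h)
    (hw : m ≤ 0 ∨ w₀ ≤ 0) : numComponents (Sheets h w₀) ≤ Fintype.card ι :=
  numComponents_le (fun i => piece h w₀ (T i)) (isPreconnected_piece H hc hw)
    fun x => H.cover x.1.1

/-- If the sheets meet and reach down to the height zero, then no component is compact. -/
lemma numCompactComponents_le_one_of_peakCover (H : PeakCover h m M T) (hc : Continuous h)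
    (hw : (m ≤ 0 ∧ 0 < w₀ ∧ w₀ ^ 2 ≤ M) ∨ (w₀ ≤ 0 ∧ m ≤ w₀ ^ 2)) :
    numCompactComponents (Sheets h w₀) ≤ 1 := by
  refine numCompactComponents_le_one isPreconnected_empty continuous_height (fun x => x.2.1)
    fun x _ δ hδ => ?_
  obtain ⟨i, hi⟩ := H.cover x.1.1
  have hpre := isPreconnected_piece (w₀ := w₀) H hc (hw.imp And.left And.left) i
  have hM : h x.1.1 ≤ M := H.le _
  have hx0 := x.2.1
  have hx := x.2.2
  have : ∃ δ', 0 < δ' ∧ δ' < δ ∧ m ≤ (δ' - w₀) ^ 2 ∧ (δ' - w₀) ^ 2 ≤ M := by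
    rcases hw with ⟨hm, h0, hM'⟩ | ⟨h0, hm⟩
    · refine ⟨min (δ / 2) w₀, by positivity, (min_le_left _ _).trans_lt (by linarith),
        hm.trans (sq_nonneg _), le_trans ?_ hM'⟩
      have h1 : 0 < min (δ / 2) w₀ := by positivity
      have h2 := min_le_right (δ / 2) w₀
      nlinarith
    · refine ⟨min (δ / 2) x.1.2, by positivity, (min_le_left _ _).trans_lt (by linarith),
        hm.trans ?_, le_trans ?_ (hx.trans_le hM)⟩
      · have h1 : 0 < min (δ / 2) x.1.2 := by positivity
        nlinarith
      · have h1 : 0 < min (δ / 2) x.1.2 := by positivity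
        have h2 := min_le_right (δ / 2) x.1.2
        nlinarith
  obtain ⟨δ', h0, hlt, hm', hM'⟩ := this
  obtain ⟨u, hu, hhu⟩ := H.exists_eq hc i hm' hM'
  exact ⟨⟨(u, δ'), h0, hhu.symm⟩, mk_eq_mk hpre hu hi, hlt⟩

/-- The upper (`s = 1`) or lower (`s = -1`) sheet over a set is a copy of that set, if it lies over
all of that set. -/
def homeomorphOfSign (hc : Continuous h) (T : Set S) (s : ℝ) (hs : s ^ 2 = 1)
    (hT : ∀ u ∈ T, 0 ≤ h u ∧ 0 < w₀ + s * √(h u)) (P : Set (Sheets h w₀))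
    (hP : ∀ x, x ∈ P ↔ x.1.1 ∈ T ∧ 0 ≤ s * (x.1.2 - w₀)) : P ≃ₜ T where
  toFun x := ⟨x.1.1.1, ((hP _).1 x.2).1⟩
  invFun u := ⟨⟨(u.1, w₀ + s * √(h u)), (hT u u.2).2, by
      rw [add_sub_cancel_left, mul_pow, hs, one_mul, Real.sq_sqrt (hT u u.2).1]⟩,
    (hP _).2 ⟨u.2, by
      rw [add_sub_cancel_left, ← mul_assoc, ← sq, hs, one_mul]; exact Real.sqrt_nonneg _⟩⟩
  left_inv x := by
    have h1 := ((hP _).1 x.2).2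
    have h2 : √(h x.1.1.1) = s * (x.1.1.2 - w₀) := by
      rw [← x.1.2.2, ← Real.sqrt_sq h1, mul_pow, hs, one_mul]
    apply Subtype.ext
    apply Subtype.ext
    apply Prod.ext
    · rfl
    · change w₀ + s * √(h x.1.1.1) = x.1.1.2
      rw [h2, ← mul_assoc, ← sq, hs]
      ring
  right_inv u := rfl
  continuous_toFun := by fun_prop
  continuous_invFun := by
    refine Continuous.subtype_mk (Continuous.subtype_mk ?_ _) _
    fun_prop

/-- If all points lie on the upper sheet, which covers a connected base, there is one component. -/
lemma numComponents_le_one_of_upper [PreconnectedSpace S] (hc : Continuous h)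
    (hpos : ∀ u, 0 ≤ h u ∧ 0 < w₀ + √(h u)) (hup : ∀ x : Sheets h w₀, w₀ ≤ x.1.2) :
    numComponents (Sheets h w₀) ≤ 1 := by
  let e := homeomorphOfSign (w₀ := w₀) hc Set.univ 1 (by norm_num)
    (fun u _ => by rw [one_mul]; exact hpos u) Set.univ
    (fun x => by simpa using hup x)
  let e' : Sheets h w₀ ≃ₜ S :=
    (Homeomorph.Set.univ _).symm.trans (e.trans (Homeomorph.Set.univ _))
  rw [numComponents_eq_of_homeomorph e']
  exact numComponents_le_one

end Sheets

end

noncomputable section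

open CBQuartic Components unitInterval

/-! ### The quartic form on the sphere -/

/-- The unit sphere of `ℝ^n`. -/
abbrev UnitSphere (n : ℕ) : Type := {u : Fin n → ℝ // ∑ k, u k ^ 2 = 1}

namespace UnitSphere

variable {n : ℕ}

/-- The sum of the fourth powers of the coordinates. -/
def quartic (u : UnitSphere n) : ℝ := ∑ k, u.1 k ^ 4

lemma continuous_coord (k : Fin n) : Continuous fun u : UnitSphere n => u.1 k :=
  (continuous_apply k).comp continuous_subtype_val

lemma continuous_quartic : Continuous (quartic (n := n)) :=
  continuous_finsetSum _ fun k _ => (continuous_coord k).pow 4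

instance : CompactSpace (UnitSphere n) := by
  have hcl : IsClosed {u : Fin n → ℝ | ∑ k, u k ^ 2 = 1} :=
    isClosed_eq (by fun_prop) continuous_const
  refine isCompact_iff_compactSpace.1 (Metric.isCompact_of_isClosed_isBounded hcl ?_)
  refine (Metric.isBounded_Icc (-1 : Fin n → ℝ) 1).subset fun u hu => ?_
  have h : ∀ k, u k ^ 2 ≤ 1 := fun k => by
    rw [← show ∑ k, u k ^ 2 = 1 from hu]
    exact Finset.single_le_sum (f := fun k => u k ^ 2) (fun k _ => sq_nonneg _) (Finset.mem_univ k)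
  exact ⟨fun k => (abs_le.1 ((sq_le_one_iff_abs_le_one _).1 (h k))).1,
    fun k => (abs_le.1 ((sq_le_one_iff_abs_le_one _).1 (h k))).2⟩

/-- The real number `1` or `-1`. -/
def sgn (b : Bool) : ℝ := if b then 1 else -1

lemma sgn_sq (b : Bool) : sgn b ^ 2 = 1 := by cases b <;> simp [sgn]

lemma sgn_mul_self (b : Bool) : sgn b * sgn b = 1 := by rw [← sq, sgn_sq]

lemma abs_sgn (b : Bool) : |sgn b| = 1 := by cases b <;> simp [sgn]

lemma sgn_mul_eq_abs {b : Bool} {x : ℝ} (h : 0 ≤ sgn b * x) : sgn b * x = |x| := by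
  rw [← abs_of_nonneg h, abs_mul, abs_sgn, one_mul]

lemma eq_sgn_mul_abs {b : Bool} {x : ℝ} (h : 0 ≤ sgn b * x) : x = sgn b * |x| := by
  rw [← sgn_mul_eq_abs h, ← mul_assoc, sgn_mul_self, one_mul]

lemma exists_sgn (x : ℝ) : ∃ b, 0 ≤ sgn b * x := by
  rcases le_total 0 x with h | h
  · exact ⟨true, by simpa [sgn] using h⟩
  · exact ⟨false, by simpa [sgn] using h⟩

/-- The closed orthant of the sphere with the given signs. -/
def orthant (ε : Fin n → Bool) : Set (UnitSphere n) := {u | ∀ k, 0 ≤ sgn (ε k) * u.1 k}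

/-- The set of points of the sphere closest to a given unit vector `± e_j`. -/
def cone (i : Fin n × Bool) : Set (UnitSphere n) := {u | ∀ k, |u.1 k| ≤ sgn i.2 * u.1 i.1}

lemma coord_nonneg (y : stdSimplex ℝ (Fin n)) (k : Fin n) : 0 ≤ y k := y.2.1 k

lemma sum_coord (y : stdSimplex ℝ (Fin n)) : ∑ k, y k = 1 := y.2.2

/-- The point of an orthant with given squares of the coordinates. -/
def signedRoot (ε : Fin n → Bool) (y : stdSimplex ℝ (Fin n)) : UnitSphere n :=
  ⟨fun k => sgn (ε k) * √(y k), by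
    simp only [mul_pow, sgn_sq, one_mul, Real.sq_sqrt (coord_nonneg y _)]
    exact sum_coord y⟩

/-- The squares of the coordinates. -/
def squares (u : UnitSphere n) : stdSimplex ℝ (Fin n) :=
  ⟨fun k => u.1 k ^ 2, fun _ => sq_nonneg _, u.2⟩

lemma quartic_eq (u : UnitSphere n) : quartic u = ∑ k, squares u k ^ 2 :=
  Finset.sum_congr rfl fun k _ => by
    change u.1 k ^ 4 = (u.1 k ^ 2) ^ 2
    ring

lemma signedRoot_sq (ε : Fin n → Bool) (y : stdSimplex ℝ (Fin n)) (k : Fin n) :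
    (signedRoot ε y).1 k ^ 2 = y k := by
  change (sgn (ε k) * √(y k)) ^ 2 = _
  rw [mul_pow, sgn_sq, one_mul, Real.sq_sqrt (coord_nonneg y _)]

lemma squares_signedRoot (ε : Fin n → Bool) (y : stdSimplex ℝ (Fin n)) :
    squares (signedRoot ε y) = y :=
  Subtype.ext (funext fun k => signedRoot_sq ε y k)

lemma signedRoot_mem_orthant (ε : Fin n → Bool) (y : stdSimplex ℝ (Fin n)) :
    signedRoot ε y ∈ orthant ε := fun k => by
  change 0 ≤ sgn (ε k) * (sgn (ε k) * √(y k))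
  rw [← mul_assoc, sgn_mul_self, one_mul]
  exact Real.sqrt_nonneg _

lemma signedRoot_squares {ε : Fin n → Bool} {u : UnitSphere n} (hu : u ∈ orthant ε) :
    signedRoot ε (squares u) = u :=
  Subtype.ext (funext fun k => by
    change sgn (ε k) * √(u.1 k ^ 2) = u.1 k
    rw [Real.sqrt_sq_eq_abs]
    exact (eq_sgn_mul_abs (hu k)).symm)

lemma continuous_signedRoot (ε : Fin n → Bool) : Continuous (signedRoot ε) := by
  refine Continuous.subtype_mk (continuous_pi fun k => ?_) _
  exact continuous_const.mul (((continuous_apply k).comp continuous_subtype_val).sqrt)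

lemma continuous_squares : Continuous (squares (n := n)) :=
  Continuous.subtype_mk (continuous_pi fun k => (continuous_coord k).pow 2) _

/-- The straight path between two points of the standard simplex. -/
def segmentPath (y z : stdSimplex ℝ (Fin n)) : Path y z where
  toFun t := ⟨(1 - (t : ℝ)) • y.1 + (t : ℝ) • z.1,
    convex_stdSimplex ℝ (Fin n) y.2 z.2 (by linarith [t.2.2]) t.2.1 (by ring)⟩
  continuous_toFun := by fun_prop
  source' := Subtype.ext (by simp)
  target' := Subtype.ext (by simp)

lemma segmentPath_apply (y z : stdSimplex ℝ (Fin n)) (t : I) (k : Fin n) :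
    segmentPath y z t k = (1 - t) * y k + t * z k := rfl

lemma exists_path {ε : Fin n → Bool} {u : UnitSphere n} (hu : u ∈ orthant ε)
    (z : stdSimplex ℝ (Fin n)) :
    ∃ γ : Path u (signedRoot ε z), ∀ t, γ t = signedRoot ε (segmentPath (squares u) z t) :=
  ⟨((segmentPath (squares u) z).map (continuous_signedRoot ε)).cast
    (signedRoot_squares hu).symm rfl, fun _ => rfl⟩

lemma quartic_signedRoot (ε : Fin n → Bool) (y : stdSimplex ℝ (Fin n)) :
    quartic (signedRoot ε y) = ∑ k, y k ^ 2 := by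
  rw [quartic_eq, squares_signedRoot]

/-- The barycentre of the standard simplex. -/
def barycentre (hn : 0 < n) : stdSimplex ℝ (Fin n) :=
  ⟨fun _ => (n : ℝ)⁻¹, fun _ => by positivity, by
    rw [Finset.sum_const, Finset.card_univ, Fintype.card_fin, nsmul_eq_mul,
      mul_inv_cancel₀ (by positivity)]⟩

/-- A vertex of the standard simplex. -/
def vertex (j : Fin n) : stdSimplex ℝ (Fin n) := ⟨Pi.single j 1, single_mem_stdSimplex ℝ j⟩

lemma sum_sq_segment (y z : stdSimplex ℝ (Fin n)) (t : I) :
    ∑ k, segmentPath y z t k ^ 2 = (1 - t) ^ 2 * ∑ k, y k ^ 2 +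
      2 * (1 - t) * t * ∑ k, y k * z k + t ^ 2 * ∑ k, z k ^ 2 := by
  simp only [segmentPath_apply, Finset.mul_sum, ← Finset.sum_add_distrib]
  exact Finset.sum_congr rfl fun k _ => by ring

lemma inv_le_sum_sq (hn : 0 < n) (y : stdSimplex ℝ (Fin n)) : (n : ℝ)⁻¹ ≤ ∑ k, y k ^ 2 := by
  have h : 0 ≤ ∑ k, (y k - (n : ℝ)⁻¹) ^ 2 := Finset.sum_nonneg fun _ _ => sq_nonneg _
  have h1 : ∑ k, y k = 1 := y.2.2
  have : ∑ k, (y k - (n : ℝ)⁻¹) ^ 2 = ∑ k, y k ^ 2 - (n : ℝ)⁻¹ := by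
    simp only [sub_sq, Finset.sum_add_distrib, Finset.sum_sub_distrib, ← Finset.sum_mul,
      ← Finset.mul_sum, h1, Finset.sum_const, Finset.card_univ, Fintype.card_fin, nsmul_eq_mul]
    have : (n : ℝ) ≠ 0 := by positivity
    field_simp
    ring
  linarith

lemma antitone_segment_barycentre (hn : 0 < n) (y : stdSimplex ℝ (Fin n)) :
    Antitone fun t : I => ∑ k, segmentPath y (barycentre hn) t k ^ 2 := by
  have h1 : ∑ k, y k = 1 := y.2.2
  have hc : ∀ k, barycentre hn k = (n : ℝ)⁻¹ := fun _ => rfl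
  have h : ∀ t : I, ∑ k, segmentPath y (barycentre hn) t k ^ 2 =
      (1 - t) ^ 2 * (∑ k, y k ^ 2 - (n : ℝ)⁻¹) + (n : ℝ)⁻¹ := fun t => by
    rw [sum_sq_segment]
    simp only [hc, ← Finset.sum_mul, h1, Finset.sum_const, Finset.card_univ, Fintype.card_fin,
      nsmul_eq_mul]
    have : (n : ℝ) ≠ 0 := by positivity
    field_simp
    ring
  intro s t hst
  simp only [h]
  have h2 := inv_le_sum_sq hn y
  have h3 : (s : ℝ) ≤ t := hst
  have h4 := t.2.2
  gcongr

lemma sum_sq_le_max {y : stdSimplex ℝ (Fin n)} {j : Fin n} (hj : ∀ k, y k ≤ y j) :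
    ∑ k, y k ^ 2 ≤ y j := by
  have h1 : ∑ k, y k = 1 := y.2.2
  calc ∑ k, y k ^ 2 ≤ ∑ k, y j * y k :=
        Finset.sum_le_sum fun k _ => by rw [sq]; exact mul_le_mul_of_nonneg_right (hj k) (y.2.1 k)
    _ = y j := by rw [← Finset.mul_sum, h1, mul_one]

lemma le_one_apply (y : stdSimplex ℝ (Fin n)) (j : Fin n) : y j ≤ 1 := by
  rw [← show ∑ k, y k = 1 from y.2.2]
  exact Finset.single_le_sum (f := fun k => y k) (fun k _ => y.2.1 k) (Finset.mem_univ j)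

lemma monotone_segment_vertex {y : stdSimplex ℝ (Fin n)} {j : Fin n} (hj : ∀ k, y k ≤ y j) :
    Monotone fun t : I => ∑ k, segmentPath y (vertex j) t k ^ 2 := by
  have hc : ∀ k, vertex j k = if k = j then (1 : ℝ) else 0 := fun k => Pi.single_apply j 1 k
  intro s t hst
  simp only [sum_sq_segment, hc, mul_ite, mul_one, mul_zero, Finset.sum_ite_eq', Finset.mem_univ,
    if_true, ite_pow, one_pow, ne_eq, OfNat.ofNat_ne_zero, not_false_eq_true, zero_pow]
  have h1 := sum_sq_le_max hj
  have h2 := le_one_apply y j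
  have h3 : (s : ℝ) ≤ t := hst
  have h4 := t.2.2
  have h5 := s.2.1
  have h6 : 0 ≤ (t - s : ℝ) * ((2 - (t + s)) * (y j - ∑ k, y k ^ 2) + (t + s) * (1 - y j)) := by
    refine mul_nonneg (by linarith) (add_nonneg (mul_nonneg ?_ ?_) (mul_nonneg ?_ ?_)) <;> linarith
  linarith

lemma exists_mem_orthant (u : UnitSphere n) : ∃ ε, u ∈ orthant ε := by
  choose ε hε using fun k => exists_sgn (u.1 k)
  exact ⟨ε, hε⟩

lemma exists_max (hn : 0 < n) (u : UnitSphere n) : ∃ j, ∀ k, squares u k ≤ squares u j := by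
  have : Nonempty (Fin n) := ⟨⟨0, hn⟩⟩
  obtain ⟨j, -, hj⟩ := Finset.exists_max_image Finset.univ (fun k => squares u k)
    Finset.univ_nonempty
  exact ⟨j, fun k => hj k (Finset.mem_univ k)⟩

lemma sum_barycentre_sq (hn : 0 < n) : ∑ k, barycentre hn k ^ 2 = (n : ℝ)⁻¹ := by
  have hc : ∀ k, barycentre hn k = (n : ℝ)⁻¹ := fun _ => rfl
  simp only [hc, Finset.sum_const, Finset.card_univ, Fintype.card_fin, nsmul_eq_mul]
  have : (n : ℝ) ≠ 0 := by positivity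
  field_simp

lemma sum_vertex_sq (j : Fin n) : ∑ k, vertex j k ^ 2 = 1 := by
  have hc : ∀ k, vertex j k = if k = j then (1 : ℝ) else 0 := fun k => Pi.single_apply j 1 k
  simp [hc]

/-- On an orthant the quartic form is smallest at the central point and largest at the vertices. -/
lemma peakCover_orthant (hn : 0 < n) :
    PeakCover (fun u : UnitSphere n => -quartic u) (-1) (-(n : ℝ)⁻¹) orthant where
  cover := exists_mem_orthant
  up ε := by
    refine ⟨_, signedRoot_mem_orthant ε (barycentre hn), ?_, fun u hu => ?_⟩
    · rw [quartic_signedRoot, sum_barycentre_sq]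
    · obtain ⟨γ, hγ⟩ := exists_path hu (barycentre hn)
      refine ⟨γ, fun t => hγ t ▸ signedRoot_mem_orthant _ _, fun s t hst => ?_⟩
      simp only [Function.comp_apply, hγ, quartic_signedRoot]
      exact neg_le_neg (antitone_segment_barycentre hn _ hst)
  down ε u hu := by
    obtain ⟨j, hj⟩ := exists_max hn u
    obtain ⟨γ, hγ⟩ := exists_path hu (vertex j)
    refine ⟨_, ?_, γ, fun t => hγ t ▸ signedRoot_mem_orthant _ _, fun s t hst => ?_⟩
    · rw [quartic_signedRoot, sum_vertex_sq]
    · simp only [Function.comp_apply, hγ, quartic_signedRoot]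
      exact neg_le_neg (monotone_segment_vertex hj hst)

lemma max_of_mem_cone {i : Fin n × Bool} {u : UnitSphere n} (hu : u ∈ cone i) (k : Fin n) :
    squares u k ≤ squares u i.1 :=
  sq_le_sq.2 ((hu k).trans (sgn_mul_eq_abs ((abs_nonneg _).trans (hu k))).le)

lemma signedRoot_mem_cone {i : Fin n × Bool} {ε : Fin n → Bool} (hε : ε i.1 = i.2)
    {y : stdSimplex ℝ (Fin n)} (hy : ∀ k, y k ≤ y i.1) : signedRoot ε y ∈ cone i := fun k => by
  change |sgn (ε k) * √(y k)| ≤ sgn i.2 * (sgn (ε i.1) * √(y i.1))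
  rw [hε, ← mul_assoc, sgn_mul_self, one_mul, abs_mul, abs_sgn, one_mul,
    abs_of_nonneg (Real.sqrt_nonneg _)]
  exact Real.sqrt_le_sqrt (hy k)

lemma exists_mem_orthant_of_mem_cone {i : Fin n × Bool} {u : UnitSphere n} (hu : u ∈ cone i) :
    ∃ ε, u ∈ orthant ε ∧ ε i.1 = i.2 := by
  obtain ⟨ε, hε⟩ := exists_mem_orthant u
  refine ⟨Function.update ε i.1 i.2, fun k => ?_, Function.update_self _ _ _⟩
  rcases eq_or_ne k i.1 with rfl | hk
  · rw [Function.update_self]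
    exact (abs_nonneg _).trans (hu i.1)
  · rw [Function.update_of_ne hk]
    exact hε k

lemma exists_mem_cone (hn : 0 < n) (u : UnitSphere n) : ∃ i, u ∈ cone i := by
  obtain ⟨j, hj⟩ := exists_max hn u
  obtain ⟨b, hb⟩ := exists_sgn (u.1 j)
  refine ⟨(j, b), fun k => ?_⟩
  change |u.1 k| ≤ sgn b * u.1 j
  rw [sgn_mul_eq_abs hb]
  exact sq_le_sq.1 (hj k)

lemma signedRoot_vertex_congr {ε ε' : Fin n → Bool} {j : Fin n} (h : ε j = ε' j) :
    signedRoot ε (vertex j) = signedRoot ε' (vertex j) := by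
  refine Subtype.ext (funext fun k => ?_)
  change sgn (ε k) * √(vertex j k) = sgn (ε' k) * √(vertex j k)
  rcases eq_or_ne k j with rfl | hk
  · rw [h]
  · have : vertex j k = 0 := Pi.single_eq_of_ne hk 1
    rw [this, Real.sqrt_zero, mul_zero, mul_zero]

/-- On the points closest to a unit vector `± e_j`, the quartic form is largest at that vector, and
smallest at the points with coordinates of equal size. -/
lemma peakCover_cone (hn : 0 < n) :
    PeakCover (fun u : UnitSphere n => quartic u) (n : ℝ)⁻¹ 1 cone where
  cover := exists_mem_cone hn
  up i := by
    have hseg : ∀ (y : stdSimplex ℝ (Fin n)) (_ : ∀ k, y k ≤ y i.1) (t : I) (k : Fin n),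
        segmentPath y (vertex i.1) t k ≤ segmentPath y (vertex i.1) t i.1 := fun y hy t k => by
      rw [segmentPath_apply, segmentPath_apply]
      have h1 : vertex i.1 k ≤ vertex i.1 i.1 := by
        rw [show vertex i.1 i.1 = 1 from Pi.single_eq_same _ _]
        exact le_one_apply _ _
      have h2 := t.2.1
      have h3 : (0 : ℝ) ≤ 1 - t := by linarith [t.2.2]
      have h4 := hy k
      gcongr
    refine ⟨signedRoot (fun _ => i.2) (vertex i.1), signedRoot_mem_cone rfl fun k => ?_, ?_,
      fun u hu => ?_⟩
    · rw [show vertex i.1 i.1 = 1 from Pi.single_eq_same _ _]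
      exact le_one_apply _ _
    · rw [quartic_signedRoot, sum_vertex_sq]
    · obtain ⟨ε, hε, hεi⟩ := exists_mem_orthant_of_mem_cone hu
      obtain ⟨γ, hγ⟩ := exists_path hε (vertex i.1)
      refine ⟨γ.cast rfl (signedRoot_vertex_congr hεi.symm), fun t => ?_, fun s t hst => ?_⟩
      · rw [Path.cast_coe, hγ]
        exact signedRoot_mem_cone hεi (hseg _ (max_of_mem_cone hu) t)
      · simp only [Function.comp_apply, Path.cast_coe, hγ, quartic_signedRoot]
        exact monotone_segment_vertex (max_of_mem_cone hu) hst
  down i u hu := by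
    obtain ⟨ε, hε, hεi⟩ := exists_mem_orthant_of_mem_cone hu
    obtain ⟨γ, hγ⟩ := exists_path hε (barycentre hn)
    refine ⟨_, ?_, γ, fun t => hγ t ▸ signedRoot_mem_cone hεi fun k => ?_, fun s t hst => ?_⟩
    · rw [quartic_signedRoot, sum_barycentre_sq]
    · rw [segmentPath_apply, segmentPath_apply]
      have h3 : (0 : ℝ) ≤ 1 - t := by linarith [t.2.2]
      have h4 := max_of_mem_cone hu k
      have h5 : barycentre hn k = barycentre hn i.1 := rfl
      rw [h5]
      gcongr
    · simp only [Function.comp_apply, hγ, quartic_signedRoot]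
      exact antitone_segment_barycentre hn _ hst

end UnitSphere

lemma PeakCover.affine {S ι : Type} [TopologicalSpace S] {h g : S → ℝ} {m M : ℝ} {T : ι → Set S}
    (H : PeakCover h m M T) (a : ℝ) {b : ℝ} (hb : 0 ≤ b) (hg : ∀ u, g u = a + b * h u) :
    PeakCover g (a + b * m) (a + b * M) T where
  cover := H.cover
  up i := by
    obtain ⟨p, hp, hpM, hup⟩ := H.up i
    refine ⟨p, hp, by rw [hg, hpM], fun u hu => ?_⟩
    obtain ⟨γ, hγ, hmono⟩ := hup u hu
    refine ⟨γ, hγ, fun s t hst => ?_⟩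
    simp only [Function.comp_apply, hg]
    have : h (γ s) ≤ h (γ t) := hmono hst
    gcongr
  down i u hu := by
    obtain ⟨v, hv, γ, hγ, hanti⟩ := H.down i u hu
    refine ⟨v, by rw [hg, hv], γ, hγ, fun s t hst => ?_⟩
    simp only [Function.comp_apply, hg]
    have : h (γ t) ≤ h (γ s) := hanti hst
    gcongr

end

noncomputable section

open CBQuartic Components Chain

/-! ### Level sets of positive homogeneous functions -/

section LevelSet

variable {n : ℕ} {G : (Fin n → ℝ) → ℝ}

/-- A level set of a positive function that is homogeneous of degree two is a deformation retract of
the space without the origin. -/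
def levelSetEquiv (hc : Continuous G) (hG : ∀ (t : ℝ) v, G (t • v) = t ^ 2 * G v)
    (hpos : ∀ v, v ≠ 0 → 0 < G v) {ρ : ℝ} (hρ : 0 < ρ) :
    ContinuousMap.HomotopyEquiv {v // G v = ρ} (Punctured n) :=
  have h0 : G 0 = 0 := by simpa using hG 0 0
  have hne : ∀ v : {v // G v = ρ}, v.1 ≠ 0 := fun v hv => by
    have := v.2
    rw [hv, h0] at this
    exact hρ.ne this
  have hval : ∀ v : Punctured n, G (√(ρ / G v.1) • v.1) = ρ := fun v => by
    have := hpos v.1 v.2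
    rw [hG, Real.sq_sqrt (by positivity), div_mul_cancel₀ _ this.ne']
  have hcont : Continuous fun v : Punctured n => √(ρ / G v.1) :=
    (continuous_const.div (hc.comp continuous_subtype_val) fun v => (hpos v.1 v.2).ne').sqrt
  { toFun := ⟨fun v => ⟨v.1, hne v⟩, continuous_subtype_val.subtype_mk hne⟩
    invFun := ⟨fun v => ⟨√(ρ / G v.1) • v.1, hval v⟩,
      (hcont.smul continuous_subtype_val).subtype_mk _⟩
    left_inv := by
      rw [show ContinuousMap.comp _ _ = ContinuousMap.id {v // G v = ρ} from ?_]
      ext1 v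
      refine Subtype.ext ?_
      change √(ρ / G v.1) • v.1 = v.1
      rw [v.2, div_self hρ.ne', Real.sqrt_one, one_smul]
    right_inv := ⟨{
      toFun := fun p => ⟨((1 - (p.1 : ℝ)) * √(ρ / G p.2.1) + p.1) • p.2.1, by
        have h1 : 0 < √(ρ / G p.2.1) := Real.sqrt_pos.2 (div_pos hρ (hpos _ p.2.2))
        refine smul_ne_zero (ne_of_gt ?_) p.2.2
        rcases p.1.2.1.eq_or_lt with h | h
        · rw [← h, sub_zero, one_mul, add_zero]
          exact h1
        · have h2 := p.1.2.2
          have h3 : 0 ≤ (1 - (p.1 : ℝ)) * √(ρ / G p.2.1) := mul_nonneg (by linarith) h1.le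
          linarith⟩
      continuous_toFun := by
        have h1 := hcont.comp (continuous_snd (X := unitInterval))
        have h2 : Continuous fun p : unitInterval × Punctured n => (p.1 : ℝ) :=
          continuous_subtype_val.comp continuous_fst
        exact ((((continuous_const.sub h2).mul h1).add h2).smul
          (continuous_subtype_val.comp continuous_snd)).subtype_mk _
      map_zero_left := fun v => by
        refine Subtype.ext ?_
        change ((1 - ((0 : unitInterval) : ℝ)) * √(ρ / G v.1) + ((0 : unitInterval) : ℝ)) • v.1 =
          √(ρ / G v.1) • v.1
        simp
      map_one_left := fun v => by
        refine Subtype.ext ?_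
        change ((1 - ((1 : unitInterval) : ℝ)) * √(ρ / G v.1) + ((1 : unitInterval) : ℝ)) • v.1 =
          v.1
        simp }⟩ }

end LevelSet

/-- The space is path connected and has the homology of a sphere of dimension `m - 1`. -/
def IsConnectedSphere (A : Type u) [CommRing A] (X : Type) [TopologicalSpace X] (m : ℕ) : Prop :=
  PathConnectedSpace X ∧ IsHomologySphere A X m

lemma IsConnectedSphere.of_homotopyEquiv {A : Type u} [CommRing A] {X Y : Type} [TopologicalSpace X]
    [TopologicalSpace Y] {m : ℕ} (h : IsConnectedSphere A Y m)
    (e : ContinuousMap.HomotopyEquiv X Y) : IsConnectedSphere A X m :=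
  have := h.1
  ⟨pathConnectedSpace_of_homotopyEquiv e, h.2.of_homotopyEquiv e⟩

variable (A : Type u) [CommRing A]

lemma isConnectedSphere_levelSet {n : ℕ} (hn : 2 ≤ n) {G : (Fin n → ℝ) → ℝ} (hc : Continuous G)
    (hG : ∀ (t : ℝ) v, G (t • v) = t ^ 2 * G v) (hpos : ∀ v, v ≠ 0 → 0 < G v) {ρ : ℝ}
    (hρ : 0 < ρ) : IsConnectedSphere A {v // G v = ρ} n :=
  IsConnectedSphere.of_homotopyEquiv
    ⟨pathConnectedSpace_punctured hn, isHomologySphere_punctured A n⟩ (levelSetEquiv hc hG hpos hρ)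

lemma isConnectedSphere_unitSphere {n : ℕ} (hn : 2 ≤ n) : IsConnectedSphere A (UnitSphere n) n := by
  refine isConnectedSphere_levelSet A hn (G := fun u => ∑ k, u k ^ 2) (by fun_prop) (fun t v => ?_)
    (fun v hv => ?_) one_pos
  · simp only [Pi.smul_apply, smul_eq_mul, mul_pow, Finset.mul_sum]
  · obtain ⟨k, hk⟩ := Function.ne_iff.1 hv
    exact Finset.sum_pos' (fun _ _ => sq_nonneg _) ⟨k, Finset.mem_univ k, by
      have : v k ≠ 0 := hk
      positivity⟩

lemma pathConnectedSpace_unitSphere {n : ℕ} (hn : 2 ≤ n) : PathConnectedSpace (UnitSphere n) :=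
  (isConnectedSphere_unitSphere ℤ hn).1

/-! ### The three configurations -/

/-- The numbers of components and of compact components determine the Betti numbers in the three
configurations. -/
def BettiDetermined (n : ℕ) (X : Type) [TopologicalSpace X] : Prop :=
  (numComponents X = 2 ^ n + 1 → HasBetti A X (2 ^ n + 1) (n - 1) 1) ∧
  (numCompactComponents X = 2 ^ n → HasBetti A X (2 ^ n) (n - 1) (2 ^ n)) ∧
  (numCompactComponents X = 2 → HasBetti A X 2 (n - 1) 2)

namespace BettiDetermined

variable {A} {n : ℕ} {X Y : Type} [TopologicalSpace X] [TopologicalSpace Y]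

lemma of_homeomorph (h : BettiDetermined A n Y) (e : X ≃ₜ Y) : BettiDetermined A n X := by
  obtain ⟨h1, h2, h3⟩ := h
  have hc := numComponents_eq_of_homeomorph e
  have hk := numCompactComponents_eq_of_homeomorph e
  exact ⟨fun h => (h1 (hc ▸ h)).of_homeomorph e, fun h => (h2 (hk ▸ h)).of_homeomorph e,
    fun h => (h3 (hk ▸ h)).of_homeomorph e⟩

lemma four_le (hn : 2 ≤ n) : 4 ≤ 2 ^ n := by
  simpa using Nat.pow_le_pow_right (n := 2) (by norm_num) hn

/-- With few components and at most one compact one, none of the configurations occurs. -/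
lemma of_le (hn : 2 ≤ n) (h1 : numComponents X ≤ (2 ^ n : ℕ)) (h2 : numCompactComponents X ≤ 1) :
    BettiDetermined A n X := by
  have h4 := four_le hn
  refine ⟨fun h => ?_, fun h => ?_, fun h => ?_⟩
  · rw [h] at h1
    have : 2 ^ n + 1 ≤ 2 ^ n := by exact_mod_cast h1
    omega
  · rw [h] at h2
    have : 2 ^ n ≤ 1 := by exact_mod_cast h2
    omega
  · rw [h] at h2
    have : 2 ≤ 1 := by exact_mod_cast h2
    omega

lemma of_le_one (hn : 2 ≤ n) (h1 : numComponents X ≤ 1) : BettiDetermined A n X :=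
  of_le hn (h1.trans (by exact_mod_cast Nat.one_le_two_pow)) (numCompactComponents_le.trans h1)

lemma of_numCompactComponents_eq {N : ℕ} (h1 : numComponents X = N)
    (h2 : numCompactComponents X = N) (hN : N ≤ 2 ^ n)
    (h3 : N = 2 ^ n → HasBetti A X (2 ^ n) (n - 1) (2 ^ n))
    (h4 : N = 2 → HasBetti A X 2 (n - 1) 2) : BettiDetermined A n X := by
  refine ⟨fun h => ?_, fun h => h3 ?_, fun h => h4 ?_⟩
  · rw [h1] at h
    have : N = 2 ^ n + 1 := by exact_mod_cast h
    omega
  · rw [h2] at h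
    exact_mod_cast h
  · rw [h2] at h
    exact_mod_cast h

end BettiDetermined

end

noncomputable section

open CBQuartic Components Chain

variable (A : Type u) [CommRing A]

/-! ### Disjoint unions of spheres and contractible spaces -/

lemma numComponents_eq_card {X κ : Type} [TopologicalSpace X] [Fintype κ] {π : X → κ}
    (hπ : IsLocallyConstant π) (hc : ∀ c, IsConnected (π ⁻¹' {c})) :
    numComponents X = Fintype.card κ := by
  refine le_antisymm (numComponents_le _ (fun c => (hc c).isPreconnected) fun x => ⟨π x, rfl⟩)
    (le_numComponents hπ fun c => ?_)
  obtain ⟨x, hx⟩ := (hc c).nonempty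
  exact ⟨x, hx⟩

variable {A} in
/-- A space whose components are spheres and contractible spaces. -/
lemma hasBetti_of_fibers [Nontrivial A] {X κ : Type} [TopologicalSpace X] [Fintype κ] {π : X → κ}
    (hπ : IsLocallyConstant π) {n : ℕ} (hn : 2 ≤ n) (s : Finset κ)
    (hs : ∀ c ∈ s, IsConnectedSphere A (π ⁻¹' {c}) n)
    (hs' : ∀ c ∉ s, ContractibleSpace (π ⁻¹' {c})) :
    HasBetti A X (Fintype.card κ) (n - 1) s.card := by
  obtain ⟨d, rfl⟩ := Nat.exists_eq_add_of_le' hn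
  refine hasBetti_of_isLocallyConstant A hπ (fun c => ?_) s (fun c hc => (hs c hc).2)
    fun c hc => have := hs' c hc; acyclic_of_contractible A _
  rw [isPathConnected_iff_pathConnectedSpace]
  by_cases hc : c ∈ s
  · exact (hs c hc).1
  · have := hs' c hc
    infer_instance

namespace Sheets

/-! ### Sheets over the sphere -/

section General

variable {S : Type} [TopologicalSpace S] {h : S → ℝ} {w₀ : ℝ}

lemma compactSpace [CompactSpace S] (hc : Continuous h) (h0 : 0 < w₀) (hlt : ∀ u, h u < w₀ ^ 2) :
    CompactSpace (Sheets h w₀) := by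
  have hset : {x : S × ℝ | 0 < x.2 ∧ (x.2 - w₀) ^ 2 = h x.1} =
      {x : S × ℝ | (x.2 - w₀) ^ 2 = h x.1} ∩ Set.univ ×ˢ Set.Icc 0 (2 * w₀) := by
    ext x
    constructor
    · rintro ⟨hx, hxh⟩
      have := hlt x.1
      have h2 := abs_lt_of_sq_lt_sq (hxh.trans_lt this) h0.le
      exact ⟨hxh, trivial, hx.le, by linarith [(abs_lt.1 h2).2]⟩
    · rintro ⟨hxh, -, -, -⟩
      have hxh : (x.2 - w₀) ^ 2 = h x.1 := hxh
      have h2 := abs_lt_of_sq_lt_sq (hxh.trans_lt (hlt x.1)) h0.le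
      exact ⟨by linarith [(abs_lt.1 h2).1], hxh⟩
  have hcomp : IsCompact {x : S × ℝ | 0 < x.2 ∧ (x.2 - w₀) ^ 2 = h x.1} := by
    rw [hset]
    refine (isCompact_univ.prod isCompact_Icc).inter_left (isClosed_eq ?_ ?_) <;> fun_prop
  exact isCompact_iff_compactSpace.1 hcomp

lemma sqrt_lt (h0 : 0 < w₀) {x : ℝ} (hx : x < w₀ ^ 2) : √x < w₀ :=
  (Real.sqrt_lt' h0).2 hx

end General

section Sphere

variable {n : ℕ} {h : UnitSphere n → ℝ} {w₀ m M : ℝ}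

open UnitSphere (sgn sgn_sq exists_sgn)

variable {A} in
/-- Two disjoint sheets, each of which is a copy of the sphere. -/
lemma bettiDetermined_of_two_sheets [Nontrivial A] (hn : 2 ≤ n) (hc : Continuous h) (h0 : 0 < w₀)
    (hpos : ∀ u, 0 < h u) (hlt : ∀ u, h u < w₀ ^ 2) : BettiDetermined A n (Sheets h w₀) := by
  have := compactSpace hc h0 hlt
  let P : Bool → Set (Sheets h w₀) := fun b => {x | 0 ≤ sgn b * (x.1.2 - w₀)}
  have hS := isConnectedSphere_unitSphere A hn
  have := hS.1
  have hcl : ∀ b, IsClosed (P b) := fun b => isClosed_le continuous_const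
    (continuous_const.mul (continuous_height.sub continuous_const))
  obtain ⟨π, hπ, hfib⟩ := exists_isLocallyConstant_of_disjoint P hcl
    (fun x => exists_sgn (x.1.2 - w₀)) fun b c x hb hc => by
      by_contra hbc
      have hb : 0 ≤ sgn b * (x.1.2 - w₀) := hb
      have hc : 0 ≤ sgn c * (x.1.2 - w₀) := hc
      have : x.1.2 - w₀ = 0 := by
        cases b <;> cases c <;> simp [sgn] at hb hc hbc <;> linarith
      have h1 := x.2.2
      rw [this] at h1
      linarith [hpos x.1.1]
  have e : ∀ b, π ⁻¹' {b} ≃ₜ UnitSphere n := fun b =>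
    (homeomorphOfSign hc Set.univ (sgn b) (sgn_sq b) (fun u _ => ⟨(hpos u).le, by
      have h1 := sqrt_lt h0 (hlt u)
      have h2 := Real.sqrt_nonneg (h u)
      cases b <;> simp [sgn] <;> linarith⟩) _ (fun x => by
        rw [hfib]
        exact (and_iff_right trivial).symm)).trans (Homeomorph.Set.univ _)
  have hfs : ∀ b, IsConnectedSphere A (π ⁻¹' {b}) n := fun b =>
    hS.of_homotopyEquiv (e b).toHomotopyEquiv
  have hnum := numComponents_eq_card hπ fun b => (isPathConnected_iff_pathConnectedSpace.2
    (hfs b).1).isConnected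
  have hB := hasBetti_of_fibers hπ hn Finset.univ (fun b _ => hfs b)
    fun b hb => absurd (Finset.mem_univ b) hb
  have h4 := BettiDetermined.four_le hn
  exact BettiDetermined.of_numCompactComponents_eq (N := 2) hnum
    (numCompactComponents_eq.trans hnum) (by omega) (fun h => by omega) fun _ => hB

/-- The upper sheet is a copy of the sphere, and no component of the lower sheet is compact. -/
lemma numCompactComponents_le_one_of_lower {ι : Type} {T : ι → Set (UnitSphere n)} (hn : 2 ≤ n)
    (hc : Continuous h) (H : PeakCover (fun u => -h u) (-M) (-m) T) (hm : 0 < m) (h0 : 0 < w₀)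
    (hmw : m < w₀ ^ 2) (hM : w₀ ^ 2 ≤ M) :
    IsConnected {x : Sheets h w₀ | w₀ ≤ x.1.2} ∧ numCompactComponents (Sheets h w₀) ≤ 1 := by
  have hge : ∀ u, m ≤ h u := fun u => neg_le_neg_iff.1 (H.le u)
  have hup : IsConnected {x : Sheets h w₀ | w₀ ≤ x.1.2} := by
    have := pathConnectedSpace_unitSphere hn
    let e := (homeomorphOfSign (w₀ := w₀) hc Set.univ 1 (by norm_num) (fun u _ =>
      ⟨hm.le.trans (hge u), by positivity⟩) {x : Sheets h w₀ | w₀ ≤ x.1.2} (fun x => by simp)).trans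
      (Homeomorph.Set.univ _)
    have : ConnectedSpace {x : Sheets h w₀ | w₀ ≤ x.1.2} :=
      e.symm.surjective.connectedSpace e.symm.continuous
    exact isConnected_iff_connectedSpace.2 this
  refine ⟨hup, numCompactComponents_le_one hup.isPreconnected continuous_height (fun x => x.2.1)
    fun x hx δ hδ => ?_⟩
  have hx : x.1.2 < w₀ := not_le.1 hx
  obtain ⟨i, hi⟩ := H.cover x.1.1
  have hlt := sqrt_lt h0 hmw
  have h1 : 0 < w₀ - √m := by linarith
  have h2 : 0 < min (δ / 2) (w₀ - √m) := by positivity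
  have h3 := min_le_right (δ / 2) (w₀ - √m)
  have h4 := min_le_left (δ / 2) (w₀ - √m)
  have h5 := Real.sqrt_nonneg m
  have h6 := Real.sq_sqrt hm.le
  set η := min (δ / 2) (w₀ - √m)
  have h7 : √m ≤ w₀ - η := by linarith
  obtain ⟨u, hu, hhu⟩ := H.exists_eq hc.neg i (c := -(η - w₀) ^ 2) (by nlinarith) (by nlinarith)
  refine ⟨⟨(u, η), h2, (neg_injective hhu).symm⟩, mk_eq_mk
    (isPreconnected_lowerPiece H hc hm i) ⟨hu, ?_⟩ ⟨hi, hx⟩, ?_⟩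
  · change η < w₀
    have := Real.sqrt_pos.2 hm
    linarith
  · change η < δ
    linarith

end Sphere

end Sheets

end

noncomputable section

open CBQuartic Components Chain UnitSphere

variable (A : Type u) [CommRing A]

/-! ### Components of compact sheets over the sphere -/

namespace UnitSphere

variable {n : ℕ}

/-- The function `a - b ∑ u_k⁴` on the sphere. -/
def height (a b : ℝ) (u : UnitSphere n) : ℝ := a - b * quartic u

lemma continuous_height (a b : ℝ) : Continuous (height (n := n) a b) :=
  continuous_const.sub (continuous_const.mul continuous_quartic)

lemma exists_perm_pair {i j i' j' : Fin n} (h : i ≠ j) (h' : i' ≠ j') :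
    ∃ σ : Equiv.Perm (Fin n), σ i' = i ∧ σ j' = j := by
  refine ⟨(Equiv.swap i' i).trans (Equiv.swap (Equiv.swap i' i j') j), ?_, ?_⟩
  · rw [Equiv.trans_apply, Equiv.swap_apply_left]
    refine Equiv.swap_apply_of_ne_of_ne (fun heq => h' ?_) h
    exact (Equiv.swap i' i).injective (by rw [Equiv.swap_apply_left]; exact heq)
  · rw [Equiv.trans_apply, Equiv.swap_apply_left]

/-- Coordinates can be permuted and their signs changed. -/
lemma exists_perm (u : UnitSphere n) (σ : Equiv.Perm (Fin n)) (ε : Fin n → Bool) :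
    ∃ v ∈ orthant ε, (∀ k, |v.1 k| = |u.1 (σ k)|) ∧ quartic v = quartic u := by
  have hv : ∑ k, (sgn (ε k) * |u.1 (σ k)|) ^ 2 = 1 := by
    simp only [mul_pow, sgn_sq, one_mul, sq_abs]
    rw [Equiv.sum_comp σ fun k => u.1 k ^ 2, u.2]
  have habs : ∀ k, abs (sgn (ε k) * |u.1 (σ k)|) = |u.1 (σ k)| := fun k => by
    rw [abs_mul, abs_sgn, one_mul, abs_abs]
  refine ⟨⟨_, hv⟩, fun k => ?_, habs, ?_⟩
  · change 0 ≤ sgn (ε k) * (sgn (ε k) * |u.1 (σ k)|)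
    rw [← mul_assoc, sgn_mul_self, one_mul]
    exact abs_nonneg _
  · calc quartic (⟨_, hv⟩ : UnitSphere n) = ∑ k, u.1 (σ k) ^ 4 :=
          Finset.sum_congr rfl fun k _ => by
            change (sgn (ε k) * |u.1 (σ k)|) ^ 4 = _
            rw [← Even.pow_abs (by decide), habs, Even.pow_abs (by decide)]
      _ = quartic u := Equiv.sum_comp σ fun k => u.1 k ^ 4

lemma isClosed_orthant (ε : Fin n → Bool) : IsClosed (orthant ε) := by
  have : orthant ε = ⋂ k, {u : UnitSphere n | 0 ≤ sgn (ε k) * u.1 k} := by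
    ext u; simp [orthant]
  rw [this]
  exact isClosed_iInter fun k => isClosed_le continuous_const
    (continuous_const.mul (continuous_coord k))

lemma isClosed_cone (i : Fin n × Bool) : IsClosed (cone i) := by
  have : cone i = ⋂ k, {u : UnitSphere n | |u.1 k| ≤ sgn i.2 * u.1 i.1} := by
    ext u; simp [cone]
  rw [this]
  exact isClosed_iInter fun k => isClosed_le (continuous_coord k).abs
    (continuous_const.mul (continuous_coord i.1))

lemma peakCover_height_orthant (hn : 0 < n) (a : ℝ) {b : ℝ} (hb : 0 ≤ b) :
    PeakCover (height (n := n) a b) (a - b) (a - b * (n : ℝ)⁻¹) orthant := by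
  have := (peakCover_orthant hn).affine (g := height a b) a hb fun u => by rw [height]; ring
  convert this using 1 <;> ring

lemma peakCover_height_cone (hn : 0 < n) (a : ℝ) {b : ℝ} (hb : b ≤ 0) :
    PeakCover (height (n := n) a b) (a - b * (n : ℝ)⁻¹) (a - b) cone := by
  have := (peakCover_cone hn).affine (g := height a b) a (neg_nonneg.2 hb)
    fun u => by rw [height]; ring
  convert this using 1 <;> ring

lemma peakCover_neg_height_orthant (hn : 0 < n) (a : ℝ) {b : ℝ} (hb : b ≤ 0) :
    PeakCover (fun u : UnitSphere n => -height a b u) (-(a - b)) (-(a - b * (n : ℝ)⁻¹)) orthant := by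
  have := (peakCover_orthant hn).affine (g := fun u => -height a b u) (-a) (neg_nonneg.2 hb)
    fun u => by rw [height]; ring
  convert this using 1 <;> ring

lemma peakCover_neg_height_cone (hn : 0 < n) (a : ℝ) {b : ℝ} (hb : 0 ≤ b) :
    PeakCover (fun u : UnitSphere n => -height a b u) (-(a - b * (n : ℝ)⁻¹)) (-(a - b)) cone := by
  have := (peakCover_cone hn).affine (g := fun u => -height a b u) (-a) hb
    fun u => by rw [height]; ring
  convert this using 1 <;> ring

end UnitSphere

namespace Sheets

section Disjoint

variable {S ι : Type} [TopologicalSpace S] {h : S → ℝ} {w₀ m M : ℝ} {T : ι → Set S}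

lemma piece_nonempty (H : PeakCover h m M T) (hM : 0 ≤ M) (h0 : 0 < w₀) (i : ι) :
    (piece h w₀ (T i)).Nonempty := by
  obtain ⟨p, hp, hpM, -⟩ := H.up i
  exact ⟨⟨(p, w₀ + √M), by positivity, by
    rw [add_sub_cancel_left, Real.sq_sqrt hM, hpM]⟩, hp⟩

lemma exists_isLocallyConstant_piece [Fintype ι] (H : PeakCover h m M T) (hc : Continuous h)
    (hT : ∀ i, IsClosed (T i)) (hm : m ≤ 0) (hM : 0 ≤ M) (h0 : 0 < w₀)
    (hdisj : ∀ i j u, u ∈ T i → u ∈ T j → 0 ≤ h u → i = j) :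
    ∃ π : Sheets h w₀ → ι, IsLocallyConstant π ∧ (∀ i, π ⁻¹' {i} = piece h w₀ (T i)) ∧
      numComponents (Sheets h w₀) = Fintype.card ι := by
  obtain ⟨π, hπ, hfib⟩ := exists_isLocallyConstant_of_disjoint (fun i => piece h w₀ (T i))
    (fun i => isClosed_piece (hT i)) (fun x => H.cover x.1.1)
    fun i j x hi hj => hdisj i j _ hi hj x.nonneg
  exact ⟨π, hπ, hfib, numComponents_eq_card hπ fun i => by
    rw [hfib]; exact ⟨piece_nonempty H hM h0 i, isPreconnected_piece H hc (Or.inl hm) i⟩⟩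

/-- If any two pieces are linked by a chain of pieces that meet, there is only one component. -/
lemma numComponents_le_one_of_meet (H : PeakCover h m M T) (hc : Continuous h) (hm : m ≤ 0)
    (hM : 0 ≤ M) (h0 : 0 < w₀)
    (hmeet : ∀ c : ι → ConnectedComponents (Sheets h w₀),
      (∀ i j u, u ∈ T i → u ∈ T j → 0 ≤ h u → c i = c j) → ∀ i j, c i = c j) :
    numComponents (Sheets h w₀) ≤ 1 := by
  have hpre := isPreconnected_piece (w₀ := w₀) H hc (Or.inl hm)
  choose p hp using piece_nonempty (w₀ := w₀) H hM h0
  have key := hmeet (fun i => ConnectedComponents.mk (p i)) fun i j u hi hj hu => by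
    let x : Sheets h w₀ := ⟨(u, w₀ + √(h u)), by positivity, by
      rw [add_sub_cancel_left, Real.sq_sqrt hu]⟩
    have h1 := mk_eq_mk (hpre i) (hp i) (show x ∈ piece h w₀ (T i) from hi)
    have h2 := mk_eq_mk (hpre j) (hp j) (show x ∈ piece h w₀ (T j) from hj)
    exact h1.trans h2.symm
  refine Cardinal.le_one_iff_subsingleton.2 ⟨fun c d => ?_⟩
  obtain ⟨x, rfl⟩ := ConnectedComponents.surjective_coe c
  obtain ⟨y, rfl⟩ := ConnectedComponents.surjective_coe d
  obtain ⟨i, hi⟩ := H.cover x.1.1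
  obtain ⟨j, hj⟩ := H.cover y.1.1
  exact (mk_eq_mk (hpre i) hi (hp i)).trans ((key i j).trans (mk_eq_mk (hpre j) (hp j) hj))

end Disjoint

variable {n : ℕ} {a b w₀ : ℝ}

/-- Either the parts over the orthants are disjoint, or there is only one component: a common point
of two parts has a vanishing coordinate, and by symmetry any coordinate can be made to vanish. -/
lemma orthant_dichotomy (hn : 0 < n) (hb : 0 ≤ b) (hm : a - b ≤ 0) (hM : 0 ≤ a - b * (n : ℝ)⁻¹)
    (h0 : 0 < w₀) :
    numComponents (Sheets (height (n := n) a b) w₀) ≤ 1 ∨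
      ∀ u : UnitSphere n, 0 ≤ height a b u → ∀ k, u.1 k ≠ 0 := by
  by_cases hz : ∀ u : UnitSphere n, 0 ≤ height a b u → ∀ k, u.1 k ≠ 0
  · exact Or.inr hz
  push Not at hz
  obtain ⟨u, hu, k, hk⟩ := hz
  refine Or.inl (numComponents_le_one_of_meet (peakCover_height_orthant hn a hb)
    (UnitSphere.continuous_height a b) hm hM h0 fun c hc => ?_)
  have hflip : ∀ ε j v, c (Function.update ε j v) = c ε := fun ε j v => by
    obtain ⟨w, hw, habs, hq⟩ := exists_perm u (Equiv.swap j k) ε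
    have hwj : w.1 j = 0 := by
      rw [← abs_eq_zero, habs, Equiv.swap_apply_left, hk, abs_zero]
    refine hc _ _ w (fun i => ?_) hw (by rw [height, hq]; exact hu)
    rcases eq_or_ne i j with rfl | hi
    · rw [hwj, mul_zero]
    · rw [Function.update_of_ne hi]; exact hw i
  have hpiece : ∀ (ε ε' : Fin n → Bool) (s : Finset (Fin n)), c (s.piecewise ε' ε) = c ε := by
    intro ε ε' s
    induction s using Finset.induction with
    | empty => rw [Finset.piecewise_empty]
    | insert j s _ ih => rw [Finset.piecewise_insert, hflip, ih]
  intro ε ε'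
  rw [← hpiece ε ε' Finset.univ, Finset.piecewise_univ]

lemma orthant_disjoint (hz : ∀ u : UnitSphere n, 0 ≤ height a b u → ∀ k, u.1 k ≠ 0)
    (ε ε' : Fin n → Bool) (u : UnitSphere n) (hε : u ∈ orthant ε) (hε' : u ∈ orthant ε')
    (hu : 0 ≤ height a b u) : ε = ε' := by
  by_contra hne
  obtain ⟨k, hk⟩ := Function.ne_iff.1 hne
  refine hz u hu k ?_
  have h1 := hε k
  have h2 := hε' k
  cases h3 : ε k <;> cases h4 : ε' k <;> simp [h3, h4, sgn] at hk h1 h2 <;> linarith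

/-- Either the parts over the cones are disjoint, or there is only one component: a common point of
two parts has two coordinates of maximal size, and by symmetry any two coordinates can be made so. -/
lemma cone_dichotomy (hn : 2 ≤ n) (hb : b ≤ 0) (hm : a - b * (n : ℝ)⁻¹ ≤ 0) (hM : 0 ≤ a - b)
    (h0 : 0 < w₀) :
    numComponents (Sheets (height (n := n) a b) w₀) ≤ 1 ∨
      ∀ i j (u : UnitSphere n), u ∈ cone i → u ∈ cone j → 0 ≤ height a b u → i = j := by
  by_cases hz : ∀ i j (u : UnitSphere n), u ∈ cone i → u ∈ cone j → 0 ≤ height a b u → i.1 = j.1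
  · refine Or.inr fun i j u hi hj hu => ?_
    obtain ⟨i, s⟩ := i
    obtain ⟨j, s'⟩ := j
    obtain rfl : i = j := hz _ _ u hi hj hu
    by_contra hne
    have hne : s ≠ s' := fun h => hne (by rw [h])
    have hu0 : ∀ k, u.1 k = 0 := fun k => by
      have h1 : |u.1 k| ≤ sgn s * u.1 i := hi k
      have h2 : |u.1 k| ≤ sgn s' * u.1 i := hj k
      have h3 := abs_nonneg (u.1 k)
      rw [← abs_eq_zero]
      cases s <;> cases s' <;> simp [sgn] at hne h1 h2 <;> linarith
    have := u.2
    simp [hu0] at this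
  push Not at hz
  obtain ⟨⟨i, s⟩, ⟨j, s'⟩, u, hi, hj, hu, hij⟩ := hz
  change i ≠ j at hij
  have hmax : ∀ k, |u.1 k| ≤ |u.1 i| ∧ |u.1 k| ≤ |u.1 j| := fun k =>
    ⟨sq_le_sq.1 (max_of_mem_cone hi k), sq_le_sq.1 (max_of_mem_cone hj k)⟩
  refine Or.inl (numComponents_le_one_of_meet (peakCover_height_cone (by omega) a hb)
    (UnitSphere.continuous_height a b) hm hM h0 fun c hc => ?_)
  have hne : ∀ i' j' t t', i' ≠ j' → c (i', t) = c (j', t') := fun i' j' t t' hij' => by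
    obtain ⟨σ, hσi, hσj⟩ := exists_perm_pair hij hij'
    obtain ⟨w, hw, habs, hq⟩ := exists_perm u σ (fun k => if k = i' then t else t')
    refine hc _ _ w (fun k => ?_) (fun k => ?_) (by rw [height, hq]; exact hu)
    · have h1 : 0 ≤ sgn t * w.1 i' := by simpa using hw i'
      change |w.1 k| ≤ sgn t * w.1 i'
      rw [sgn_mul_eq_abs h1, habs, habs, hσi]
      exact (hmax _).1
    · have h1 : 0 ≤ sgn t' * w.1 j' := by simpa [hij'.symm] using hw j'
      change |w.1 k| ≤ sgn t' * w.1 j'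
      rw [sgn_mul_eq_abs h1, habs, habs, hσj]
      exact (hmax _).2
  rintro ⟨i', t⟩ ⟨j', t'⟩
  rcases eq_or_ne i' j' with rfl | hij'
  · have : Nontrivial (Fin n) := Fin.nontrivial_iff_two_le.2 hn
    obtain ⟨k, hk⟩ := exists_ne i'
    exact (hne i' k t true hk.symm).trans (hne k i' true t' hk)
  · exact hne _ _ _ _ hij'

end Sheets

end

noncomputable section

open CBQuartic Components Chain UnitSphere

variable (A : Type u) [CommRing A]

/-! ### Parts over the orthants are ellipsoids -/

namespace Sheets

variable {n : ℕ} {a b w₀ : ℝ}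

/-- The quadratic polynomial that cuts out the part of the sheets over an orthant in the coordinates
`z_k = u_k² / w`. -/
def quadric (a b w₀ : ℝ) (z : Fin n → ℝ) : ℝ :=
  b * ∑ k, z k ^ 2 + (1 - w₀ * ∑ k, z k) ^ 2 - a * (∑ k, z k) ^ 2

lemma sum_pos_of_quadric {z : Fin n → ℝ} (hz : ∀ k, 0 ≤ z k) (h : quadric a b w₀ z ≤ 0) :
    0 < ∑ k, z k := by
  refine (Finset.sum_nonneg fun k _ => hz k).lt_of_ne fun h0 => ?_
  have h1 := (Finset.sum_eq_zero_iff_of_nonneg fun k _ => hz k).1 h0.symm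
  have h2 : ∀ k, z k = 0 := fun k => h1 k (Finset.mem_univ k)
  simp [quadric, h2] at h
  linarith

/-- Nonnegative vectors with positive sum, scaled to lie in the standard simplex. -/
def normalize (z : Fin n → ℝ) (hz : ∀ k, 0 ≤ z k) (hs : 0 < ∑ k, z k) : stdSimplex ℝ (Fin n) :=
  ⟨fun k => z k / ∑ k, z k, fun k => div_nonneg (hz k) hs.le, by
    rw [← Finset.sum_div, div_self hs.ne']⟩

lemma height_signedRoot_normalize (ε : Fin n → Bool) {z : Fin n → ℝ} (hz : ∀ k, 0 ≤ z k)
    (hs : 0 < ∑ k, z k) : height a b (signedRoot ε (normalize z hz hs)) * (∑ k, z k) ^ 2 =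
      (1 - w₀ * ∑ k, z k) ^ 2 - quadric a b w₀ z := by
  have h1 : ∑ k, normalize z hz hs k ^ 2 = (∑ k, z k ^ 2) / (∑ k, z k) ^ 2 := by
    rw [Finset.sum_div]
    exact Finset.sum_congr rfl fun k _ => div_pow _ _ _
  rw [height, quartic_signedRoot, h1, quadric]
  field_simp
  ring

/-- The coordinates `z_k = u_k² / w` on the part of the sheets over an orthant. -/
def pieceHomeomorph (ε : Fin n → Bool) :
    piece (height (n := n) a b) w₀ (orthant ε) ≃ₜ
      {z : Fin n → ℝ // (∀ k, 0 ≤ z k) ∧ quadric a b w₀ z = 0} where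
  toFun x := ⟨fun k => x.1.1.1.1 k ^ 2 / x.1.1.2, fun k => div_nonneg (sq_nonneg _) x.1.2.1.le, by
    have h1 : ∑ k, (x.1.1.1.1 k ^ 2 / x.1.1.2) ^ 2 = quartic x.1.1.1 / x.1.1.2 ^ 2 := by
      rw [quartic, Finset.sum_div]
      exact Finset.sum_congr rfl fun k _ => by rw [div_pow]; ring
    have h2 : ∑ k, x.1.1.1.1 k ^ 2 / x.1.1.2 = 1 / x.1.1.2 := by
      rw [← Finset.sum_div, x.1.1.1.2]
    have h3 := x.1.2.1.ne'
    have h4 : (x.1.1.2 - w₀) ^ 2 = a - b * quartic x.1.1.1 := x.1.2.2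
    rw [quadric, h1, h2]
    field_simp
    linarith⟩
  invFun z := ⟨⟨(signedRoot ε (normalize z.1 z.2.1 (sum_pos_of_quadric z.2.1 z.2.2.le)),
      1 / ∑ k, z.1 k), by
    have hs := sum_pos_of_quadric z.2.1 z.2.2.le
    refine ⟨by positivity, ?_⟩
    have h1 := (height_signedRoot_normalize (a := a) (b := b) (w₀ := w₀) ε z.2.1 hs).trans
      (show _ = (1 - w₀ * ∑ k, z.1 k) ^ 2 by rw [z.2.2, sub_zero])
    rw [← mul_left_inj' (pow_pos hs 2).ne', h1, ← mul_pow]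
    congr 1
    field_simp⟩, signedRoot_mem_orthant _ _⟩
  left_inv x := by
    have h2 : ∑ k, x.1.1.1.1 k ^ 2 / x.1.1.2 = 1 / x.1.1.2 := by
      rw [← Finset.sum_div, x.1.1.1.2]
    have h3 := x.1.2.1.ne'
    refine Subtype.ext (Subtype.ext (Prod.ext ?_ ?_))
    · change signedRoot ε _ = x.1.1.1
      refine Eq.trans ?_ (signedRoot_squares x.2)
      congr 1
      refine Subtype.ext (funext fun k => ?_)
      change x.1.1.1.1 k ^ 2 / x.1.1.2 / ∑ k, x.1.1.1.1 k ^ 2 / x.1.1.2 = x.1.1.1.1 k ^ 2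
      rw [h2]
      field_simp
    · change 1 / ∑ k, x.1.1.1.1 k ^ 2 / x.1.1.2 = x.1.1.2
      rw [h2, one_div_one_div]
  right_inv z := by
    have hs := sum_pos_of_quadric z.2.1 z.2.2.le
    refine Subtype.ext (funext fun k => ?_)
    change (signedRoot ε (normalize z.1 _ hs)).1 k ^ 2 / (1 / ∑ k, z.1 k) = z.1 k
    rw [signedRoot_sq]
    change z.1 k / (∑ k, z.1 k) / (1 / ∑ k, z.1 k) = z.1 k
    field_simp
  continuous_toFun := by
    refine Continuous.subtype_mk (continuous_pi fun k => ?_) _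
    have h1 : Continuous fun x : piece (height (n := n) a b) w₀ (orthant ε) => x.1.1.1.1 k :=
      (continuous_coord k).comp
        (continuous_fst.comp (continuous_subtype_val.comp continuous_subtype_val))
    exact (h1.pow 2).div (continuous_height.comp continuous_subtype_val) fun x => x.1.2.1.ne'
  continuous_invFun := by
    have h0 : ∀ k, Continuous fun z : {z : Fin n → ℝ // (∀ k, 0 ≤ z k) ∧ quadric a b w₀ z = 0} =>
      z.1 k := fun k => (continuous_apply k).comp continuous_subtype_val
    have h1 := continuous_finsetSum Finset.univ fun k _ => h0 k
    have h2 := fun z : {z : Fin n → ℝ // (∀ k, 0 ≤ z k) ∧ quadric a b w₀ z = 0} =>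
      (sum_pos_of_quadric z.2.1 z.2.2.le).ne'
    refine Continuous.subtype_mk (Continuous.subtype_mk (Continuous.prodMk ?_ ?_) _) _
    · refine (continuous_signedRoot ε).comp (Continuous.subtype_mk (continuous_pi fun k => ?_) _)
      exact (h0 k).div h1 h2
    · exact continuous_const.div h1 h2

/-- The positive definite form whose level set is a translate of the quadric. -/
def ellipsoidForm (n : ℕ) (b κ : ℝ) (v : Fin n → ℝ) : ℝ :=
  b * (∑ k, v k ^ 2 - (∑ k, v k) ^ 2 / n) + κ * (∑ k, v k) ^ 2

lemma ellipsoidForm_smul (κ t : ℝ) (v : Fin n → ℝ) :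
    ellipsoidForm n b κ (t • v) = t ^ 2 * ellipsoidForm n b κ v := by
  simp only [ellipsoidForm, Pi.smul_apply, smul_eq_mul, mul_pow, ← Finset.mul_sum]
  ring

lemma ellipsoidForm_pos (hn : 0 < n) (hb : 0 < b) {κ : ℝ} (hκ : 0 < κ) {v : Fin n → ℝ}
    (hv : v ≠ 0) : 0 < ellipsoidForm n b κ v := by
  have hn' : (0 : ℝ) < n := by exact_mod_cast hn
  have h1 : ∑ k, v k ^ 2 - (∑ k, v k) ^ 2 / n = ∑ k, (v k - (∑ k, v k) / n) ^ 2 := by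
    simp only [sub_sq, Finset.sum_add_distrib, Finset.sum_sub_distrib, ← Finset.sum_mul,
      ← Finset.mul_sum, Finset.sum_const, Finset.card_univ, Fintype.card_fin, nsmul_eq_mul]
    field_simp
    ring
  have h2 : 0 ≤ ∑ k, (v k - (∑ k, v k) / n) ^ 2 := Finset.sum_nonneg fun _ _ => sq_nonneg _
  rw [ellipsoidForm, h1]
  refine (add_nonneg (mul_nonneg hb.le h2) (mul_nonneg hκ.le (sq_nonneg _))).lt_of_ne fun h => hv ?_
  have h3 := mul_nonneg hb.le h2
  have h4 := mul_nonneg hκ.le (sq_nonneg (∑ k, v k))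
  have h5 : ∑ k, (v k - (∑ k, v k) / n) ^ 2 = 0 :=
    (mul_eq_zero.1 (by linarith : b * ∑ k, (v k - (∑ k, v k) / n) ^ 2 = 0)).resolve_left hb.ne'
  have h6 : ∑ k, v k = 0 := pow_eq_zero_iff two_ne_zero |>.1
    ((mul_eq_zero.1 (by linarith : κ * (∑ k, v k) ^ 2 = 0)).resolve_left hκ.ne')
  ext k
  have h7 := (Finset.sum_eq_zero_iff_of_nonneg fun k _ => sq_nonneg _).1 h5 k (Finset.mem_univ k)
  rw [h6, zero_div, sub_zero] at h7
  exact pow_eq_zero_iff two_ne_zero |>.1 h7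

/-- Completing the square: the centre of the quadric has all coordinates equal to
`w₀ / (κ n)`, where `κ = w₀² - (a - b / n)`. -/
lemma ellipsoidForm_eq (hn : 0 < n) {κ : ℝ} (hκ : 0 < κ) (hκ' : κ = w₀ ^ 2 - (a - b * (n : ℝ)⁻¹))
    (v : Fin n → ℝ) : ellipsoidForm n b κ v =
      quadric a b w₀ (fun k => v k + w₀ / κ / n) + (a - b * (n : ℝ)⁻¹) / κ := by
  have hn' : (0 : ℝ) < n := by exact_mod_cast hn
  have ha : a = w₀ ^ 2 - κ + b * (n : ℝ)⁻¹ := by rw [hκ']; ring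
  simp only [ellipsoidForm, quadric, add_sq, Finset.sum_add_distrib, ← Finset.sum_mul,
    ← Finset.mul_sum, Finset.sum_const, Finset.card_univ, Fintype.card_fin, nsmul_eq_mul]
  rw [ha]
  field_simp
  ring

/-- If no point of nonnegative height has a vanishing coordinate, the ellipsoid lies in the open
positive orthant: otherwise, shrinking a point of the ellipsoid towards the centre until the last
of its negative coordinates vanishes yields a forbidden point. -/
lemma pos_of_ellipsoidForm_eq (hn : 0 < n) (hw₀ : 0 < w₀) {κ : ℝ} (hκ : 0 < κ)
    (hκ' : κ = w₀ ^ 2 - (a - b * (n : ℝ)⁻¹)) (hM : 0 < a - b * (n : ℝ)⁻¹)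
    (hz : ∀ u : UnitSphere n, 0 ≤ height a b u → ∀ k, u.1 k ≠ 0) {v : Fin n → ℝ}
    (hv : ellipsoidForm n b κ v = (a - b * (n : ℝ)⁻¹) / κ) (k : Fin n) : 0 < v k + w₀ / κ / n := by
  have hn' : (0 : ℝ) < n := by exact_mod_cast hn
  set c := w₀ / κ / n with hc
  have hcpos : 0 < c := by positivity
  by_contra hk
  have : Nonempty (Fin n) := ⟨⟨0, hn⟩⟩
  obtain ⟨j, -, hj⟩ := Finset.exists_min_image Finset.univ v Finset.univ_nonempty
  have hjc : v j ≤ -c := by linarith [hj k (Finset.mem_univ k)]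
  have hj0 : 0 < -v j := by linarith
  let t := c / -v j
  have ht0 : 0 < t := div_pos hcpos hj0
  have ht1 : t ≤ 1 := (div_le_one hj0).2 (by linarith)
  have htj : t * v j + c = 0 := by
    have : t * -v j = c := div_mul_cancel₀ _ hj0.ne'
    linarith
  have hnn : ∀ i, 0 ≤ (t • v) i + c := fun i => by
    have := mul_le_mul_of_nonneg_left (hj i (Finset.mem_univ i)) ht0.le
    change 0 ≤ t * v i + c
    linarith
  have hq : quadric a b w₀ (fun i => (t • v) i + c) ≤ 0 := by
    have h1 := ellipsoidForm_eq hn hκ hκ' (t • v)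
    rw [ellipsoidForm_smul, hv] at h1
    have h2 : t ^ 2 * ((a - b * (n : ℝ)⁻¹) / κ) ≤ (a - b * (n : ℝ)⁻¹) / κ :=
      mul_le_of_le_one_left (by positivity) (pow_le_one₀ ht0.le ht1)
    linarith
  have hs := sum_pos_of_quadric hnn hq
  have hh := height_signedRoot_normalize (a := a) (b := b) (w₀ := w₀) (fun _ => true) hnn hs
  refine hz (signedRoot (fun _ => true) (normalize _ hnn hs)) ?_ j ?_
  · refine nonneg_of_mul_nonneg_left ?_ (pow_pos hs 2)
    rw [hh]
    have := sq_nonneg (1 - w₀ * ∑ i, ((t • v) i + c))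
    linarith
  · rw [← pow_eq_zero_iff two_ne_zero, signedRoot_sq]
    change (t * v j + c) / _ = 0
    rw [htj, zero_div]

/-- A part over an orthant that does not touch the other parts is an ellipsoid. -/
lemma isConnectedSphere_piece (hn : 2 ≤ n) (hb : 0 < b) (hw₀ : 0 < w₀)
    (hM : 0 < a - b * (n : ℝ)⁻¹) (hMw : a - b * (n : ℝ)⁻¹ < w₀ ^ 2)
    (hz : ∀ u : UnitSphere n, 0 ≤ height a b u → ∀ k, u.1 k ≠ 0) (ε : Fin n → Bool) :
    IsConnectedSphere A (piece (height (n := n) a b) w₀ (orthant ε)) n := by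
  have hn0 : 0 < n := by omega
  obtain ⟨κ, hκ'⟩ : ∃ κ, κ = w₀ ^ 2 - (a - b * (n : ℝ)⁻¹) := ⟨_, rfl⟩
  have hκ : 0 < κ := by rw [hκ']; linarith
  have hsph := isConnectedSphere_levelSet A hn (G := ellipsoidForm n b κ)
    (by unfold ellipsoidForm; fun_prop) (ellipsoidForm_smul κ)
    (fun v hv => ellipsoidForm_pos hn0 hb hκ hv) (div_pos hM hκ)
  have hfwd : ∀ z : {z : Fin n → ℝ // (∀ k, 0 ≤ z k) ∧ quadric a b w₀ z = 0},
      ellipsoidForm n b κ (fun k => z.1 k - w₀ / κ / n) = (a - b * (n : ℝ)⁻¹) / κ := fun z => by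
    rw [ellipsoidForm_eq hn0 hκ hκ']
    simp only [sub_add_cancel]
    rw [z.2.2, zero_add]
  have hbwd : ∀ v : {v : Fin n → ℝ // ellipsoidForm n b κ v = (a - b * (n : ℝ)⁻¹) / κ},
      (∀ k, 0 ≤ v.1 k + w₀ / κ / n) ∧ quadric a b w₀ (fun k => v.1 k + w₀ / κ / n) = 0 :=
    fun v => ⟨fun k => (pos_of_ellipsoidForm_eq hn0 hw₀ hκ hκ' hM hz v.2 k).le, by
      have := ellipsoidForm_eq hn0 hκ hκ' v.1
      rw [v.2] at this
      linarith⟩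
  let e : {z : Fin n → ℝ // (∀ k, 0 ≤ z k) ∧ quadric a b w₀ z = 0} ≃ₜ
      {v : Fin n → ℝ // ellipsoidForm n b κ v = (a - b * (n : ℝ)⁻¹) / κ} :=
    { toFun := fun z => ⟨fun k => z.1 k - w₀ / κ / n, hfwd z⟩
      invFun := fun v => ⟨fun k => v.1 k + w₀ / κ / n, hbwd v⟩
      left_inv := fun z => Subtype.ext (funext fun k => sub_add_cancel _ _)
      right_inv := fun v => Subtype.ext (funext fun k => add_sub_cancel_right _ _)
      continuous_toFun := by
        refine Continuous.subtype_mk (continuous_pi fun k => ?_) _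
        exact ((continuous_apply k).comp continuous_subtype_val).sub continuous_const
      continuous_invFun := by
        refine Continuous.subtype_mk (continuous_pi fun k => ?_) _
        exact ((continuous_apply k).comp continuous_subtype_val).add continuous_const }
  exact hsph.of_homotopyEquiv ((pieceHomeomorph ε).trans e).toHomotopyEquiv

end Sheets

end

noncomputable section

open CBQuartic Components Chain UnitSphere

variable {A : Type u} [CommRing A]

namespace Sheets

variable {n : ℕ} {a b w₀ : ℝ}

/-! ### Sheets with the upper one separate from the lower one -/

lemma contractibleSpace_orthant_sublevel {ε : Fin n → Bool} (hb : b ≤ 0) (c : ℝ)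
    (hne : {u : UnitSphere n | u ∈ orthant ε ∧ height a b u < c}.Nonempty) :
    ContractibleSpace {u : UnitSphere n | u ∈ orthant ε ∧ height a b u < c} := by
  let K : Set (Fin n → ℝ) := {y | y ∈ stdSimplex ℝ (Fin n) ∧ -b * ∑ k, y k ^ 2 < c - a}
  have hK : Convex ℝ K := by
    have hf : ConvexOn ℝ (stdSimplex ℝ (Fin n)) fun y : Fin n → ℝ => -b * ∑ k, y k ^ 2 := by
      refine ⟨convex_stdSimplex ℝ _, fun y _ z _ s t hs ht hst => ?_⟩
      simp only [smul_eq_mul, Finset.mul_sum, ← Finset.sum_add_distrib, Pi.add_apply, Pi.smul_apply]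
      refine Finset.sum_le_sum fun k _ => ?_
      obtain rfl : s = 1 - t := by linarith
      have h1 : 0 ≤ -b * ((1 - t) * t * (y k - z k) ^ 2) :=
        mul_nonneg (neg_nonneg.2 hb) (mul_nonneg (mul_nonneg hs ht) (sq_nonneg _))
      linarith
    exact hf.convex_lt (c - a)
  let e : {u : UnitSphere n | u ∈ orthant ε ∧ height a b u < c} ≃ₜ K :=
    { toFun := fun u => ⟨squares u.1, (squares u.1).2, by
        have h1 : a - b * quartic u.1 < c := u.2.2
        rw [quartic_eq] at h1
        change -b * ∑ k, squares u.1 k ^ 2 < c - a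
        linarith⟩
      invFun := fun y => ⟨signedRoot ε ⟨y.1, y.2.1⟩, signedRoot_mem_orthant _ _, by
        have h1 : -b * ∑ k, y.1 k ^ 2 < c - a := y.2.2
        rw [height, quartic_signedRoot]
        change a - b * ∑ k, y.1 k ^ 2 < c
        linarith⟩
      left_inv := fun u => Subtype.ext (signedRoot_squares u.2.1)
      right_inv := fun y => Subtype.ext (funext fun k => signedRoot_sq ε _ k)
      continuous_toFun := by
        refine Continuous.subtype_mk ?_ _
        exact continuous_subtype_val.comp (continuous_squares.comp continuous_subtype_val)
      continuous_invFun := by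
        refine Continuous.subtype_mk ?_ _
        exact (continuous_signedRoot ε).comp (continuous_subtype_val.subtype_mk _) }
  obtain ⟨u, hu⟩ := hne
  have : ContractibleSpace K := hK.contractibleSpace ⟨_, (e ⟨u, hu⟩).2⟩
  exact e.contractibleSpace

/-- If there are as many components as possible, the lower sheet consists of one contractible part
over each orthant. -/
lemma bettiDetermined_of_lower_orthant [Nontrivial A] (hn : 2 ≤ n) (hb : b ≤ 0)
    (hm : 0 < a - b * (n : ℝ)⁻¹) (h0 : 0 < w₀) (hmw : a - b * (n : ℝ)⁻¹ < w₀ ^ 2)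
    (hM : w₀ ^ 2 ≤ a - b) : BettiDetermined A n (Sheets (height (n := n) a b) w₀) := by
  have hc := UnitSphere.continuous_height (n := n) a b
  have H := peakCover_neg_height_orthant (n := n) (by omega) a hb
  have hge : ∀ u : UnitSphere n, a - b * (n : ℝ)⁻¹ ≤ height a b u :=
    fun u => neg_le_neg_iff.1 (H.le u)
  obtain ⟨hup, hcomp⟩ := numCompactComponents_le_one_of_lower hn hc H hm h0 hmw hM
  let P : Option (Fin n → Bool) → Set (Sheets (height (n := n) a b) w₀) := fun o =>
    o.elim {x | w₀ ≤ x.1.2} fun ε => lowerPiece _ _ (orthant ε)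
  have hP : ∀ o, IsPreconnected (P o)
    | none => hup.isPreconnected
    | some ε => isPreconnected_lowerPiece H hc hm ε
  have hcov : ∀ x, ∃ o, x ∈ P o := fun x => by
    rcases le_or_gt w₀ x.1.2 with h | h
    · exact ⟨none, h⟩
    · obtain ⟨ε, hε⟩ := H.cover x.1.1
      exact ⟨some ε, hε, h⟩
  have hcard : Fintype.card (Option (Fin n → Bool)) = 2 ^ n + 1 := by simp
  have h4 := BettiDetermined.four_le hn
  refine ⟨fun h => ?_, fun h => ?_, fun h => ?_⟩
  · obtain ⟨π, hπ, hfib⟩ := exists_isLocallyConstant P hP hcov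
      (h.trans (by rw [hcard]; push_cast; rfl))
    have hS := isConnectedSphere_unitSphere A hn
    have e : π ⁻¹' {none} ≃ₜ UnitSphere n :=
      (homeomorphOfSign hc Set.univ 1 (by norm_num)
        (fun u _ => ⟨hm.le.trans (hge u), by positivity⟩) _
        (fun x => by rw [(hfib none).2]; simp [P])).trans (Homeomorph.Set.univ _)
    have hsph := hS.of_homotopyEquiv e.toHomotopyEquiv
    have hcon : ∀ ε, ContractibleSpace (π ⁻¹' {some ε}) := fun ε => by
      have hmem : ∀ x : Sheets (height (n := n) a b) w₀, x ∈ π ⁻¹' {some ε} ↔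
          x.1.1 ∈ {u : UnitSphere n | u ∈ orthant ε ∧ height a b u < w₀ ^ 2} ∧
            0 ≤ -1 * (x.1.2 - w₀) := fun x => by
        rw [(hfib (some ε)).2]
        have h1 := x.2.1
        have h2 := x.2.2
        constructor
        · rintro ⟨hx, hxw⟩
          refine ⟨⟨hx, ?_⟩, by linarith⟩
          rw [← h2]
          nlinarith
        · rintro ⟨⟨hx, -⟩, hxw⟩
          refine ⟨hx, lt_of_le_of_ne (by linarith) fun heq => ?_⟩
          rw [heq, sub_self] at h2
          linarith [hge x.1.1]
      obtain ⟨x, hx⟩ := (hfib (some ε)).1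
      have := contractibleSpace_orthant_sublevel (a := a) (ε := ε) hb (w₀ ^ 2)
        ⟨x.1.1, ((hmem x).1 ((hfib _).2.symm ▸ hx)).1⟩
      exact (homeomorphOfSign hc _ (-1) (by norm_num) (fun u hu =>
        ⟨hm.le.trans (hge u), by linarith [sqrt_lt h0 hu.2]⟩) _ hmem).contractibleSpace
    have := hasBetti_of_fibers (A := A) hπ hn {none} (fun o ho => by
      rw [Finset.mem_singleton.1 ho]; exact hsph) (fun o ho => by
      obtain ⟨ε, rfl⟩ := Option.ne_none_iff_exists'.1 fun h => ho (Finset.mem_singleton.2 h)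
      exact hcon ε)
    rwa [hcard, Finset.card_singleton] at this
  · rw [h] at hcomp
    have : 2 ^ n ≤ 1 := by exact_mod_cast hcomp
    omega
  · rw [h] at hcomp
    have : 2 ≤ 1 := by exact_mod_cast hcomp
    omega

lemma two_mul_add_one_le (hn : 3 ≤ n) : 2 * n + 1 ≤ 2 ^ n := by
  induction n, hn using Nat.le_induction with
  | base => norm_num
  | succ k _ ih => rw [pow_succ]; omega

/-- If the lower sheet has its lowest points over the unit vectors, there are too few components for
`2 ^ n + 1` when `n ≥ 3`. -/
lemma bettiDetermined_of_lower_cone (hn : 3 ≤ n) (hb : 0 ≤ b) (hm : 0 < a - b) (h0 : 0 < w₀)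
    (hmw : a - b < w₀ ^ 2) (hM : w₀ ^ 2 ≤ a - b * (n : ℝ)⁻¹) :
    BettiDetermined A n (Sheets (height (n := n) a b) w₀) := by
  have hc := UnitSphere.continuous_height (n := n) a b
  have H := peakCover_neg_height_cone (n := n) (by omega) a hb
  obtain ⟨hup, hcomp⟩ := numCompactComponents_le_one_of_lower (by omega) hc H hm h0 hmw hM
  let P : Option (Fin n × Bool) → Set (Sheets (height (n := n) a b) w₀) := fun o =>
    o.elim {x | w₀ ≤ x.1.2} fun i => lowerPiece _ _ (cone i)
  have hP : ∀ o, IsPreconnected (P o)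
    | none => hup.isPreconnected
    | some i => isPreconnected_lowerPiece H hc hm i
  have hcov : ∀ x, ∃ o, x ∈ P o := fun x => by
    rcases le_or_gt w₀ x.1.2 with h | h
    · exact ⟨none, h⟩
    · obtain ⟨i, hi⟩ := H.cover x.1.1
      exact ⟨some i, hi, h⟩
  refine BettiDetermined.of_le (by omega) ((numComponents_le P hP hcov).trans ?_) hcomp
  have := two_mul_add_one_le hn
  have hcard : Fintype.card (Option (Fin n × Bool)) ≤ 2 ^ n := by
    simp only [Fintype.card_option, Fintype.card_prod, Fintype.card_fin, Fintype.card_bool]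
    omega
  exact_mod_cast hcard

/-! ### The plane: exchanging the axes with the diagonals -/

/-- The reflection of the plane that exchanges the coordinate axes with the diagonals. -/
def diagonalReflection : UnitSphere 2 ≃ₜ UnitSphere 2 :=
  have hs : ∀ u : UnitSphere 2,
      ∑ k, (![(u.1 0 + u.1 1) / √2, (u.1 0 - u.1 1) / √2] : Fin 2 → ℝ) k ^ 2 = 1 := fun u => by
    have h1 := u.2
    rw [Fin.sum_univ_two] at h1 ⊢
    simp only [Matrix.cons_val_zero, Matrix.cons_val_one, div_pow,
      Real.sq_sqrt (zero_le_two (α := ℝ))]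
    linarith
  let F : UnitSphere 2 → UnitSphere 2 := fun u => ⟨_, hs u⟩
  have h0 : ∀ u, (F u).1 0 = (u.1 0 + u.1 1) / √2 := fun u => rfl
  have h1 : ∀ u, (F u).1 1 = (u.1 0 - u.1 1) / √2 := fun u => rfl
  have hF : ∀ u, F (F u) = u := fun u => by
    have h2 : √2 * √2 = (2 : ℝ) := Real.mul_self_sqrt zero_le_two
    refine Subtype.ext (funext fun k => ?_)
    fin_cases k
    · change (F (F u)).1 0 = u.1 0
      rw [h0, h0, h1, ← add_div, div_div, h2]
      ring
    · change (F (F u)).1 1 = u.1 1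
      rw [h1, h0, h1, ← sub_div, div_div, h2]
      ring
  have hc : Continuous F := by
    refine Continuous.subtype_mk (continuous_pi fun k => ?_) _
    have c0 := continuous_coord (n := 2) 0
    have c1 := continuous_coord (n := 2) 1
    fin_cases k
    · exact (c0.add c1).div_const _
    · exact (c0.sub c1).div_const _
  { toFun := F, invFun := F, left_inv := hF, right_inv := hF, continuous_toFun := hc
    continuous_invFun := hc }

lemma quartic_diagonalReflection (u : UnitSphere 2) : quartic (diagonalReflection u) = 3 / 2 - quartic u := by
  have h1 := u.2
  rw [Fin.sum_univ_two] at h1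
  have h4 : √2 ^ 4 = (4 : ℝ) := by
    rw [show (4 : ℕ) = 2 * 2 from rfl, pow_mul, Real.sq_sqrt zero_le_two]; norm_num
  rw [quartic, quartic, Fin.sum_univ_two, Fin.sum_univ_two]
  change ((u.1 0 + u.1 1) / √2) ^ 4 + ((u.1 0 - u.1 1) / √2) ^ 4 = _
  rw [div_pow, div_pow, h4]
  linear_combination (3 / 2 * (u.1 0 ^ 2 + u.1 1 ^ 2) + 3 / 2) * h1

/-- A homeomorphism of the base that respects the heights induces one of the sheets. -/
def congrBase {S S' : Type} [TopologicalSpace S] [TopologicalSpace S'] {h : S → ℝ} {h' : S' → ℝ}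
    (e : S ≃ₜ S') (he : ∀ u, h' (e u) = h u) : Sheets h w₀ ≃ₜ Sheets h' w₀ where
  toFun x := ⟨(e x.1.1, x.1.2), x.2.1, x.2.2.trans (he _).symm⟩
  invFun x := ⟨(e.symm x.1.1, x.1.2), x.2.1, x.2.2.trans (by rw [← he, e.apply_symm_apply])⟩
  left_inv x := Subtype.ext (Prod.ext (e.symm_apply_apply _) rfl)
  right_inv x := Subtype.ext (Prod.ext (e.apply_symm_apply _) rfl)
  continuous_toFun := by fun_prop
  continuous_invFun := by fun_prop

lemma bettiDetermined_diagonalReflection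
    (h : BettiDetermined A 2 (Sheets (height (n := 2) (a - 3 / 2 * b) (-b)) w₀)) :
    BettiDetermined A 2 (Sheets (height (n := 2) a b) w₀) :=
  h.of_homeomorph (congrBase diagonalReflection fun u => by
    rw [height, quartic_diagonalReflection, height]; ring)

end Sheets

end

noncomputable section

open CBQuartic Components Chain UnitSphere

variable {A : Type u} [CommRing A]

namespace Sheets

variable {n : ℕ} {a b w₀ : ℝ}

/-! ### The case analysis -/

/-- Compact sheets over a base with peaks in the orthants: either there is one component, or there
are `2 ^ n` ellipsoids. -/
lemma bettiDetermined_of_orthant [Nontrivial A] (hn : 2 ≤ n) (hb : 0 < b) (hm : a - b ≤ 0)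
    (hM : 0 < a - b * (n : ℝ)⁻¹) (h0 : 0 < w₀) (hMw : a - b * (n : ℝ)⁻¹ < w₀ ^ 2) :
    BettiDetermined A n (Sheets (height (n := n) a b) w₀) := by
  have hc := UnitSphere.continuous_height (n := n) a b
  have H := peakCover_height_orthant (n := n) (by omega) a hb.le
  have := compactSpace hc h0 fun u => (H.le u).trans_lt hMw
  rcases orthant_dichotomy (n := n) (by omega) hb.le hm hM.le h0 with h | hz
  · exact BettiDetermined.of_le_one hn h
  obtain ⟨π, hπ, hfib, hnum⟩ := exists_isLocallyConstant_piece H hc isClosed_orthant hm hM.le h0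
    (orthant_disjoint hz)
  have hcard : Fintype.card (Fin n → Bool) = 2 ^ n := by simp
  rw [hcard] at hnum
  have h4 := BettiDetermined.four_le hn
  refine BettiDetermined.of_numCompactComponents_eq hnum (numCompactComponents_eq.trans hnum) le_rfl
    (fun _ => ?_) fun h => by omega
  have := hasBetti_of_fibers (A := A) hπ hn Finset.univ (fun ε _ => by
    rw [hfib]; exact isConnectedSphere_piece A hn hb h0 hM hMw hz ε)
    fun ε hε => absurd (Finset.mem_univ ε) hε
  rwa [Finset.card_univ, hcard] at this

/-- Compact sheets over a base with peaks at the unit vectors: for `n ≥ 3`, the numbers of components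
`1` and `2 * n` do not occur in any of the configurations. -/
lemma bettiDetermined_of_cone (hn : 3 ≤ n) (hb : b ≤ 0) (hm : a - b * (n : ℝ)⁻¹ ≤ 0)
    (hM : 0 < a - b) (h0 : 0 < w₀) (hMw : a - b < w₀ ^ 2) :
    BettiDetermined A n (Sheets (height (n := n) a b) w₀) := by
  have hc := UnitSphere.continuous_height (n := n) a b
  have H := peakCover_height_cone (n := n) (by omega) a hb
  have := compactSpace hc h0 fun u => (H.le u).trans_lt hMw
  rcases cone_dichotomy (n := n) (by omega) hb hm hM.le h0 with h | hdisj
  · exact BettiDetermined.of_le_one (by omega) h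
  obtain ⟨-, -, -, hnum⟩ := exists_isLocallyConstant_piece H hc isClosed_cone hm hM.le h0 hdisj
  have hcard : Fintype.card (Fin n × Bool) = 2 * n := by simp [mul_comm]
  have := two_mul_add_one_le hn
  rw [hcard] at hnum
  exact BettiDetermined.of_numCompactComponents_eq hnum (numCompactComponents_eq.trans hnum)
    (by omega) (fun h => by omega) fun h => by omega

/-- The height has a cover with peaks in the orthants for `b ≥ 0`, and at the unit vectors for
`b ≤ 0`. -/
lemma exists_peakCover (hn : 2 ≤ n) (a b : ℝ) :
    ∃ (ι : Type) (_ : Fintype ι) (T : ι → Set (UnitSphere n)),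
      PeakCover (height a b) (min (a - b) (a - b * (n : ℝ)⁻¹)) (max (a - b) (a - b * (n : ℝ)⁻¹)) T ∧
      Fintype.card ι ≤ 2 ^ n := by
  have hr : (n : ℝ)⁻¹ ≤ 1 := inv_le_one_of_one_le₀ (by exact_mod_cast (by omega : 1 ≤ n))
  rcases le_total 0 b with hb | hb
  · have h : a - b ≤ a - b * (n : ℝ)⁻¹ := by nlinarith
    rw [min_eq_left h, max_eq_right h]
    exact ⟨_, inferInstance, _, peakCover_height_orthant (by omega) a hb, by simp⟩
  · have h : a - b * (n : ℝ)⁻¹ ≤ a - b := by nlinarith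
    rw [min_eq_right h, max_eq_left h]
    refine ⟨_, inferInstance, _, peakCover_height_cone (by omega) a hb, ?_⟩
    rw [Fintype.card_prod, Fintype.card_fin, Fintype.card_bool]
    rcases hn.eq_or_lt with rfl | hn
    · norm_num
    · have := two_mul_add_one_le hn
      omega

/-- If the largest value of a nonconstant height is zero, then all points lie over its finitely many
maxima. -/
lemma finite_of_max_eq_zero (hn : 0 < n) (hb : b ≠ 0)
    (hM : max (a - b) (a - b * (n : ℝ)⁻¹) = 0) : Finite (Sheets (height (n := n) a b) w₀) := by
  have hn' : (0 : ℝ) < n := by exact_mod_cast hn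
  have hr : (n : ℝ)⁻¹ ≤ 1 := inv_le_one_of_one_le₀ (by exact_mod_cast hn)
  have hr0 : 0 < (n : ℝ)⁻¹ := by positivity
  have hle : ∀ u : UnitSphere n, height a b u ≤ 0 := fun u => by
    rcases le_total 0 b with h | h
    · exact ((peakCover_height_orthant hn a h).le u).trans ((le_max_right _ _).trans_eq hM)
    · exact ((peakCover_height_cone hn a h).le u).trans ((le_max_left _ _).trans_eq hM)
  have hzero : ∀ x : Sheets (height (n := n) a b) w₀, height a b x.1.1 = 0 ∧ x.1.2 = w₀ := fun x => by
    have h1 := le_antisymm (hle x.1.1) x.nonneg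
    have h2 := x.2.2
    rw [h1] at h2
    exact ⟨h1, sub_eq_zero.1 (pow_eq_zero_iff two_ne_zero |>.1 h2)⟩
  have hcoord : ∀ (x : Sheets (height (n := n) a b) w₀) k,
      x.1.1.1 k ∈ ({0, 1, -1, √(n : ℝ)⁻¹, -√(n : ℝ)⁻¹} : Set ℝ) := by
    intro x k
    have hx := (hzero x).1
    have hs : ∑ k, x.1.1.1 k ^ 2 = 1 := x.1.1.2
    rw [height] at hx
    have hq : quartic x.1.1 = ∑ k, (x.1.1.1 k ^ 2) ^ 2 :=
      Finset.sum_congr rfl fun k _ => by rw [← pow_mul]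
    rcases hb.lt_or_gt with h | h
    · have h1 : a - b = 0 := by
        rwa [max_eq_left (by nlinarith)] at hM
      have h2 : quartic x.1.1 = 1 := by
        have : b * (1 - quartic x.1.1) = 0 := by linarith
        linarith [(mul_eq_zero.1 this).resolve_left hb]
      have h3 : ∑ k, x.1.1.1 k ^ 2 * (1 - x.1.1.1 k ^ 2) = 0 := by
        simp only [mul_sub, mul_one, ← sq, Finset.sum_sub_distrib]
        rw [hs, ← hq, h2, sub_self]
      have hle1 : ∀ k, x.1.1.1 k ^ 2 ≤ 1 := fun k => le_one_apply (squares x.1.1) k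
      have h4 := (Finset.sum_eq_zero_iff_of_nonneg fun k _ =>
        mul_nonneg (sq_nonneg (x.1.1.1 k)) (sub_nonneg.2 (hle1 k))).1 h3 k (Finset.mem_univ k)
      rcases mul_eq_zero.1 h4 with h5 | h5
      · simp [pow_eq_zero_iff two_ne_zero |>.1 h5]
      · rcases sq_eq_sq_iff_eq_or_eq_neg.1
          ((sub_eq_zero.1 h5).symm.trans (one_pow 2).symm) with h6 | h6 <;> simp [h6]
    · have h1 : a - b * (n : ℝ)⁻¹ = 0 := by
        rwa [max_eq_right (by nlinarith)] at hM
      have h2 : quartic x.1.1 = (n : ℝ)⁻¹ := by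
        have : b * ((n : ℝ)⁻¹ - quartic x.1.1) = 0 := by linarith
        linarith [(mul_eq_zero.1 this).resolve_left hb]
      have h3 : ∑ k, (x.1.1.1 k ^ 2 - (n : ℝ)⁻¹) ^ 2 = 0 := by
        simp only [sub_sq, Finset.sum_add_distrib, Finset.sum_sub_distrib, ← Finset.sum_mul,
          ← Finset.mul_sum, hs, Finset.sum_const, Finset.card_univ, Fintype.card_fin, nsmul_eq_mul]
        rw [← hq, h2]
        field_simp
        ring
      have h4 := (Finset.sum_eq_zero_iff_of_nonneg fun k _ => sq_nonneg _).1 h3 k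
        (Finset.mem_univ k)
      have h5 : x.1.1.1 k ^ 2 = √(n : ℝ)⁻¹ ^ 2 := by
        rw [Real.sq_sqrt hr0.le]
        exact sub_eq_zero.1 (pow_eq_zero_iff two_ne_zero |>.1 h4)
      rcases sq_eq_sq_iff_eq_or_eq_neg.1 h5 with h6 | h6 <;> simp [h6]
  have hfin : Finite ({0, 1, -1, √(n : ℝ)⁻¹, -√(n : ℝ)⁻¹} : Set ℝ) := Set.toFinite _
  refine Finite.of_injective (fun x k => (⟨x.1.1.1 k, hcoord x k⟩ :
    ({0, 1, -1, √(n : ℝ)⁻¹, -√(n : ℝ)⁻¹} : Set ℝ))) fun x y hxy => ?_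
  refine Subtype.ext (Prod.ext (Subtype.ext (funext fun k => ?_)) ?_)
  · exact congrArg Subtype.val (congrFun hxy k)
  · rw [(hzero x).2, (hzero y).2]

/-- The sheets over the sphere. The hypothesis excludes the case of finitely many points, where the
number of compact components can be `2 ^ n` although all of them are isolated points. -/
theorem bettiDetermined [Nontrivial A] (hn : 2 ≤ n)
    (hfin : Finite (Sheets (height (n := n) a b) w₀) → IsEmpty (Sheets (height (n := n) a b) w₀)) :
    BettiDetermined A n (Sheets (height (n := n) a b) w₀) := by
  have hc := UnitSphere.continuous_height (n := n) a b
  have := pathConnectedSpace_unitSphere hn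
  have hr : (n : ℝ)⁻¹ ≤ 1 := inv_le_one_of_one_le₀ (by exact_mod_cast (by omega : 1 ≤ n))
  obtain ⟨ι, _, T, H, hcard⟩ := exists_peakCover hn a b
  have hcard : (Fintype.card ι : Cardinal) ≤ (2 ^ n : ℕ) := by exact_mod_cast hcard
  have hempty : IsEmpty (Sheets (height (n := n) a b) w₀) →
      BettiDetermined A n (Sheets (height (n := n) a b) w₀) := fun h =>
    BettiDetermined.of_le_one hn numComponents_le_one
  set m := min (a - b) (a - b * (n : ℝ)⁻¹)
  set M := max (a - b) (a - b * (n : ℝ)⁻¹)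
  have hbpos : 0 ≤ b → m = a - b ∧ M = a - b * (n : ℝ)⁻¹ := fun h => by
    have h : a - b ≤ a - b * (n : ℝ)⁻¹ := by nlinarith
    exact ⟨min_eq_left h, max_eq_right h⟩
  have hbneg : b ≤ 0 → m = a - b * (n : ℝ)⁻¹ ∧ M = a - b := fun h => by
    have h : a - b * (n : ℝ)⁻¹ ≤ a - b := by nlinarith
    exact ⟨min_eq_right h, max_eq_left h⟩
  have h2 : n = 2 → a - 3 / 2 * b - -b = a - b * (n : ℝ)⁻¹ ∧
      a - 3 / 2 * b - -b * (n : ℝ)⁻¹ = a - b := by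
    rintro rfl
    constructor <;> push_cast <;> ring
  -- the numbers `m ≤ M` are the extrema of the height, to be compared with `0` and `w₀ ^ 2`
  rcases le_or_gt m 0 with hm | hm
  · rcases le_or_gt w₀ 0 with h0 | h0
    · exact BettiDetermined.of_le hn ((numComponents_le_card H hc (Or.inl hm)).trans hcard)
        (numCompactComponents_le_one_of_peakCover H hc (Or.inr ⟨h0, hm.trans (sq_nonneg _)⟩))
    rcases le_or_gt (w₀ ^ 2) M with hMw | hMw
    · exact BettiDetermined.of_le hn ((numComponents_le_card H hc (Or.inl hm)).trans hcard)
        (numCompactComponents_le_one_of_peakCover H hc (Or.inl ⟨hm, h0, hMw⟩))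
    -- from here on, the sheets stay away from height zero and form a compact space
    rcases lt_trichotomy M 0 with hM | hM | hM
    · exact hempty ⟨fun x => absurd (x.nonneg.trans (H.le _)) (not_le.2 hM)⟩
    · rcases eq_or_ne b 0 with rfl | hb
      · have h1 : ∀ u : UnitSphere n, height a 0 u = 0 := fun u => by
          have h1 := (hbpos le_rfl).2
          rw [zero_mul] at h1
          rw [height, zero_mul]
          linarith
        refine BettiDetermined.of_le_one hn (numComponents_le_one_of_upper hc
          (fun u => by rw [h1]; simpa using h0) fun x => ?_)
        have h3 := x.2.2
        rw [h1] at h3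
        exact (sub_eq_zero.1 (pow_eq_zero_iff two_ne_zero |>.1 h3)).ge
      · exact hempty (hfin (finite_of_max_eq_zero (by omega) hb hM))
    · rcases lt_trichotomy b 0 with hb | rfl | hb
      · obtain ⟨e1, e2⟩ := hbneg hb.le
        rw [e1] at hm
        rw [e2] at hM hMw
        rcases hn.eq_or_lt with rfl | hn
        · obtain ⟨e3, e4⟩ := h2 rfl
          exact bettiDetermined_diagonalReflection (bettiDetermined_of_orthant le_rfl (neg_pos.2 hb)
            (by rwa [e3]) (by rwa [e4]) h0 (by rwa [e4]))
        · exact bettiDetermined_of_cone hn hb.le hm hM h0 hMw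
      · have := (hbpos le_rfl).1
        have := (hbpos le_rfl).2
        linarith
      · obtain ⟨e1, e2⟩ := hbpos hb.le
        rw [e1] at hm
        rw [e2] at hM hMw
        exact bettiDetermined_of_orthant hn hb hm hM h0 hMw
  · have hge : ∀ u : UnitSphere n, m ≤ height a b u := H.ge
    have hsqrt : ∀ u : UnitSphere n, √m ≤ √(height a b u) := fun u => Real.sqrt_le_sqrt (hge u)
    rcases le_or_gt w₀ 0 with h0 | h0
    · rcases le_or_gt m (w₀ ^ 2) with hmw | hmw
      · exact BettiDetermined.of_le hn ((numComponents_le_card H hc (Or.inr h0)).trans hcard)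
          (numCompactComponents_le_one_of_peakCover H hc (Or.inr ⟨h0, hmw⟩))
      · refine BettiDetermined.of_le_one hn (numComponents_le_one_of_upper hc
          (fun u => ⟨hm.le.trans (hge u), ?_⟩) fun x => h0.trans x.2.1.le)
        have h3 : -w₀ < √m := Real.lt_sqrt_of_sq_lt (by rwa [neg_sq])
        linarith [hsqrt u]
    rcases le_or_gt (w₀ ^ 2) m with hmw | hmw
    · refine BettiDetermined.of_le_one hn (numComponents_le_one_of_upper hc
        (fun u => ⟨hm.le.trans (hge u), by positivity⟩) fun x => not_lt.1 fun hx => ?_)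
      have h3 := x.2.1
      have h4 := x.2.2
      have h5 := hge x.1.1
      nlinarith
    rcases lt_or_ge M (w₀ ^ 2) with hMw | hMw
    · exact bettiDetermined_of_two_sheets hn hc h0 (fun u => hm.trans_le (hge u))
        fun u => (H.le u).trans_lt hMw
    -- the upper sheet is a sphere and the lower one is cut off at height zero
    rcases le_or_gt b 0 with hb | hb
    · obtain ⟨e1, e2⟩ := hbneg hb
      rw [e1] at hm hmw
      rw [e2] at hMw
      exact bettiDetermined_of_lower_orthant hn hb hm h0 hmw hMw
    · obtain ⟨e1, e2⟩ := hbpos hb.le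
      rw [e1] at hm hmw
      rw [e2] at hMw
      rcases hn.eq_or_lt with rfl | hn
      · obtain ⟨e3, e4⟩ := h2 rfl
        exact bettiDetermined_diagonalReflection (bettiDetermined_of_lower_orthant le_rfl
          (neg_nonpos.2 hb.le) (by rwa [e4]) h0 (by rwa [e4]) (by rwa [e3]))
      · exact bettiDetermined_of_lower_cone hn hb.le hm h0 hmw hMw

end Sheets

end

noncomputable section

open CBQuartic Components Chain UnitSphere

/-! ### Invariant polynomials of degree four -/

section Invariant

variable {n : ℕ}

/-- The function is of the form `α ∑ x_k⁴ + β (∑ x_k²)² + γ ∑ x_k² + δ`. -/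
def IsInvariantQuartic (φ : (Fin n → ℝ) → ℝ) : Prop :=
  ∃ α β γ δ : ℝ, ∀ x, φ x = α * ∑ k, x k ^ 4 + β * (∑ k, x k ^ 2) ^ 2 + γ * ∑ k, x k ^ 2 + δ

lemma IsInvariantQuartic.const_mul {φ : (Fin n → ℝ) → ℝ} (h : IsInvariantQuartic φ) (c : ℝ) :
    IsInvariantQuartic fun x => c * φ x := by
  obtain ⟨α, β, γ, δ, h⟩ := h
  exact ⟨c * α, c * β, c * γ, c * δ, fun x => by simp only [h]; ring⟩

lemma IsInvariantQuartic.sum {ι : Type*} {s : Finset ι} {φ : ι → (Fin n → ℝ) → ℝ}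
    (h : ∀ i ∈ s, IsInvariantQuartic (φ i)) : IsInvariantQuartic fun x => ∑ i ∈ s, φ i x := by
  classical
  induction s using Finset.induction with
  | empty => exact ⟨0, 0, 0, 0, fun x => by simp⟩
  | insert i s hi ih =>
    obtain ⟨α, β, γ, δ, h1⟩ := h i (Finset.mem_insert_self i s)
    obtain ⟨α', β', γ', δ', h2⟩ := ih fun j hj => h j (Finset.mem_insert_of_mem hj)
    exact ⟨α + α', β + β', γ + γ', δ + δ', fun x => by
      simp only [Finset.sum_insert hi, h1, h2]
      ring⟩

lemma sum_perm_congr (φ : Equiv.Perm (Fin n) → ℝ) (τ : Equiv.Perm (Fin n)) :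
    ∑ σ, φ (σ * τ) = ∑ σ, φ σ := Equiv.sum_comp (Equiv.mulRight τ) φ

lemma mul_sum_perm (g : Fin n → ℝ) (i : Fin n) :
    n * ∑ σ : Equiv.Perm (Fin n), g (σ i) = n.factorial * ∑ k, g k := by
  have h : ∀ j, ∑ σ : Equiv.Perm (Fin n), g (σ j) = ∑ σ : Equiv.Perm (Fin n), g (σ i) := fun j => by
    rw [← sum_perm_congr (fun σ => g (σ j)) (Equiv.swap j i)]
    simp [Equiv.Perm.mul_apply]
  calc n * ∑ σ : Equiv.Perm (Fin n), g (σ i) = ∑ j, ∑ σ : Equiv.Perm (Fin n), g (σ j) := by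
        simp [h]
    _ = ∑ σ : Equiv.Perm (Fin n), ∑ k, g k := by
        rw [Finset.sum_comm]
        exact Finset.sum_congr rfl fun σ _ => Equiv.sum_comp σ g
    _ = n.factorial * ∑ k, g k := by simp [Fintype.card_perm]

lemma mul_sum_perm_pair (g : Fin n → ℝ) {i j : Fin n} (hij : i ≠ j) :
    n * ((n - 1) * ∑ σ : Equiv.Perm (Fin n), g (σ i) * g (σ j)) =
      n.factorial * ((∑ k, g k) ^ 2 - ∑ k, g k ^ 2) := by
  have h : ∀ i' j', i' ≠ j' → ∑ σ : Equiv.Perm (Fin n), g (σ i') * g (σ j') =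
      ∑ σ : Equiv.Perm (Fin n), g (σ i) * g (σ j) := fun i' j' h' => by
    obtain ⟨τ, hi, hj⟩ := exists_perm_pair h' hij
    rw [← sum_perm_congr (fun σ => g (σ i) * g (σ j)) τ]
    simp [Equiv.Perm.mul_apply, hi, hj]
  have h1 : ∀ i', ∑ j', ∑ σ : Equiv.Perm (Fin n), g (σ i') * g (σ j') =
      ∑ σ : Equiv.Perm (Fin n), g (σ i') ^ 2 +
        (n - 1) * ∑ σ : Equiv.Perm (Fin n), g (σ i) * g (σ j) := fun i' => by
    rw [← Finset.add_sum_erase _ _ (Finset.mem_univ i'),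
      Finset.sum_congr rfl fun j' hj' => h i' j' (Finset.ne_of_mem_erase hj').symm,
      Finset.sum_const, Finset.card_erase_of_mem (Finset.mem_univ _), Finset.card_univ,
      Fintype.card_fin, nsmul_eq_mul, Nat.cast_pred (Fin.pos i)]
    simp only [sq]
  have h2 : ∑ i', ∑ j', ∑ σ : Equiv.Perm (Fin n), g (σ i') * g (σ j') =
      n.factorial * (∑ k, g k) ^ 2 := by
    have : ∀ σ : Equiv.Perm (Fin n), ∑ i', ∑ j', g (σ i') * g (σ j') = (∑ k, g k) ^ 2 := fun σ => by
      rw [← Finset.sum_mul_sum, Equiv.sum_comp σ g, sq]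
    simp only [Finset.sum_comm (s := Finset.univ (α := Fin n))
      (t := Finset.univ (α := Equiv.Perm (Fin n))), this]
    simp [Fintype.card_perm]
  have h3 := mul_sum_perm (fun k => g k ^ 2) i
  have h4 : ∑ i', ∑ σ : Equiv.Perm (Fin n), g (σ i') ^ 2 = n.factorial * ∑ k, g k ^ 2 := by
    rw [Finset.sum_comm]
    rw [Finset.sum_congr rfl fun (σ : Equiv.Perm (Fin n)) _ => Equiv.sum_comp σ fun k => g k ^ 2]
    simp [Fintype.card_perm]
  simp only [h1, Finset.sum_add_distrib, Finset.sum_const, Finset.card_univ, Fintype.card_fin,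
    nsmul_eq_mul] at h2
  rw [h4] at h2
  linarith

/-- The exponents that survive symmetrization over the signs. -/
lemma exponent_cases (d : Fin n →₀ ℕ) (he : ∀ k, Even (d k)) (hd : ∑ k, d k ≤ 4) :
    d = 0 ∨ (∃ i, d = Finsupp.single i 2) ∨
      ∃ i j, d = Finsupp.single i 2 + Finsupp.single j 2 := by
  have step : ∀ d : Fin n →₀ ℕ, (∀ k, Even (d k)) → d ≠ 0 → ∃ i, ∃ d' : Fin n →₀ ℕ,
      d = Finsupp.single i 2 + d' ∧ (∀ k, Even (d' k)) ∧ ∑ k, d k = 2 + ∑ k, d' k := by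
    intro d he hd
    obtain ⟨i, hi⟩ := Finsupp.ne_iff.1 hd
    have h2 : 2 ≤ d i := by
      obtain ⟨r, hr⟩ := he i
      have : d i ≠ 0 := hi
      omega
    have heq : d = Finsupp.single i 2 + (d - Finsupp.single i 2) :=
      (add_tsub_cancel_of_le (Finsupp.single_le_iff.2 h2)).symm
    refine ⟨i, d - Finsupp.single i 2, heq, fun k => ?_, ?_⟩
    · rw [Finsupp.tsub_apply, Finsupp.single_apply]
      split_ifs
      · exact (Nat.even_sub (by rename_i h; rwa [← h])).2 (iff_of_true (he k) even_two)
      · exact he k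
    · conv_lhs => rw [heq]
      simp [Finset.sum_add_distrib, Finsupp.single_apply]
  by_cases h0 : d = 0
  · exact Or.inl h0
  obtain ⟨i, d', hd', he', hs'⟩ := step d he h0
  by_cases h0' : d' = 0
  · exact Or.inr (Or.inl ⟨i, by rw [hd', h0', add_zero]⟩)
  obtain ⟨j, d'', hd'', he'', hs''⟩ := step d' he' h0'
  refine Or.inr (Or.inr ⟨i, j, ?_⟩)
  have : d'' = 0 := Finsupp.ext fun k => by
    have h1 : ∑ k, d'' k = 0 := by omega
    exact (Finset.sum_eq_zero_iff.1 h1) k (Finset.mem_univ k)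
  rw [hd', hd'', this, add_zero]

lemma prod_pow_single (z : Fin n → ℝ) (i : Fin n) (m : ℕ) :
    ∏ k, z k ^ (Finsupp.single i m : Fin n →₀ ℕ) k = z i ^ m := by
  rw [Finset.prod_eq_single i (fun k _ hk => by rw [Finsupp.single_eq_of_ne hk, pow_zero])
    (fun h => absurd (Finset.mem_univ i) h), Finsupp.single_eq_same]

lemma isInvariantQuartic_sum_perm (d : Fin n →₀ ℕ) (he : ∀ k, Even (d k)) (hd : ∑ k, d k ≤ 4) :
    IsInvariantQuartic fun x : Fin n → ℝ =>
      ∑ σ : Equiv.Perm (Fin n), ∏ k, x (σ k) ^ d k := by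
  rcases exponent_cases d he hd with rfl | ⟨i, rfl⟩ | ⟨i, j, rfl⟩
  · exact ⟨0, 0, 0, n.factorial, fun x => by simp [Fintype.card_perm]⟩
  · have hn : (n : ℝ) ≠ 0 := by exact_mod_cast (Fin.pos i).ne'
    refine ⟨0, 0, n.factorial / n, 0, fun x => ?_⟩
    have h1 : ∑ σ : Equiv.Perm (Fin n), ∏ k, x (σ k) ^ (Finsupp.single i 2 : Fin n →₀ ℕ) k =
        ∑ σ : Equiv.Perm (Fin n), x (σ i) ^ 2 :=
      Finset.sum_congr rfl fun σ _ => prod_pow_single (fun k => x (σ k)) i 2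
    have h2 := mul_sum_perm (fun k => x k ^ 2) i
    simp only [h1]
    field_simp
    linarith
  · have hprod : ∀ x : Fin n → ℝ, ∑ σ : Equiv.Perm (Fin n),
        ∏ k, x (σ k) ^ (Finsupp.single i 2 + Finsupp.single j 2 : Fin n →₀ ℕ) k =
          ∑ σ : Equiv.Perm (Fin n), x (σ i) ^ 2 * x (σ j) ^ 2 := fun x =>
      Finset.sum_congr rfl fun σ _ => by
        simp only [Finsupp.add_apply, pow_add, Finset.prod_mul_distrib]
        rw [prod_pow_single (fun k => x (σ k)), prod_pow_single (fun k => x (σ k))]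
    have hn : (n : ℝ) ≠ 0 := by exact_mod_cast (Fin.pos i).ne'
    rcases eq_or_ne i j with rfl | hij
    · refine ⟨n.factorial / n, 0, 0, 0, fun x => ?_⟩
      have h2 := mul_sum_perm (fun k => x k ^ 4) i
      simp only [hprod, ← pow_add, Nat.reduceAdd]
      field_simp
      linarith
    · have hn1 : (n - 1 : ℝ) ≠ 0 := by
        have h2 : 2 ≤ n := by
          have := i.2
          have := j.2
          have : (i : ℕ) ≠ j := fun h => hij (Fin.ext h)
          omega
        have : (2 : ℝ) ≤ n := by exact_mod_cast h2
        linarith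
      refine ⟨-(n.factorial / (n * (n - 1))), n.factorial / (n * (n - 1)), 0, 0, fun x => ?_⟩
      have h2 := mul_sum_perm_pair (fun k => x k ^ 2) hij
      simp only [← pow_mul, Nat.reduceMul] at h2
      simp only [hprod]
      field_simp
      linarith

/-- Invariance under the signed permutation matrix with entries `sgn (s k)` at `(k, σ k)`. -/
lemma eval_signed_perm {f : MvPolynomial (Fin n) ℝ} (hf : IsCBInvariant f) (s : Fin n → Bool)
    (σ : Equiv.Perm (Fin n)) (v : Fin n → ℝ) :
    MvPolynomial.eval (fun k => sgn (s k) * v (σ k)) f = MvPolynomial.eval v f := by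
  have hs : ∀ k, sgn (s k) ≠ 0 := fun k => by cases s k <;> simp [sgn]
  have h := hf (Matrix.of fun i j => if σ i = j then sgn (s i) else 0) ⟨fun i => ?_, fun j => ?_,
    fun i j h => ?_⟩ v
  · rw [← h]
    congr 2
    ext k
    simp [Matrix.mulVec, dotProduct]
  · exact ⟨σ i, by simp [hs], fun j hj => by
      by_contra hne
      exact hj (if_neg (Ne.symm hne))⟩
  · exact ⟨σ.symm j, by simp [hs], fun i hi => by
      by_contra hne
      exact hi (if_neg fun h => hne (by rw [← h, Equiv.symm_apply_apply]))⟩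
  · simp only [Matrix.of_apply] at h ⊢
    split_ifs at h ⊢ with hij
    · cases s i <;> simp [sgn]
    · exact absurd rfl h

/-- The sum over all signed permutations kills the monomials with an odd exponent and symmetrizes the
others. -/
theorem isInvariantQuartic_eval {f : MvPolynomial (Fin n) ℝ} (hf : IsCBInvariant f)
    (hd : f.totalDegree ≤ 4) : IsInvariantQuartic fun x => MvPolynomial.eval x f := by
  have key : ∀ x, (Fintype.card (Equiv.Perm (Fin n)) * 2 ^ n : ℝ) * MvPolynomial.eval x f =
      ∑ d ∈ f.support, (f.coeff d * ∏ k, ∑ c, sgn c ^ d k) *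
        ∑ σ : Equiv.Perm (Fin n), ∏ k, x (σ k) ^ d k := by
    intro x
    calc (Fintype.card (Equiv.Perm (Fin n)) * 2 ^ n : ℝ) * MvPolynomial.eval x f
        = ∑ σ : Equiv.Perm (Fin n), ∑ s : Fin n → Bool,
          MvPolynomial.eval (fun k => sgn (s k) * x (σ k)) f := by
          simp [eval_signed_perm hf, mul_assoc]
      _ = ∑ σ : Equiv.Perm (Fin n), ∑ s : Fin n → Bool, ∑ d ∈ f.support,
          f.coeff d * ((∏ k, sgn (s k) ^ d k) * ∏ k, x (σ k) ^ d k) := by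
          simp only [MvPolynomial.eval_eq', mul_pow, Finset.prod_mul_distrib]
      _ = ∑ σ : Equiv.Perm (Fin n), ∑ d ∈ f.support,
          f.coeff d * ((∏ k, ∑ c, sgn c ^ d k) * ∏ k, x (σ k) ^ d k) := by
          refine Finset.sum_congr rfl fun σ _ => ?_
          rw [Finset.sum_comm]
          refine Finset.sum_congr rfl fun d _ => ?_
          rw [← Finset.mul_sum, ← Finset.sum_mul, Finset.prod_univ_sum, Fintype.piFinset_univ]
      _ = _ := by
          rw [Finset.sum_comm]
          refine Finset.sum_congr rfl fun d _ => ?_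
          rw [← Finset.mul_sum, ← Finset.mul_sum, mul_assoc]
  have hN : (Fintype.card (Equiv.Perm (Fin n)) * 2 ^ n : ℝ) ≠ 0 := by positivity
  have hsum : IsInvariantQuartic fun x : Fin n → ℝ => ∑ d ∈ f.support,
      (f.coeff d * ∏ k, ∑ c, sgn c ^ d k) * ∑ σ : Equiv.Perm (Fin n), ∏ k, x (σ k) ^ d k := by
    refine IsInvariantQuartic.sum fun d hds => ?_
    by_cases he : ∀ k, Even (d k)
    · refine (isInvariantQuartic_sum_perm d he ?_).const_mul _
      rw [← Finsupp.sum_fintype d (fun _ e => e) fun _ => rfl]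
      exact (MvPolynomial.le_totalDegree hds).trans hd
    · push Not at he
      obtain ⟨k, hk⟩ := he
      have h0 : ∏ k, ∑ c, sgn c ^ d k = 0 := Finset.prod_eq_zero (Finset.mem_univ k) (by
        simp [sgn, (Nat.not_even_iff_odd.1 hk).neg_one_pow])
      exact ⟨0, 0, 0, 0, fun x => by rw [h0]; ring⟩
  have := hsum.const_mul (Fintype.card (Equiv.Perm (Fin n)) * 2 ^ n : ℝ)⁻¹
  simp only [← key, inv_mul_cancel_left₀ hN] at this
  exact this

end Invariant

end

noncomputable section

open CBQuartic Components Chain UnitSphere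

/-! ### Zero loci as sheets -/

section ZeroLocus

variable {n : ℕ} {α β γ δ : ℝ}

/-- The zero locus of an invariant quartic function. -/
abbrev quarticLocus (n : ℕ) (α β γ δ : ℝ) : Set (Fin n → ℝ) :=
  {x | α * ∑ k, x k ^ 4 + β * (∑ k, x k ^ 2) ^ 2 + γ * ∑ k, x k ^ 2 + δ = 0}

lemma sum_sq_pos_of_ne {x : Fin n → ℝ} (hx : x ≠ 0) : 0 < ∑ k, x k ^ 2 := by
  obtain ⟨k, hk⟩ := Function.ne_iff.1 hx
  exact Finset.sum_pos' (fun _ _ => sq_nonneg _) ⟨k, Finset.mem_univ k, by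
    have : x k ≠ 0 := hk
    positivity⟩

lemma sum_sq_pos_of_mem (hδ : δ ≠ 0) {x : Fin n → ℝ} (hx : x ∈ quarticLocus n α β γ δ) :
    0 < ∑ k, x k ^ 2 := by
  refine sum_sq_pos_of_ne fun h => hδ ?_
  subst h
  simpa [quarticLocus] using hx

/-- Away from the origin, the zero locus is described by the direction `u = x / |x|` and by
`w = 1 / |x|²`, which is subject to a quadratic equation. -/
def quarticLocusHomeomorph (hδ : δ ≠ 0) : quarticLocus n α β γ δ ≃ₜ
    Sheets (height (n := n) ((γ / (2 * δ)) ^ 2 - β / δ) (α / δ)) (-(γ / (2 * δ))) :=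
  have hpos : ∀ x : quarticLocus n α β γ δ, 0 < ∑ k, x.1 k ^ 2 := fun x =>
    sum_sq_pos_of_mem hδ x.2
  have hsph : ∀ x : quarticLocus n α β γ δ, ∑ k, (x.1 k / √(∑ k, x.1 k ^ 2)) ^ 2 = 1 := fun x => by
    simp only [div_pow, Real.sq_sqrt (hpos x).le]
    rw [← Finset.sum_div, div_self (hpos x).ne']
  have heq : ∀ x : quarticLocus n α β γ δ, 0 < 1 / ∑ k, x.1 k ^ 2 ∧
      (1 / ∑ k, x.1 k ^ 2 - -(γ / (2 * δ))) ^ 2 =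
        height ((γ / (2 * δ)) ^ 2 - β / δ) (α / δ) (⟨_, hsph x⟩ : UnitSphere n) := fun x => by
    have h1 := hpos x
    refine ⟨by positivity, ?_⟩
    have h2 : quartic (⟨_, hsph x⟩ : UnitSphere n) = (∑ k, x.1 k ^ 4) / (∑ k, x.1 k ^ 2) ^ 2 := by
      rw [quartic, Finset.sum_div]
      refine Finset.sum_congr rfl fun k _ => ?_
      change (x.1 k / √(∑ k, x.1 k ^ 2)) ^ 4 = _
      rw [div_pow, show (4 : ℕ) = 2 * 2 from rfl, pow_mul √(∑ k, x.1 k ^ 2), Real.sq_sqrt h1.le]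
    have h3 : α * ∑ k, x.1 k ^ 4 + β * (∑ k, x.1 k ^ 2) ^ 2 + γ * ∑ k, x.1 k ^ 2 + δ = 0 := x.2
    rw [height, h2]
    field_simp
    linear_combination 4 * δ * h3
  have hmem : ∀ y : Sheets (height (n := n) ((γ / (2 * δ)) ^ 2 - β / δ) (α / δ)) (-(γ / (2 * δ))),
      (fun k => y.1.1.1 k / √y.1.2) ∈ quarticLocus n α β γ δ := fun y => by
    have h1 := y.2.1
    have h2 : (y.1.2 - -(γ / (2 * δ))) ^ 2 =
      (γ / (2 * δ)) ^ 2 - β / δ - α / δ * quartic y.1.1 := y.2.2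
    change α * ∑ k, (y.1.1.1 k / √y.1.2) ^ 4 + β * (∑ k, (y.1.1.1 k / √y.1.2) ^ 2) ^ 2 +
      γ * ∑ k, (y.1.1.1 k / √y.1.2) ^ 2 + δ = 0
    have h3 : √y.1.2 ^ 4 = y.1.2 ^ 2 := by
      rw [show (4 : ℕ) = 2 * 2 from rfl, pow_mul, Real.sq_sqrt h1.le]
    simp only [div_pow, h3, Real.sq_sqrt h1.le, ← Finset.sum_div]
    rw [y.1.1.2, ← show quartic y.1.1 = ∑ k, y.1.1.1 k ^ 4 from rfl]
    field_simp at h2 ⊢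
    refine mul_left_cancel₀ hδ ?_
    linear_combination h2 / 4
  have hsum : ∀ y : Sheets (height (n := n) ((γ / (2 * δ)) ^ 2 - β / δ) (α / δ)) (-(γ / (2 * δ))),
      ∑ k, (y.1.1.1 k / √y.1.2) ^ 2 = 1 / y.1.2 := fun y => by
    simp only [div_pow, Real.sq_sqrt y.2.1.le]
    rw [← Finset.sum_div, y.1.1.2]
  { toFun := fun x => ⟨(⟨_, hsph x⟩, 1 / ∑ k, x.1 k ^ 2), heq x⟩
    invFun := fun y => ⟨_, hmem y⟩
    left_inv := fun x => by
      refine Subtype.ext (funext fun k => ?_)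
      change x.1 k / √(∑ k, x.1 k ^ 2) / √(1 / ∑ k, x.1 k ^ 2) = x.1 k
      have := Real.sqrt_pos.2 (hpos x)
      rw [Real.sqrt_div zero_le_one, Real.sqrt_one]
      field_simp
    right_inv := fun y => by
      have h1 := Real.sqrt_pos.2 y.2.1
      refine Subtype.ext (Prod.ext (Subtype.ext (funext fun k => ?_)) ?_)
      · change y.1.1.1 k / √y.1.2 / √(∑ k, (y.1.1.1 k / √y.1.2) ^ 2) = y.1.1.1 k
        rw [hsum, Real.sqrt_div zero_le_one, Real.sqrt_one]
        field_simp
      · change 1 / ∑ k, (y.1.1.1 k / √y.1.2) ^ 2 = y.1.2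
        rw [hsum, one_div_one_div]
    continuous_toFun := by
      have h1 : ∀ k, Continuous fun x : quarticLocus n α β γ δ => x.1 k := fun k =>
        (continuous_apply k).comp continuous_subtype_val
      have h2 := continuous_finsetSum Finset.univ fun k _ => (h1 k).pow 2
      refine Continuous.subtype_mk (Continuous.prodMk (Continuous.subtype_mk
        (continuous_pi fun k => ?_) _) ?_) _
      · exact (h1 k).div h2.sqrt fun x => (Real.sqrt_pos.2 (hpos x)).ne'
      · exact continuous_const.div h2 fun x => (hpos x).ne'
    continuous_invFun := by
      refine Continuous.subtype_mk (continuous_pi fun k => ?_) _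
      exact ((continuous_coord k).comp (continuous_fst.comp continuous_subtype_val)).div
        Sheets.continuous_height.sqrt fun y => (Real.sqrt_pos.2 y.2.1).ne' }

/-- If the locus passes through the origin and the quadratic term does not vanish, then the origin
is an isolated point. -/
lemma not_preperfect_of_origin (hγ : γ ≠ 0) : ¬ Preperfect (quarticLocus n α β γ 0) := by
  intro h
  have h0 : (0 : Fin n → ℝ) ∈ quarticLocus n α β γ 0 := by simp [quarticLocus]
  have hU : IsOpen {x : Fin n → ℝ | (|α| + |β|) * ∑ k, x k ^ 2 < |γ|} :=
    isOpen_lt (by fun_prop) continuous_const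
  obtain ⟨x, ⟨hxU, hx⟩, hx0⟩ := accPt_iff_nhds.1 (h 0 h0) _ (hU.mem_nhds (by simpa using hγ))
  have hp := sum_sq_pos_of_ne hx0
  have hq : ∑ k, x k ^ 4 ≤ (∑ k, x k ^ 2) ^ 2 := by
    have := Finset.sum_sq_le_sq_sum_of_nonneg (s := Finset.univ) (f := fun k => x k ^ 2)
      fun k _ => sq_nonneg _
    simpa only [← pow_mul, Nat.reduceMul] using this
  have hq0 : 0 ≤ ∑ k, x k ^ 4 := Finset.sum_nonneg fun k _ => by positivity
  have hx : α * ∑ k, x k ^ 4 + β * (∑ k, x k ^ 2) ^ 2 + γ * ∑ k, x k ^ 2 + 0 = 0 := hx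
  have hxU : (|α| + |β|) * ∑ k, x k ^ 2 < |γ| := hxU
  set p := ∑ k, x k ^ 2
  set q := ∑ k, x k ^ 4
  have h1 : |γ| * p = |α * q + β * p ^ 2| := by
    rw [show α * q + β * p ^ 2 = -(γ * p) by linarith, abs_neg, abs_mul, abs_of_pos hp]
  have h2 : |α * q + β * p ^ 2| ≤ |α| * q + |β| * p ^ 2 := by
    refine (abs_add_le _ _).trans_eq ?_
    rw [abs_mul, abs_mul, abs_of_nonneg hq0, abs_of_nonneg (sq_nonneg p)]
  have h3 : |α| * q ≤ |α| * p ^ 2 := mul_le_mul_of_nonneg_left hq (abs_nonneg _)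
  have h4 := mul_lt_mul_of_pos_right hxU hp
  linarith

/-- A homogeneous locus is a cone. -/
lemma numComponents_le_one_of_homogeneous : numComponents (quarticLocus n α β 0 0) ≤ 1 := by
  have h0 : (0 : Fin n → ℝ) ∈ quarticLocus n α β 0 0 := by simp [quarticLocus]
  have hstar : StarConvex ℝ 0 (quarticLocus n α β 0 0) := by
    refine starConvex_zero_iff.2 fun x hx t _ _ => ?_
    have hx : α * ∑ k, x k ^ 4 + β * (∑ k, x k ^ 2) ^ 2 + 0 * ∑ k, x k ^ 2 + 0 = 0 := hx
    change α * ∑ k, (t * x k) ^ 4 + β * (∑ k, (t * x k) ^ 2) ^ 2 + 0 * ∑ k, (t * x k) ^ 2 + 0 = 0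
    simp only [mul_pow, ← Finset.mul_sum]
    linear_combination t ^ 4 * hx
  have := hstar.contractibleSpace ⟨0, h0⟩
  exact numComponents_le_one

theorem bettiDetermined_quarticLocus {A : Type u} [CommRing A] [Nontrivial A] (hn : 2 ≤ n)
    (hZ : Preperfect (quarticLocus n α β γ δ)) :
    BettiDetermined A n (quarticLocus n α β γ δ) := by
  rcases eq_or_ne δ 0 with rfl | hδ
  · rcases eq_or_ne γ 0 with rfl | hγ
    · exact BettiDetermined.of_le_one hn numComponents_le_one_of_homogeneous
    · exact absurd hZ (not_preperfect_of_origin hγ)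
  · refine (Sheets.bettiDetermined hn fun hfin => ?_).of_homeomorph (quarticLocusHomeomorph hδ)
    have : Finite (quarticLocus n α β γ δ) :=
      Finite.of_equiv _ (quarticLocusHomeomorph hδ).symm.toEquiv
    have := eq_empty_of_preperfect_of_finite hZ (Set.toFinite _)
    have : IsEmpty (quarticLocus n α β γ δ) := Set.isEmpty_coe_sort.2 this
    exact (quarticLocusHomeomorph hδ).symm.toEquiv.isEmpty

end ZeroLocus

end

theorem corollary3 {A : Type u} [CommRing A] [Nontrivial A] {n : ℕ} (hn : 2 ≤ n)
    (f : MvPolynomial (Fin n) ℝ) (hf : CBQuartic.IsCBInvariant f) (hdeg : f.totalDegree = 4)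
    -- the zero locus has no isolated points
    (hZ : Preperfect (CBQuartic.zeroLocus f)) :
    -- `2 ^ n + 1` connected components
    (CBQuartic.numComponents (CBQuartic.zeroLocus f) = 2 ^ n + 1 →
      (∀ i, Module.Free A (CBQuartic.singularHomology A (CBQuartic.zeroLocus f) i)) ∧
      CBQuartic.bettiNumber A (CBQuartic.zeroLocus f) 0 = 2 ^ n + 1 ∧
      CBQuartic.bettiNumber A (CBQuartic.zeroLocus f) (n - 1) = 1 ∧
      ∀ i, i ≠ 0 → i ≠ n - 1 → CBQuartic.bettiNumber A (CBQuartic.zeroLocus f) i = 0) ∧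
    -- `2 ^ n` compact connected components
    (CBQuartic.numCompactComponents (CBQuartic.zeroLocus f) = 2 ^ n →
      (∀ i, Module.Free A (CBQuartic.singularHomology A (CBQuartic.zeroLocus f) i)) ∧
      CBQuartic.bettiNumber A (CBQuartic.zeroLocus f) 0 = 2 ^ n ∧
      CBQuartic.bettiNumber A (CBQuartic.zeroLocus f) (n - 1) = 2 ^ n ∧
      ∀ i, i ≠ 0 → i ≠ n - 1 → CBQuartic.bettiNumber A (CBQuartic.zeroLocus f) i = 0) ∧
    -- `2` compact connected components
    (CBQuartic.numCompactComponents (CBQuartic.zeroLocus f) = 2 →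
      (∀ i, Module.Free A (CBQuartic.singularHomology A (CBQuartic.zeroLocus f) i)) ∧
      CBQuartic.bettiNumber A (CBQuartic.zeroLocus f) 0 = 2 ∧
      CBQuartic.bettiNumber A (CBQuartic.zeroLocus f) (n - 1) = 2 ∧
      ∀ i, i ≠ 0 → i ≠ n - 1 → CBQuartic.bettiNumber A (CBQuartic.zeroLocus f) i = 0) := by
  obtain ⟨α, β, γ, δ, hform⟩ := isInvariantQuartic_eval hf hdeg.le
  have hlocus : CBQuartic.zeroLocus f = quarticLocus n α β γ δ := by
    ext x
    change MvPolynomial.eval x f = 0 ↔ _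
    rw [show MvPolynomial.eval x f = _ from hform x]
    rfl
  rw [hlocus] at hZ ⊢
  obtain ⟨h1, h2, h3⟩ := bettiDetermined_quarticLocus (A := A) hn hZ
  refine ⟨fun h => ?_, fun h => ?_, fun h => ?_⟩
  · simpa [Chain.HasBetti] using h1 h
  · simpa [Chain.HasBetti] using h2 h
  · simpa [Chain.HasBetti] using h3 h
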